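/- **Notation.** For an open connected subset $U$ of a finite-dimensional real vector space with base point $x_0$, let $\pi_1(U,x_0)$ be its fundamental group, where $[\gamma][\gamma']$ is the class of "first $\gamma$, then $\gamma'$". For a group $G$ let $G_k=\{g\in G: g-1\in J^k\}$, with $J$ the augmentation ideal of $\mathbb Z G$, and $G_\infty=\bigcap_{k\ge1}G_k$. For 1-forms $\omega_1,\dots,\omega_q$ and a piecewise smooth loop $\gamma$ with $\gamma^*\omega_i=\alpha_i(t)\,dt$, the iterated integral is $$\int_\gamma\omega_1\cdots\omega_q=\int_{0\le t_1\le\dots\le t_q\le1}\alpha_1(t_1)\cdots\alpha_q(t_q)\,dt_1\cdots dt_q .$$ **Holonomy orderings.** Let $X_1,\dots,X_m$ be a homogeneous basis of the real homology of $U$ in positive degrees, and let $\widehat{TH}=\mathbb R\langle\langle X_1,\dots,X_m\rangle\rangle$, graded by giving a letter of homological degree $p$ the degree $p-1$. Let $\widehat J$ be the ideal of series without constant term. A *formal homology connection* $(\bar\omega,\delta)$ consists of a series $\bar\omega=\sum_I\omega_IX_I$ without constant term, where $\omega_I$ is a smooth form on $U$ of degree $\deg X_I+1$ and $\omega_i$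 is closed and represents the cohomology class dual to $X_i$, and of a continuous graded derivation $\delta$ of $\widehat{TH}$, lowering the degree by one, with $\delta^2=0$ and $\delta X_i\in\widehat J^2$, such that $d\bar\omega+\delta\bar\omega=\varepsilon(\bar\omega)\wedge\bar\omega$, where $\varepsilon(\alpha)=(-1)^{\deg\alpha}\alpha$ and $\delta\bar\omega=\sum_I\omega_I\,\delta X_I$. Let $R$ be the quotient of the degree $0$ part of $\widehat{TH}$ by the degree $0$ part of $\delta(\widehat{TH})$, filtered by the images $\mathcal F^kR$ of the degree $0$ parts of the powers $\widehat J^k$. Let $\omega$ be the degree $0$ part of $\bar\omega$. The *holonomy map* $\Theta:\pi_1(U,x_0)\to R$ sends the class of a piecewise smooth loop $\gamma$ to the class of $1+\sum_{k\ge1}\int_\gamma\omega\cdots\omega$ ($k$ factors). Let $\{v_i\}_{i\in\mathcal I}$ be a homogeneous basis of the filtered space $R$ indexed by a well-ordered set, with non-decreasing degree: the $v_i$ of degree $k$ form a basis of a complement $R^k$ of $\mathcal F^{k+1}R$ in $\mathcal F^kR$. Let $\{v_i^*\}$ be the dual basis of linear functionals, where $v_i^*$ vanishes on $\mathcal F^{\deg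 v_i+1}R$. The *holonomy ordering* of $G/G_\infty$, $G=\pi_1(U,x_0)$, defined by these data is: $a<b$ if and only if $v_i^*(\Theta(a))<v_i^*(\Theta(b))$ for the first $i$ at which these two numbers differ. **Magnus ordering.** Let $F_n$ be the free group on $x_1,\dots,x_n$ and let $\mu:F_n\to\mathbb R\langle\langle X_1,\dots,X_n\rangle\rangle$ be the homomorphism with $\mu(x_i)=1+X_i$. Order monomials by DegLex: by length first, and lexicographically by indices for equal length. Then $a<_Mb$ if and only if, at the DegLex-first monomial at which the coefficients of $\mu(a)$ and $\mu(b)$ differ, the coefficient of $\mu(b)$ is the bigger one. **Proposition.** The Magnus ordering $<_M$ of $F_n$ is a holonomy ordering. More precisely, let $D_n$ be the open unit disc in $\mathbb C$ with $n\ge0$ distinct points removed, and let $x_0\in D_n$. Then $\pi_1(D_n,x_0)$ is free of rank $n$ and $\pi_1(D_n,x_0)_\infty=\{1\}$. Let $e:F_n\to\pi_1(D_n,x_0)$ be any isomorphism. Then: 1. The ordering of $\pi_1(D_n,x_0)=\pi_1(D_n,x_0)/\pi_1(D_n,x_0)_\infty$ that corresponds to $<_M$ under $e$ is a holonomy ordering.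 2. There are smooth closed 1-forms $\omega_1,\dots,\omega_n$ on $D_n$ with $\omega_i\wedge\omega_j=0$ for all $i,j$ and $\int_{e(x_j)}\omega_i=\delta_{ij}$. 3. For every system $\omega_1,\dots,\omega_n$ as in 2, with $X_1,\dots,X_n$ of homological degree $1$, the pair $(\sum_i\omega_iX_i,\,0)$ is a formal homology connection on $D_n$, its holonomy map is an injective multiplicative map $\Theta:\pi_1(D_n,x_0)\to\mathbb R\langle\langle X_1,\dots,X_n\rangle\rangle$, the monomials in DegLex order are an ordered homogeneous basis with non-decreasing degree, and the ordering in 1 is the holonomy ordering defined by $(\sum_i\omega_iX_i,0)$ and this basis. -/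

import Mathlib

noncomputable section

/-! ### Non-commutative formal power series -/

/-- `ℝ⟨⟨X_i : i ∈ ι⟩⟩`: a series is the family of its coefficients, indexed by the words
(lists of letters) in `ι`; the word `[i₁, …, i_k]` stands for the monomial `X_{i₁} ⋯ X_{i_k}`. -/
@[ext] structure NCSeries (ι : Type) where
  /-- the coefficient at a word -/
  coeff : List ι → ℝ

namespace NCSeries

variable {ι : Type}

instance : Zero (NCSeries ι) := ⟨⟨fun _ => 0⟩⟩
instance : Add (NCSeries ι) := ⟨fun f g => ⟨fun w => f.coeff w + g.coeff w⟩⟩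
instance : Neg (NCSeries ι) := ⟨fun f => ⟨fun w => -f.coeff w⟩⟩
instance : SMul ℝ (NCSeries ι) := ⟨fun c f => ⟨fun w => c * f.coeff w⟩⟩

/-- The monomial `X_w`. -/
def monomial (w : List ι) : NCSeries ι :=
  open Classical in ⟨fun u => if u = w then 1 else 0⟩

instance : One (NCSeries ι) := ⟨monomial []⟩

/-- Product of series: the coefficient at `w` is the sum of `f_u g_v` over all `w = u ++ v`. -/
instance : Mul (NCSeries ι) :=
  ⟨fun f g =>
    ⟨fun w => ∑ k ∈ Finset.range (w.length + 1), f.coeff (w.take k) * g.coeff (w.drop k)⟩⟩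

@[simp] theorem coeff_zero (w : List ι) : (0 : NCSeries ι).coeff w = 0 := rfl
@[simp] theorem coeff_add (f g : NCSeries ι) (w : List ι) :
    (f + g).coeff w = f.coeff w + g.coeff w := rfl
@[simp] theorem coeff_neg (f : NCSeries ι) (w : List ι) : (-f).coeff w = -f.coeff w := rfl
@[simp] theorem coeff_smul (c : ℝ) (f : NCSeries ι) (w : List ι) :
    (c • f).coeff w = c * f.coeff w := rfl

theorem coeff_monomial (w u : List ι) [Decidable (u = w)] :
    (monomial w).coeff u = if u = w then 1 else 0 := by
  by_cases h : u = w <;> simp [monomial, h]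

theorem coeff_one (w : List ι) [Decidable (w = [])] :
    (1 : NCSeries ι).coeff w = if w = [] then 1 else 0 :=
  coeff_monomial [] w

theorem coeff_mul (f g : NCSeries ι) (w : List ι) : (f * g).coeff w =
    ∑ k ∈ Finset.range (w.length + 1), f.coeff (w.take k) * g.coeff (w.drop k) := rfl

/-- The series of the coefficients of the words that start with `a`, with that letter removed. -/
def shift (a : ι) (f : NCSeries ι) : NCSeries ι := ⟨fun w => f.coeff (a :: w)⟩

theorem coeff_cons (f : NCSeries ι) (a : ι) (w : List ι) :
    f.coeff (a :: w) = (shift a f).coeff w := rfl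

theorem mul_nil (f g : NCSeries ι) : (f * g).coeff [] = f.coeff [] * g.coeff [] := by
  simp [coeff_mul]

theorem mul_cons (f g : NCSeries ι) (a : ι) (w : List ι) :
    (f * g).coeff (a :: w) = f.coeff [] * g.coeff (a :: w) + (shift a f * g).coeff w := by
  rw [coeff_mul, coeff_mul, List.length_cons, Finset.sum_range_succ', add_comm]
  simp [shift]

theorem ext_coeff {f g : NCSeries ι} (h : ∀ w, f.coeff w = g.coeff w) : f = g :=
  NCSeries.ext (funext h)

protected theorem zero_mul (f : NCSeries ι) : 0 * f = 0 :=
  ext_coeff fun w => by simp [coeff_mul]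

protected theorem one_mul (f : NCSeries ι) : 1 * f = f := by
  classical
  refine ext_coeff fun w => ?_
  cases w with
  | nil => simp [mul_nil, coeff_one]
  | cons a w =>
    have h : shift a (1 : NCSeries ι) = 0 :=
      ext_coeff fun u => by rw [← coeff_cons]; simp [coeff_one]
    rw [mul_cons, h, NCSeries.zero_mul]
    simp [coeff_one]

protected theorem mul_one (f : NCSeries ι) : f * 1 = f := by
  classical
  refine ext_coeff fun w => ?_
  induction w generalizing f with
  | nil => simp [mul_nil, coeff_one]
  | cons a w ih =>
    rw [mul_cons, ih]
    simp [coeff_one, ← coeff_cons]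

protected theorem add_mul (f g h : NCSeries ι) : (f + g) * h = f * h + g * h :=
  ext_coeff fun w => by simp [coeff_mul, add_mul, Finset.sum_add_distrib]

protected theorem mul_add (f g h : NCSeries ι) : f * (g + h) = f * g + f * h :=
  ext_coeff fun w => by simp [coeff_mul, mul_add, Finset.sum_add_distrib]

protected theorem smul_mul (c : ℝ) (f g : NCSeries ι) : (c • f) * g = c • (f * g) :=
  ext_coeff fun w => by simp [coeff_mul, Finset.mul_sum, mul_assoc]

protected theorem mul_smul (c : ℝ) (f g : NCSeries ι) : f * (c • g) = c • (f * g) :=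
  ext_coeff fun w => by simp [coeff_mul, Finset.mul_sum, mul_left_comm]

theorem shift_mul (a : ι) (f g : NCSeries ι) :
    shift a (f * g) = f.coeff [] • shift a g + shift a f * g :=
  ext_coeff fun w => mul_cons f g a w

protected theorem mul_assoc (f g h : NCSeries ι) : f * g * h = f * (g * h) := by
  refine ext_coeff fun w => ?_
  induction w generalizing f with
  | nil => simp [mul_nil, _root_.mul_assoc]
  | cons a w ih =>
    rw [mul_cons, mul_cons f, shift_mul, NCSeries.add_mul, NCSeries.smul_mul, coeff_add, ih,
      mul_cons g, mul_nil, coeff_smul]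
    ring

instance : Ring (NCSeries ι) where
  add_assoc f g h := ext_coeff fun w => by simp [add_assoc]
  zero_add f := ext_coeff fun w => by simp
  add_zero f := ext_coeff fun w => by simp
  add_comm f g := ext_coeff fun w => by simp [add_comm]
  neg_add_cancel f := ext_coeff fun w => by simp
  nsmul := nsmulRec
  zsmul := zsmulRec
  zero_mul := NCSeries.zero_mul
  mul_zero f := ext_coeff fun w => by simp [coeff_mul]
  one_mul := NCSeries.one_mul
  mul_one := NCSeries.mul_one
  left_distrib := NCSeries.mul_add
  right_distrib := NCSeries.add_mul
  mul_assoc := NCSeries.mul_assoc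

@[simp] theorem coeff_sub (f g : NCSeries ι) (w : List ι) :
    (f - g).coeff w = f.coeff w - g.coeff w := by
  rw [sub_eq_add_neg, coeff_add, coeff_neg, sub_eq_add_neg]

instance : Module ℝ (NCSeries ι) where
  one_smul f := ext_coeff fun w => by simp
  mul_smul a b f := ext_coeff fun w => by simp [mul_assoc]
  smul_zero a := ext_coeff fun w => by simp
  smul_add a f g := ext_coeff fun w => by simp [mul_add]
  add_smul a b f := ext_coeff fun w => by simp [add_mul]
  zero_smul f := ext_coeff fun w => by simp

instance : Algebra ℝ (NCSeries ι) := Algebra.ofModule NCSeries.smul_mul NCSeries.mul_smul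

/-- The variable `X_i`. -/
def X (i : ι) : NCSeries ι := monomial [i]

/-- `1 - X_i + X_i² - X_i³ + ⋯`. -/
def altGeom (i : ι) : NCSeries ι :=
  open Classical in ⟨fun w => if ∀ a ∈ w, a = i then (-1) ^ w.length else 0⟩

theorem shift_one_add_X (i a : ι) [Decidable (a = i)] :
    shift a (1 + X i) = if a = i then 1 else 0 := by
  classical
  refine ext_coeff fun w => ?_
  rw [← coeff_cons, X, coeff_add, coeff_one, coeff_monomial]
  by_cases h : a = i <;> simp [h, coeff_one]

theorem shift_altGeom (i a : ι) [Decidable (a = i)] :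
    shift a (altGeom i) = if a = i then -altGeom i else 0 := by
  classical
  refine ext_coeff fun w => ?_
  rw [← coeff_cons]
  by_cases h : a = i
  · by_cases h' : ∀ b ∈ w, b = i
    · have h'' : ∀ b ∈ a :: w, b = i := by simpa [h] using h'
      simp only [if_pos h, coeff_neg, altGeom, if_pos h', if_pos h'', List.length_cons, pow_succ]
      ring
    · have h'' : ¬ ∀ b ∈ a :: w, b = i := by simpa [h] using h'
      simp only [if_pos h, coeff_neg, altGeom, if_neg h', if_neg h'', neg_zero]
  · simp [altGeom, h]

theorem one_add_X_nil (i : ι) : (1 + X i : NCSeries ι).coeff [] = 1 := by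
  classical
  simp [X, coeff_monomial, coeff_one]

theorem altGeom_nil (i : ι) : (altGeom i : NCSeries ι).coeff [] = 1 := by
  simp [altGeom]

theorem one_add_X_mul_altGeom (i : ι) : (1 + X i) * altGeom i = 1 := by
  classical
  refine ext_coeff fun w => ?_
  cases w with
  | nil => rw [mul_nil, one_add_X_nil, altGeom_nil, coeff_one]; simp
  | cons a w =>
    rw [mul_cons, shift_one_add_X, one_add_X_nil, coeff_cons, shift_altGeom]
    by_cases hi : a = i <;> simp [hi, coeff_one]

theorem altGeom_mul_one_add_X (i : ι) : altGeom i * (1 + X i) = 1 := by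
  classical
  refine ext_coeff fun w => ?_
  induction w with
  | nil => rw [mul_nil, one_add_X_nil, altGeom_nil, coeff_one]; simp
  | cons a w ih =>
    rw [mul_cons, altGeom_nil, coeff_cons, shift_one_add_X, shift_altGeom]
    by_cases hi : a = i
    · rw [if_pos hi, if_pos hi, neg_mul, coeff_neg, ih]
      simp [coeff_one]
    · simp [hi, coeff_one]

/-- `1 + X_i` as a unit. -/
def oneAddX (i : ι) : (NCSeries ι)ˣ where
  val := 1 + X i
  inv := altGeom i
  val_inv := one_add_X_mul_altGeom i
  inv_val := altGeom_mul_one_add_X i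

end NCSeries

/-! ### The Magnus ordering -/

/-- The Magnus expansion `μ : F_n → ℝ⟨⟨X_1, …, X_n⟩⟩`, the homomorphism with `μ(x_i) = 1 + X_i`. -/
def magnus (n : ℕ) : FreeGroup (Fin n) →* NCSeries (Fin n) :=
  (Units.coeHom _).comp (FreeGroup.lift NCSeries.oneAddX)

theorem magnus_of (n : ℕ) (i : Fin n) :
    magnus n (FreeGroup.of i) = 1 + NCSeries.X i := by
  simp [magnus, NCSeries.oneAddX]

/-- The DegLex order on the words in `{1, …, n}`: shorter words first, words of equal length
in lexicographic order. -/
def degLexLT (n : ℕ) : List (Fin n) → List (Fin n) → Prop := List.Shortlex (· < ·)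

/-- The Magnus ordering of `F_n`: `a < b` if, at the DegLex-first word where `μ(a)` and `μ(b)` have
different coefficients, the coefficient of `μ(b)` is the bigger one. -/
def MagnusLT (n : ℕ) (a b : FreeGroup (Fin n)) : Prop :=
  Pi.Lex (degLexLT n) (· < ·) (magnus n a).coeff (magnus n b).coeff

/-! ### Dimension subgroups -/

/-- The augmentation ideal of the group ring `ℤ G`. -/
def augmentationIdeal (G : Type) [Group G] : Ideal (MonoidAlgebra ℤ G) :=
  RingHom.ker (MonoidAlgebra.lift ℤ ℤ G 1)

instance (G : Type) [Group G] : (augmentationIdeal G).IsTwoSided :=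
  inferInstanceAs (RingHom.ker (MonoidAlgebra.lift ℤ ℤ G 1)).IsTwoSided

/-- `G_k = {g | g - 1 ∈ J^k}`. -/
def dimensionSubgroup (G : Type) [Group G] (k : ℕ) : Subgroup G where
  carrier := {g | MonoidAlgebra.of ℤ G g - 1 ∈ augmentationIdeal G ^ k}
  one_mem' := by
    show MonoidAlgebra.of ℤ G 1 - 1 ∈ augmentationIdeal G ^ k
    rw [map_one, sub_self]
    exact zero_mem _
  mul_mem' := by
    intro g h hg hh
    show MonoidAlgebra.of ℤ G (g * h) - 1 ∈ augmentationIdeal G ^ k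
    have e : MonoidAlgebra.of ℤ G (g * h) - 1 =
        MonoidAlgebra.of ℤ G g * (MonoidAlgebra.of ℤ G h - 1) + (MonoidAlgebra.of ℤ G g - 1) := by
      rw [map_mul]; noncomm_ring
    rw [e]
    exact add_mem (Ideal.mul_mem_left _ _ hh) hg
  inv_mem' := by
    intro g hg
    show MonoidAlgebra.of ℤ G g⁻¹ - 1 ∈ augmentationIdeal G ^ k
    have e : MonoidAlgebra.of ℤ G g⁻¹ - 1 =
        -(MonoidAlgebra.of ℤ G g⁻¹ * (MonoidAlgebra.of ℤ G g - 1)) := by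
      rw [mul_sub, ← map_mul, inv_mul_cancel, map_one]; noncomm_ring
    rw [e]
    exact neg_mem (Ideal.mul_mem_left _ _ hg)

instance (G : Type) [Group G] (k : ℕ) : (dimensionSubgroup G k).Normal where
  conj_mem := by
    intro g hg h
    show MonoidAlgebra.of ℤ G (h * g * h⁻¹) - 1 ∈ augmentationIdeal G ^ k
    have e : MonoidAlgebra.of ℤ G (h * g * h⁻¹) - 1 =
        MonoidAlgebra.of ℤ G h * (MonoidAlgebra.of ℤ G g - 1) * MonoidAlgebra.of ℤ G h⁻¹ := by
      rw [mul_sub, sub_mul, mul_one, ← map_mul, ← map_mul, ← map_mul, mul_inv_cancel, map_one]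
    rw [e]
    exact Ideal.mul_mem_right _ _ (Ideal.mul_mem_left _ _ hg)

/-- `G_∞ = ⋂_{k ≥ 1} G_k`. -/
def dimensionInf (G : Type) [Group G] : Subgroup G := ⨅ k : ℕ, dimensionSubgroup G (k + 1)

instance (G : Type) [Group G] : (dimensionInf G).Normal :=
  Subgroup.normal_iInf_normal fun _ => inferInstance

/-! ### Loops and the fundamental group -/

/-- `π₁(U, x₀)` with the convention that `[γ][γ']` is the class of "first `γ`, then `γ'`".
The multiplication of `FundamentalGroup` is the opposite one. -/
abbrev LoopGroup {E : Type} [TopologicalSpace E] (U : Set E) (x₀ : U) : Type :=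
  (FundamentalGroup U x₀)ᵐᵒᵖ

/-- The class of a loop. -/
def loopClass {E : Type} [TopologicalSpace E] {U : Set E} {x₀ : U} (γ : Path x₀ x₀) :
    LoopGroup U x₀ :=
  MulOpposite.op (FundamentalGroup.fromPath (Path.Homotopic.Quotient.mk γ))

section Forms

variable {E : Type} [NormedAddCommGroup E] [NormedSpace ℝ E]

/-- The loop as a curve `ℝ → E` (constant outside `[0, 1]`). -/
def loopCurve {U : Set E} {x₀ : U} (γ : Path x₀ x₀) : ℝ → E := fun t => (γ.extend t : E)

/-- Piecewise smooth: smooth on each piece of a finite partition of `[0, 1]`. -/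
def PiecewiseSmooth {U : Set E} {x₀ : U} (γ : Path x₀ x₀) : Prop :=
  ∃ (m : ℕ) (t : Fin (m + 1) → ℝ), Monotone t ∧ t 0 = 0 ∧ t (Fin.last m) = 1 ∧
    ∀ i : Fin m, ContDiffOn ℝ (⊤ : ℕ∞) (loopCurve γ) (Set.Icc (t i.castSucc) (t i.succ))

/-- The function `α` with `γ^* ω = α(t) dt`. -/
def pullbackCoeff {U : Set E} {x₀ : U} (γ : Path x₀ x₀) (ω : E → E [⋀^Fin 1]→L[ℝ] ℝ)
    (t : ℝ) : ℝ :=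
  ω (loopCurve γ t) ![deriv (loopCurve γ) t]

/-- `iterIntFrom γ [ω₁, …, ω_q] s` is the integral of `α₁(t₁) ⋯ α_q(t_q)` over
`s ≤ t₁ ≤ ⋯ ≤ t_q ≤ 1`, where `γ^* ω_i = α_i(t) dt`. -/
def iterIntFrom {U : Set E} {x₀ : U} (γ : Path x₀ x₀) :
    List (E → E [⋀^Fin 1]→L[ℝ] ℝ) → ℝ → ℝ
  | [], _ => 1
  | ω :: l, s => ∫ t in s..1, pullbackCoeff γ ω t * iterIntFrom γ l t

/-- The iterated integral `∫_γ ω₁ ⋯ ω_q`. -/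
def iterInt {U : Set E} {x₀ : U} (γ : Path x₀ x₀) (l : List (E → E [⋀^Fin 1]→L[ℝ] ℝ)) : ℝ :=
  iterIntFrom γ l 0

/-! ### Differential forms and formal homology connections on an open subset of `E` -/

variable (E) in
/-- A differential form of mixed degree, as the family of its homogeneous components.
Only its values on the open set under consideration matter. -/
abbrev MixedForm : Type := (q : ℕ) → E → E [⋀^Fin q]→L[ℝ] ℝ

/-- The involution `ε(α) = (-1)^{deg α} α`. -/
def epsForm (α : MixedForm E) : MixedForm E := fun q x => (-1 : ℝ) ^ q • α q x

/-- The value of the degree `q` component of `α ∧ β` at `x` on `v₁, …, v_q`: the sum over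
`a + b = q` of `1 / (a! b!) ∑_σ sign(σ) α_a(v_{σ(1)}, …, v_{σ(a)}) β_b(v_{σ(a+1)}, …, v_{σ(q)})`. -/
def wedgeApply (α β : MixedForm E) (q : ℕ) (x : E) (v : Fin q → E) : ℝ :=
  ∑ a : Fin (q + 1), ((a.1.factorial : ℝ) * ((q - a.1).factorial : ℝ))⁻¹ *
    ∑ σ : Equiv.Perm (Fin q), ((Equiv.Perm.sign σ : ℤ) : ℝ) *
      (α a.1 x (fun i => v (σ ⟨i.1, by omega⟩)) *
        β (q - a.1) x (fun i => v (σ ⟨a.1 + i.1, by omega⟩)))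

/-- The degree in `T̂H` of a word in letters of homological degrees `p`: a letter in `H_p` has
degree `p - 1`. -/
def wordDeg {ι : Type} (p : ι → ℕ) (w : List ι) : ℕ := (w.map fun i => p i - 1).sum

/-- A formal homology connection `(ω̄, δ)` on the open set `U`.

The letters `X_i` form a homogeneous basis of the homology of `U` in positive degrees. By de Rham's
theorem such a basis is the same thing as its dual basis of the de Rham cohomology of `U`, which is
the basis represented by the forms `ω_i`; this is how it enters here (`indep`, `span`).
The derivation `δ` lowers the degree in `T̂H` by one. It is continuous, as it preserves the
filtration of `T̂H` by word length, so it is determined by its values on monomials, for which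
the graded Leibniz rule is stated. -/
structure FormalHomologyConnection (U : Set E) (ι : Type) [Fintype ι] where
  /-- the homological degree of the letter `X_i` -/
  hdeg : ι → ℕ
  /-- the coefficients `ω_w` of `ω̄ = ∑_w ω_w X_w` -/
  ω : List ι → MixedForm E
  /-- the derivation `δ` of `T̂H` -/
  δ : NCSeries ι →ₗ[ℝ] NCSeries ι
  hdeg_pos : ∀ i, 0 < hdeg i
  smooth : ∀ w q, ContDiffOn ℝ (⊤ : ℕ∞) (ω w q) U
  /-- `ω̄` has no constant term -/
  ω_nil : ∀ q, ∀ x ∈ U, ω [] q x = 0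
  /-- `ω_w` is homogeneous of degree `deg X_w + 1` -/
  ω_deg : ∀ w q, q ≠ wordDeg hdeg w + 1 → ∀ x ∈ U, ω w q x = 0
  /-- the classes of the forms `ω_i` are linearly independent -/
  indep : ∀ (q : ℕ) (c : ι → ℝ) (η : E → E [⋀^Fin q]→L[ℝ] ℝ), ContDiffOn ℝ (⊤ : ℕ∞) η U →
    (∀ x ∈ U, ∑ i, c i • ω [i] (q + 1) x = extDeriv η x) → ∀ i, hdeg i = q + 1 → c i = 0
  /-- the classes of the forms `ω_i` span the de Rham cohomology in positive degrees -/
  span : ∀ (q : ℕ) (θ : E → E [⋀^Fin (q + 1)]→L[ℝ] ℝ), ContDiffOn ℝ (⊤ : ℕ∞) θ U →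
    (∀ x ∈ U, extDeriv θ x = 0) →
    ∃ (c : ι → ℝ) (η : E → E [⋀^Fin q]→L[ℝ] ℝ), ContDiffOn ℝ (⊤ : ℕ∞) η U ∧
      ∀ x ∈ U, θ x = ∑ i, c i • ω [i] (q + 1) x + extDeriv η x
  δ_filt : ∀ (k : ℕ) (f : NCSeries ι), (∀ w, w.length < k → f.coeff w = 0) →
    ∀ w, w.length < k → (δ f).coeff w = 0
  δ_mul : ∀ u v : List ι, δ (NCSeries.monomial u * NCSeries.monomial v) =
    δ (NCSeries.monomial u) * NCSeries.monomial v +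
      (-1 : ℝ) ^ wordDeg hdeg u • (NCSeries.monomial u * δ (NCSeries.monomial v))
  δ_deg : ∀ u w : List ι, wordDeg hdeg w + 1 ≠ wordDeg hdeg u →
    (δ (NCSeries.monomial u)).coeff w = 0
  δ_δ : ∀ f, δ (δ f) = 0
  /-- `δ X_i ∈ Ĵ²` -/
  δ_letter : ∀ (i : ι) (w : List ι), w.length < 2 → (δ (NCSeries.X i)).coeff w = 0
  /-- `dω̄ + δω̄ = ε(ω̄) ∧ ω̄`, where `δω̄ = ∑_u ω_u δ(X_u)`; at each word the sum is finite -/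
  flat : ∀ (w : List ι) (q : ℕ), ∀ x ∈ U, ∀ v : Fin (q + 1) → E,
    extDeriv (ω w q) x v + ∑ᶠ u : List ι, (δ (NCSeries.monomial u)).coeff w * ω u (q + 1) x v =
      ∑ k ∈ Finset.range (w.length + 1),
        wedgeApply (epsForm (ω (w.take k))) (ω (w.drop k)) (q + 1) x v

namespace FormalHomologyConnection

variable {U : Set E} {ι : Type} [Fintype ι] (C : FormalHomologyConnection U ι)

/-- `𝓡`, the degree `0` part of `T̂H`. -/
def degZero : Submodule ℝ (NCSeries ι) where
  carrier := {f | ∀ w, wordDeg C.hdeg w ≠ 0 → f.coeff w = 0}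
  add_mem' := by intro f g hf hg w hw; simp [hf w hw, hg w hw]
  zero_mem' := by intro w _; rfl
  smul_mem' := by intro c f hf w hw; simp [hf w hw]

/-- `𝓝`, the degree `0` part of `δ(T̂H)`, as a subspace of `𝓡`. -/
def relations : Submodule ℝ C.degZero := (LinearMap.range C.δ).comap C.degZero.subtype

/-- `R = 𝓡 / 𝓝`. -/
abbrev R : Type := C.degZero ⧸ C.relations

/-- The degree `0` part of a series. -/
def truncate : NCSeries ι →ₗ[ℝ] C.degZero where
  toFun f := ⟨⟨fun w => if wordDeg C.hdeg w = 0 then f.coeff w else 0⟩, by intro w hw; simp [hw]⟩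
  map_add' f g := by
    refine Subtype.ext (NCSeries.ext_coeff fun w => ?_)
    by_cases h : wordDeg C.hdeg w = 0 <;> simp [h]
  map_smul' c f := by
    refine Subtype.ext (NCSeries.ext_coeff fun w => ?_)
    by_cases h : wordDeg C.hdeg w = 0 <;> simp [h]

/-- The class in `R` of the degree `0` part of a series. -/
def toR : NCSeries ι →ₗ[ℝ] C.R := C.relations.mkQ.comp C.truncate

/-- `𝓕^k R`, the image in `R` of the series of degree `0` in `Ĵ^k`, that is, with no word of length
less than `k`. -/
def filt (k : ℕ) : Submodule ℝ C.R :=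
  Submodule.map C.relations.mkQ
    { carrier := {f | ∀ w : List ι, w.length < k → (f : NCSeries ι).coeff w = 0}
      add_mem' := by intro f g hf hg w hw; simp [hf w hw, hg w hw]
      zero_mem' := by intro w _; rfl
      smul_mem' := by intro c f hf w hw; simp [hf w hw] }

/-- The series `1 + ∑_k ∫_γ ω ⋯ ω` (`k` factors) with `ω = ∑_w ω_w X_w`: its coefficient at `w` is
the sum of `∫_γ ω_{w₁} ⋯ ω_{w_k}` over all ways to cut `w` into nonempty words `w₁, …, w_k`.
Only its coefficients at words of degree `0`, where the `ω_{w_j}` are `1`-forms, are used. -/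
def transport {x₀ : U} (γ : Path x₀ x₀) : NCSeries ι :=
  ⟨fun w => ∑ c : Composition w.length, iterInt γ ((w.splitWrtComposition c).map fun u => C.ω u 1)⟩

/-- `Θ` is the holonomy representation: it is given by iterated integrals along piecewise smooth
loops, and every class contains such a loop. -/
def IsHolonomyMap {x₀ : U} (Θ : LoopGroup U x₀ → C.R) : Prop :=
  (∀ g : LoopGroup U x₀, ∃ γ : Path x₀ x₀, PiecewiseSmooth γ ∧ loopClass γ = g) ∧
    ∀ γ : Path x₀ x₀, PiecewiseSmooth γ → Θ (loopClass γ) = C.toR (C.transport γ)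

/-- `v` is an ordered, homogeneous basis of the filtered vector space `R` with non-decreasing
degree, indexed by `I` with the well-order `lt`, and `coord` is its dual basis. The elements `v i`
with `deg i = k` are a basis of a complement `R^k` of `𝓕^{k+1}` in `𝓕^k` (their linear independence
modulo `𝓕^{k+1}` is a consequence of `coord_v` and `coord_filt`), and `coord i` vanishes on the
other basis elements and on all elements of higher degree. -/
structure IsHolonomyBasis {I : Type} (lt : I → I → Prop) (deg : I → ℕ) (v : I → C.R)
    (coord : I → C.R →ₗ[ℝ] ℝ) : Prop where
  wellOrder : IsWellOrder I lt
  deg_mono : ∀ i j, lt i j → deg i ≤ deg j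
  v_mem : ∀ i, v i ∈ C.filt (deg i)
  span : ∀ k, C.filt k ≤ Submodule.span ℝ (v '' {i | deg i = k}) ⊔ C.filt (k + 1)
  coord_self : ∀ i, coord i (v i) = 1
  coord_v : ∀ i j, i ≠ j → coord i (v j) = 0
  coord_filt : ∀ i, ∀ f ∈ C.filt (deg i + 1), coord i f = 0

/-- `r` is the ordering of `G / G_∞`, `G = π₁(U, x₀)`, with `a < b` iff `Θ(a) < Θ(b)` in the
lexicographic order of the sequences of coordinates. -/
def IsHolonomyOrderingOf {x₀ : U} {I : Type} (lt : I → I → Prop) (coord : I → C.R →ₗ[ℝ] ℝ)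
    (r : LoopGroup U x₀ ⧸ dimensionInf (LoopGroup U x₀) →
      LoopGroup U x₀ ⧸ dimensionInf (LoopGroup U x₀) → Prop) : Prop :=
  ∃ Θ : LoopGroup U x₀ → C.R, C.IsHolonomyMap Θ ∧
    ∀ a b : LoopGroup U x₀, r (QuotientGroup.mk a) (QuotientGroup.mk b) ↔
      Pi.Lex lt (· < ·) (fun i => coord i (Θ a)) (fun i => coord i (Θ b))

end FormalHomologyConnection

/-- `r` is a holonomy ordering of `G / G_∞`, `G = π₁(U, x₀)`, where `U` is a connected open subset
of a finite-dimensional space: it is defined by some formal homology connection on `U` and some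
ordered, homogeneous, degree non-decreasing basis. -/
def IsHolonomyOrdering [FiniteDimensional ℝ E] (U : Set E) (x₀ : U)
    (r : LoopGroup U x₀ ⧸ dimensionInf (LoopGroup U x₀) →
      LoopGroup U x₀ ⧸ dimensionInf (LoopGroup U x₀) → Prop) : Prop :=
  IsOpen U ∧ IsConnected U ∧
    ∃ (m : ℕ) (C : FormalHomologyConnection U (Fin m)) (I : Type) (lt : I → I → Prop)
      (deg : I → ℕ) (v : I → C.R) (coord : I → C.R →ₗ[ℝ] ℝ),
      C.IsHolonomyBasis lt deg v coord ∧ C.IsHolonomyOrderingOf lt coord r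

end Forms

/-! ### The punctured disc -/

/-- The open unit disc without the points `p_1, …, p_n`. -/
def puncturedDisc {n : ℕ} (p : Fin n → ℂ) : Set ℂ := {z | ‖z‖ < 1 ∧ ∀ i, z ≠ p i}

/-- The forms `ω_1, …, ω_n` on the open set `U` are smooth and closed, satisfy `ω_i ∧ ω_j = 0`, and
their classes are dual to the elements `g_1, …, g_n` of `π₁(U, x₀)`: `∫_{g_j} ω_i = δ_{ij}`. -/
structure IsDualFlatSystem {n : ℕ} {U : Set ℂ} {x₀ : U} (g : Fin n → LoopGroup U x₀)
    (ω : Fin n → ℂ → ℂ [⋀^Fin 1]→L[ℝ] ℝ) : Prop where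
  smooth : ∀ i, ContDiffOn ℝ (⊤ : ℕ∞) (ω i) U
  closed : ∀ i, ∀ x ∈ U, extDeriv (ω i) x = 0
  wedge : ∀ i j, ∀ x ∈ U, ∀ u v : ℂ, ω i x ![u] * ω j x ![v] - ω i x ![v] * ω j x ![u] = 0
  dual : ∀ i j, ∀ γ : Path x₀ x₀, PiecewiseSmooth γ → loopClass γ = g j →
    iterInt γ [ω i] = if i = j then 1 else 0

/-- `ω = ∑_i ω_i X_i`. -/
def linearForm {n : ℕ} (ω : Fin n → ℂ → ℂ [⋀^Fin 1]→L[ℝ] ℝ) : List (Fin n) → MixedForm ℂ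
  | [i] => Pi.single 1 (ω i)
  | _ => 0

end

/-!
Let `ω_1, …, ω_n` be closed forms on the punctured disc `D_n` with `ω_i ∧ ω_j = 0`. The connection
`∑ ω_i X_i` is then flat: over a convex open set it has a parallel section, obtained by integrating
closed forms one after the other (`exists_isParallel`), so that the generating series of iterated
integrals along a path depends only on the homotopy class of the path (`chen_eq_of_homotopic`). This
gives a multiplicative map `holonomy` from `π₁(D_n)` to the power series.

If the forms are dual to elements `g_1, …, g_n`, the holonomy of `g_i` is `1 + X_i` plus words of
length at least two. Such an expansion `T` of the free group is the Magnus expansion `μ` followed by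
a substitution `X_i ↦ X_i + (words of length at least two)` (`subst_magnus`). Hence `T(b) - T(a)` and
`μ(b) - μ(a)` have the same lowest degree part (`coeff_sub_eq_magnus`). The DegLex-first monomial at
which two series differ belongs to the lowest degree part of their difference, so that `T` defines
the same ordering as `μ` (`magnusLT_iff`), and it inherits injectivity from Magnus's theorem
(`magnus_injective`). Injectivity forces `G_∞ = 1` (`dimensionInf_eq_bot_of_injective`).

The topology of `D_n` enters through three facts.

* `π₁(D_n)` is generated by `n` elements (`exists_generators_puncturedDisc`). Seen from a point `q`
  in general position, the punctures cast disjoint shadows. The disc without these slits is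
  star-shaped, and crossing the slits contributes one generator each (`exists_generators`, the easy
  half of a van Kampen theorem).
* There are `n` flat forms with linearly independent classes: the `i`-th is the differential of a
  step function across a thin cone around the `i`-th slit (`coneForm`,
  `IsSlitCentre.coeff_eq_zero`). A closed form without periods is exact, so that the matrix of
  periods of these forms over any `n` generators is invertible. This yields dual systems for all
  generating families (`exists_dual_isFlatSystem`), and thereby the freeness of `π₁(D_n)`: no
  computation of relations is needed.
* Every `2`-form on `D_n` is exact (`exists_primitive_twoForm`), by radial integration and a
  partition of unity. Together with the duality this shows that the classes of the `ω_i` are a basis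
  of the cohomology in positive degrees, as required of a formal homology connection
  (`linearConnection`). Since `δ = 0` and all letters have degree one, `R` is the full power series
  space, and the monomials are an ordered homogeneous basis (`isHolonomyBasis_monomial`).
-/

noncomputable section

/-! ### Substitution in non-commutative power series -/

namespace NCSeries

variable {ι : Type}

theorem eq_zero_of_mul_eq_zero {f g : NCSeries ι} (hg : g.coeff [] ≠ 0) (h : f * g = 0) :
    f = 0 := by
  have key : ∀ (n : ℕ) (w : List ι), w.length = n → f.coeff w = 0 := by
    intro n
    induction n using Nat.strong_induction_on with
    | _ n ih =>
      intro w hw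
      have hc : (f * g).coeff w = 0 := by rw [h]; rfl
      rw [coeff_mul, Finset.sum_range_succ, Finset.sum_eq_zero, zero_add] at hc
      · simpa [hg] using hc
      · intro k hk
        have hk' : k < w.length := Finset.mem_range.1 hk
        rw [ih k (hw ▸ hk') (w.take k) (by simp; omega), zero_mul]
  exact ext_coeff fun w => key _ w rfl

/-- Right cancellation by a series whose constant term is not zero. -/
theorem mul_right_cancel_of_coeff_nil {f f' g : NCSeries ι} (hg : g.coeff [] ≠ 0)
    (h : f * g = f' * g) : f = f' := by
  have : (f - f') * g = 0 := by rw [sub_mul, h, sub_self]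
  exact sub_eq_zero.1 (eq_zero_of_mul_eq_zero hg this)

/-- All words of length less than `k` have coefficient `0`. -/
def VanishesBelow (k : ℕ) (f : NCSeries ι) : Prop := ∀ w : List ι, w.length < k → f.coeff w = 0

theorem VanishesBelow.mul {a b : ℕ} {f g : NCSeries ι} (hf : f.VanishesBelow a)
    (hg : g.VanishesBelow b) : (f * g).VanishesBelow (a + b) := by
  intro w hw
  rw [coeff_mul]
  refine Finset.sum_eq_zero fun k hk => ?_
  have hk' := Finset.mem_range.1 hk
  by_cases h : k < a
  · rw [hf _ (by simp; omega), zero_mul]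
  · rw [hg _ (by simp; omega), mul_zero]

theorem VanishesBelow.eq_zero {f : NCSeries ι} (hf : ∀ k, f.VanishesBelow k) : f = 0 :=
  ext_coeff fun w => hf (w.length + 1) w (Nat.lt_succ_self _)

theorem shift_sub (a : ι) (f g : NCSeries ι) : shift a (f - g) = shift a f - shift a g :=
  ext_coeff fun w => by rw [← coeff_cons, coeff_sub, coeff_sub]; rfl

theorem coeff_sum {κ : Type} (s : Finset κ) (f : κ → NCSeries ι) (w : List ι) :
    (∑ i ∈ s, f i).coeff w = ∑ i ∈ s, (f i).coeff w := by
  classical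
  induction s using Finset.induction_on with
  | empty => simp
  | insert a s ha ih => rw [Finset.sum_insert ha, Finset.sum_insert ha, coeff_add, ih]

/-- If `Y` has no constant term, the coefficients of `Y g` at words of length at most `n + 1` depend
only on the coefficients of `g` at words of length at most `n`. -/
theorem coeff_mul_congr {Y g g' : NCSeries ι} (hY : Y.coeff [] = 0) {n : ℕ}
    (h : ∀ u : List ι, u.length ≤ n → g.coeff u = g'.coeff u) {w : List ι}
    (hw : w.length ≤ n + 1) : (Y * g).coeff w = (Y * g').coeff w := by
  rw [coeff_mul, coeff_mul]
  refine Finset.sum_congr rfl fun k _ => ?_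
  rcases Nat.eq_zero_or_pos k with rfl | hk
  · simp [hY]
  · rw [h _ (by simp; omega)]

variable [Fintype ι]

/-- Approximations to the substitution `X_i ↦ Y_i`, correct up to words of length `n`. -/
def substAux (Y : ι → NCSeries ι) : ℕ → NCSeries ι → NCSeries ι
  | 0, f => f.coeff [] • 1
  | n + 1, f => f.coeff [] • 1 + ∑ i, Y i * substAux Y n (shift i f)

/-- The series `f(Y)` that arises from `f` by substituting the series `Y i` for the variables
`X_i`. It is meaningful if the `Y i` have no constant term; the coefficient at `w` is then read off
from the finitely many words of `f` of length at most `|w|`. -/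
def subst (Y : ι → NCSeries ι) (f : NCSeries ι) : NCSeries ι :=
  ⟨fun w => (substAux Y w.length f).coeff w⟩

variable {Y : ι → NCSeries ι}

theorem substAux_stable (hY : ∀ i, (Y i).coeff [] = 0) (n m : ℕ) (f : NCSeries ι)
    (w : List ι) (hn : w.length ≤ n) (hm : w.length ≤ m) :
    (substAux Y n f).coeff w = (substAux Y m f).coeff w := by
  have nil : ∀ (k : ℕ) (f : NCSeries ι), (substAux Y k f).coeff [] = f.coeff [] := by
    classical
    intro k f
    cases k with
    | zero => simp [substAux, coeff_one]
    | succ k => simp [substAux, coeff_one, coeff_sum, mul_nil, hY]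
  induction n generalizing m f w with
  | zero =>
    have : w = [] := List.length_eq_zero_iff.1 (by omega)
    rw [this, nil, nil]
  | succ n ih =>
    cases m with
    | zero =>
      have : w = [] := List.length_eq_zero_iff.1 (by omega)
      rw [this, nil, nil]
    | succ m =>
      simp only [substAux, coeff_add, coeff_sum]
      congr 1
      refine Finset.sum_congr rfl fun i _ => ?_
      rcases w with _ | ⟨a, w⟩
      · simp [mul_nil, hY]
      · refine coeff_mul_congr (hY i) (n := w.length) (fun u hu => ?_) (by simp)
        simp only [List.length_cons] at hn hm
        exact ih m _ u (by omega) (by omega)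

/-- The recursion `f(Y) = f_∅ + ∑_i Y_i (∂_i f)(Y)`, where `f = f_∅ + ∑_i X_i ∂_i f`. -/
theorem subst_eq (hY : ∀ i, (Y i).coeff [] = 0) (f : NCSeries ι) :
    subst Y f = f.coeff [] • 1 + ∑ i, Y i * subst Y (shift i f) := by
  refine ext_coeff fun w => ?_
  show (substAux Y w.length f).coeff w = _
  rw [substAux_stable hY w.length (w.length + 1) f w le_rfl (Nat.le_succ _)]
  simp only [substAux, coeff_add, coeff_sum]
  congr 1
  refine Finset.sum_congr rfl fun i _ => ?_
  refine coeff_mul_congr (hY i) (n := w.length) (fun u hu => ?_) (by simp)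
  exact substAux_stable hY _ _ _ _ hu le_rfl

theorem subst_nil (hY : ∀ i, (Y i).coeff [] = 0) (f : NCSeries ι) :
    (subst Y f).coeff [] = f.coeff [] := by
  classical
  rw [subst_eq hY]
  simp [coeff_one, coeff_sum, mul_nil, hY]

/-- Two operators that satisfy the recursion of `subst_eq` up to the same error agree: it suffices
to compare them on coefficients of shorter words. -/
theorem subst_unique (hY : ∀ i, (Y i).coeff [] = 0) {κ : Type} (F G : κ → NCSeries ι)
    (s : ι → κ → κ) (E : κ → NCSeries ι) (hF : ∀ x, F x = E x + ∑ i, Y i * F (s i x))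
    (hG : ∀ x, G x = E x + ∑ i, Y i * G (s i x)) (x : κ) : F x = G x := by
  have key : ∀ (n : ℕ) (x : κ) (w : List ι), w.length ≤ n → (F x).coeff w = (G x).coeff w := by
    intro n
    induction n with
    | zero =>
      intro x w hw
      have : w = [] := List.length_eq_zero_iff.1 (by omega)
      rw [this, hF, hG]
      simp [coeff_sum, mul_nil, hY]
    | succ n ih =>
      intro x w hw
      rw [hF, hG, coeff_add, coeff_add, coeff_sum, coeff_sum]
      congr 1
      exact Finset.sum_congr rfl fun i _ => coeff_mul_congr (hY i) (fun u hu => ih _ u hu) hw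
  exact ext_coeff fun w => key _ x w le_rfl

theorem subst_sub (hY : ∀ i, (Y i).coeff [] = 0) (f g : NCSeries ι) :
    subst Y (f - g) = subst Y f - subst Y g := by
  refine subst_unique hY (κ := NCSeries ι × NCSeries ι) (fun x => subst Y (x.1 - x.2))
    (fun x => subst Y x.1 - subst Y x.2) (fun i x => (shift i x.1, shift i x.2))
    (fun x => (x.1.coeff [] - x.2.coeff []) • 1) (fun x => ?_) (fun x => ?_) (f, g)
  · rw [subst_eq hY]
    simp only [shift_sub, coeff_sub]
  · rw [subst_eq hY x.1, subst_eq hY x.2]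
    simp only [mul_sub, Finset.sum_sub_distrib, sub_smul]
    abel

theorem subst_mul (hY : ∀ i, (Y i).coeff [] = 0) (f g : NCSeries ι) :
    subst Y (f * g) = subst Y f * subst Y g := by
  have hadd : ∀ (c : ℝ) (f g : NCSeries ι), subst Y (c • f + g) = c • subst Y f + subst Y g := by
    intro c f g
    refine subst_unique hY (κ := NCSeries ι × NCSeries ι) (fun x => subst Y (c • x.1 + x.2))
      (fun x => c • subst Y x.1 + subst Y x.2) (fun i x => (shift i x.1, shift i x.2))
      (fun x => (c * x.1.coeff [] + x.2.coeff []) • 1) (fun x => ?_) (fun x => ?_) (f, g)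
    · rw [subst_eq hY]; rfl
    · rw [subst_eq hY x.1, subst_eq hY x.2]
      simp only [mul_add, mul_smul_comm, Finset.sum_add_distrib, smul_add, add_smul,
        Finset.smul_sum, SemigroupAction.mul_smul]
      abel
  refine subst_unique hY (κ := NCSeries ι × NCSeries ι) (fun x => subst Y (x.1 * x.2))
    (fun x => subst Y x.1 * subst Y x.2) (fun i x => (shift i x.1, x.2))
    (fun x => x.1.coeff [] • subst Y x.2) (fun x => ?_) (fun x => ?_) (f, g)
  · rw [subst_eq hY, mul_nil]
    simp only [shift_mul, hadd, mul_add, mul_smul_comm, Finset.sum_add_distrib]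
    rw [← add_assoc]
    congr 1
    rw [subst_eq hY x.2, smul_add, Finset.smul_sum, smul_smul]
  · rw [subst_eq hY x.1]
    simp only [add_mul, smul_mul_assoc, one_mul, Finset.sum_mul, mul_assoc]

theorem subst_one (hY : ∀ i, (Y i).coeff [] = 0) : subst Y (1 : NCSeries ι) = 1 := by
  classical
  have hz : subst Y (0 : NCSeries ι) = 0 := by
    simpa using subst_sub hY (0 : NCSeries ι) 0
  have h : ∀ i, shift i (1 : NCSeries ι) = 0 := fun i =>
    ext_coeff fun u => by rw [← coeff_cons]; simp [coeff_one]
  rw [subst_eq hY]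
  simp [h, hz, coeff_one]

theorem subst_one_add_X (hY : ∀ i, (Y i).coeff [] = 0) (i : ι) :
    subst Y (1 + X i : NCSeries ι) = 1 + Y i := by
  classical
  have hz : subst Y (0 : NCSeries ι) = 0 := by
    simpa using subst_sub hY (0 : NCSeries ι) 0
  rw [subst_eq hY, one_add_X_nil, one_smul]
  congr 1
  rw [Finset.sum_eq_single i]
  · rw [shift_one_add_X, if_pos rfl, subst_one hY, mul_one]
  · intro j _ hj
    rw [shift_one_add_X, if_neg hj, hz, mul_zero]
  · simp

/-- Substituting `X_i + (words of length at least two)` for `X_i` does not change the lowest degree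
part of a series. -/
theorem coeff_subst_of_vanishesBelow (hY : ∀ i, (Y i).coeff [] = 0)
    (hY1 : ∀ i j, [Decidable (i = j)] → (Y i).coeff [j] = if i = j then 1 else 0)
    (k : ℕ) (f : NCSeries ι) (hf : f.VanishesBelow k) (w : List ι) (hw : w.length ≤ k) :
    (subst Y f).coeff w = f.coeff w := by
  classical
  induction k generalizing f w with
  | zero =>
    have : w = [] := List.length_eq_zero_iff.1 (by omega)
    rw [this, subst_nil hY]
  | succ k ih =>
    rcases w with _ | ⟨a, w⟩
    · rw [subst_nil hY]
    have hshift : ∀ i, (shift i f).VanishesBelow k := fun i u hu => hf (i :: u) (by simpa using hu)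
    rw [subst_eq hY, hf [] (by simp), zero_smul, zero_add, coeff_sum]
    have hterm : ∀ i, (Y i * subst Y (shift i f)).coeff (a :: w) =
        if i = a then f.coeff (a :: w) else 0 := by
      intro i
      rw [mul_cons, hY, zero_mul, zero_add, coeff_mul, Finset.sum_range_succ', Finset.sum_eq_zero]
      · have : (shift a (Y i)).coeff (w.take 0) = (Y i).coeff [a] := by simp [shift]
        rw [this, hY1, zero_add, List.drop_zero, ih _ (hshift i) w (by simpa using hw)]
        by_cases h : i = a
        · simp [h, shift]
        · simp [h]
      · intro j hj
        have hj' := Finset.mem_range.1 hj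
        have hlen : (w.drop (j + 1)).length < k := by
          simp only [List.length_cons, List.length_drop] at hw ⊢; omega
        rw [ih _ (hshift i) _ hlen.le, hshift i _ hlen, mul_zero]
    simp [hterm]

end NCSeries

/-! ### The Magnus expansion -/

namespace NCSeries

variable {ι : Type}

/-- Words without two equal adjacent letters. -/
abbrev SquareFree (w : List ι) : Prop := w.IsChain (· ≠ ·)

/-- On square-free words, the coefficients of `g` are those of `(1 + X_i)^e f`: modulo the words
that contain `X_i X_i`, the series `(1 + X_i)^e` is `1 + e X_i`. -/
def PowRel (i : ι) (e : ℤ) (f g : NCSeries ι) : Prop :=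
  (∀ w, SquareFree w → w.head? ≠ some i → g.coeff w = f.coeff w) ∧
    ∀ w, SquareFree (i :: w) → g.coeff (i :: w) = f.coeff (i :: w) + e * f.coeff w

theorem coeff_one_add_X_mul (i : ι) (f : NCSeries ι) (w : List ι) (hw : w.head? ≠ some i) :
    ((1 + X i) * f).coeff w = f.coeff w := by
  classical
  rcases w with _ | ⟨a, w⟩
  · rw [mul_nil, one_add_X_nil, one_mul]
  · rw [mul_cons, shift_one_add_X, one_add_X_nil, one_mul, if_neg (by simpa using hw),
      zero_mul, coeff_zero, add_zero]

theorem coeff_one_add_X_mul_cons (i : ι) (f : NCSeries ι) (w : List ι) :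
    ((1 + X i) * f).coeff (i :: w) = f.coeff (i :: w) + f.coeff w := by
  classical
  rw [mul_cons, shift_one_add_X, one_add_X_nil, one_mul, if_pos rfl, one_mul]

theorem head?_ne_of_squareFree_cons {i : ι} {w : List ι} (h : SquareFree (i :: w)) :
    w.head? ≠ some i := by
  rcases w with _ | ⟨a, w⟩
  · simp
  · simpa [eq_comm] using (List.isChain_cons_cons.1 h).1

theorem PowRel.succ {i : ι} {e : ℤ} {f g : NCSeries ι} (h : PowRel i e f g) :
    PowRel i (e + 1) f ((1 + X i) * g) := by
  refine ⟨fun w hw hi => by rw [coeff_one_add_X_mul i g w hi, h.1 w hw hi], fun w hw => ?_⟩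
  rw [coeff_one_add_X_mul_cons, h.2 w hw,
    h.1 w hw.tail (head?_ne_of_squareFree_cons hw)]
  push_cast
  ring

theorem PowRel.pred {i : ι} {e : ℤ} {f g : NCSeries ι} (h : PowRel i e f ((1 + X i) * g)) :
    PowRel i (e - 1) f g := by
  have h1 : ∀ w, SquareFree w → w.head? ≠ some i → g.coeff w = f.coeff w := fun w hw hi => by
    rw [← h.1 w hw hi, coeff_one_add_X_mul i g w hi]
  refine ⟨h1, fun w hw => ?_⟩
  have := h.2 w hw
  rw [coeff_one_add_X_mul_cons, h1 w hw.tail (head?_ne_of_squareFree_cons hw)] at this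
  push_cast
  linear_combination this

/-- Among the square-free words with nonzero coefficient there are ones of maximal length `d`, and
all these satisfy `P`. -/
def TopWords (P : List ι → Prop) (d : ℕ) (f : NCSeries ι) : Prop :=
  (∃ w, SquareFree w ∧ w.length = d ∧ f.coeff w ≠ 0) ∧
    ∀ w, SquareFree w → d ≤ w.length → f.coeff w ≠ 0 → w.length = d ∧ P w

theorem TopWords.mono {P Q : List ι → Prop} {d : ℕ} {f : NCSeries ι} (h : TopWords P d f)
    (hPQ : ∀ w, P w → Q w) : TopWords Q d f :=
  ⟨h.1, fun w hw hd hf => ⟨(h.2 w hw hd hf).1, hPQ w (h.2 w hw hd hf).2⟩⟩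

/-- Multiplication by a nontrivial power of `1 + X_i` lengthens the longest square-free words by
the letter `X_i`, if they do not already start with it. -/
theorem TopWords.powRel {i : ι} {d : ℕ} {e : ℤ} (he : e ≠ 0) {f g : NCSeries ι}
    (h : TopWords (fun w => w.head? ≠ some i) d f) (hfg : PowRel i e f g) :
    TopWords (fun w => w.head? = some i) (d + 1) g := by
  have hz : ∀ w, SquareFree w → d < w.length → f.coeff w = 0 := fun w hw hd => by
    by_contra hne
    have := (h.2 w hw hd.le hne).1
    omega
  obtain ⟨⟨w, hw, hd, hne⟩, hall⟩ := h
  have he' : (e : ℝ) ≠ 0 := by exact_mod_cast he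
  have hsf : SquareFree (i :: w) := by
    have := (hall w hw hd.ge hne).2
    rcases w with _ | ⟨a, w⟩
    · exact List.isChain_singleton _
    · exact List.isChain_cons_cons.2 ⟨fun e => this (by simp [e]), hw⟩
  refine ⟨⟨i :: w, hsf, by simp [hd], ?_⟩, fun u hu hdu hne' => ?_⟩
  · rw [hfg.2 w hsf, hz _ hsf (by simp [hd]), zero_add]
    exact mul_ne_zero he' hne
  · by_cases hi : u.head? = some i
    · refine ⟨?_, hi⟩
      rcases u with _ | ⟨a, u⟩
      · simp at hi
      obtain rfl : a = i := by simpa using hi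
      simp only [List.length_cons] at hdu ⊢
      rw [hfg.2 u hu, hz _ hu (by simp; omega), zero_add] at hne'
      rw [(hall u hu.tail (by omega) (right_ne_zero_of_mul hne')).1]
    · rw [hfg.1 u hu hi, hz u hu (by omega)] at hne'
      exact absurd rfl hne'

end NCSeries

open NCSeries in
/-- The Magnus expansion of a nonempty reduced word that starts with the letter `x_i^{±1}` is
`(1 + X_i)^e f` on square-free words, where `±e > 0` and the longest square-free words of `f` do not
start with `X_i`. -/
theorem magnus_mk_powRel (n : ℕ) (x : Fin n × Bool) (L : List (Fin n × Bool))
    (hL : FreeGroup.IsReduced (x :: L)) :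
    ∃ (d : ℕ) (e : ℤ) (f : NCSeries (Fin n)), (0 < if x.2 then e else -e) ∧
      TopWords (fun w => w.head? ≠ some x.1) d f ∧
      PowRel x.1 e f (magnus n (FreeGroup.mk (x :: L))) := by
  classical
  induction L generalizing x with
  | nil =>
    refine ⟨0, if x.2 then 1 else -1, 1, by cases x.2 <;> simp, ⟨⟨[], List.isChain_nil, rfl, ?_⟩,
      fun w _ _ hw => ?_⟩, ?_⟩
    · simp [coeff_one]
    · have : w = [] := by
        by_contra h
        simp [coeff_one, h] at hw
      simp [this]
    · have h0 : PowRel x.1 0 1 (1 : NCSeries (Fin n)) := ⟨fun _ _ _ => rfl, fun w _ => by simp⟩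
      obtain ⟨i, b⟩ := x
      cases b with
      | true =>
        have := h0.succ
        rw [mul_one, ← magnus_of] at this
        exact this
      | false =>
        have hinv : (1 + X i) * magnus n (FreeGroup.mk [(i, false)]) = 1 := by
          rw [← magnus_of, ← map_mul]
          have : FreeGroup.of i * FreeGroup.mk [(i, false)] = 1 :=
            mul_inv_cancel (FreeGroup.of i)
          rw [this, map_one]
        refine PowRel.pred (e := 0) ?_
        rw [hinv]
        exact h0
  | cons y L ih =>
    have hL' : FreeGroup.IsReduced (y :: L) := (List.isChain_cons_cons.1 hL).2
    have hxy := (List.isChain_cons_cons.1 hL).1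
    obtain ⟨d, e, f, he, htop, hrel⟩ := ih y hL'
    have step : ∀ (d : ℕ) (e : ℤ) (f : NCSeries (Fin n)), (0 ≤ if x.2 then e else -e) →
        TopWords (fun w => w.head? ≠ some x.1) d f →
        PowRel x.1 e f (magnus n (FreeGroup.mk (y :: L))) →
        ∃ (d : ℕ) (e : ℤ) (f : NCSeries (Fin n)), (0 < if x.2 then e else -e) ∧
          TopWords (fun w => w.head? ≠ some x.1) d f ∧
          PowRel x.1 e f (magnus n (FreeGroup.mk (x :: y :: L))) := by
      intro d e f he htop hrel
      obtain ⟨i, b⟩ := x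
      cases b with
      | true =>
        refine ⟨d, e + 1, f, by simp only [if_true] at he ⊢; omega, htop, ?_⟩
        have := hrel.succ
        rwa [← magnus_of, ← map_mul] at this
      | false =>
        refine ⟨d, e - 1, f, by simp at he ⊢; omega, htop, PowRel.pred ?_⟩
        rw [← magnus_of, ← map_mul]
        have : FreeGroup.of i * FreeGroup.mk ((i, false) :: y :: L) = FreeGroup.mk (y :: L) :=
          mul_inv_cancel_left (FreeGroup.of i) (FreeGroup.mk (y :: L))
        rwa [this]
    by_cases hi : x.1 = y.1
    · refine step d e f ?_ (hi ▸ htop) (hi ▸ hrel)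
      rw [hxy hi]
      exact he.le
    · have he0 : e ≠ 0 := by
        rintro rfl
        simp at he
      exact step (d + 1) 0 _ (by simp)
        ((htop.powRel he0 hrel).mono fun w hw => by
          rw [hw]; simpa [eq_comm] using hi) ⟨fun _ _ _ => rfl, fun w _ => by simp⟩

open NCSeries in
/-- Magnus's theorem: the Magnus expansion is injective. -/
theorem magnus_injective (n : ℕ) : Function.Injective (magnus n) := by
  classical
  rw [injective_iff_map_eq_one]
  intro g hg
  by_contra hne
  have hred : FreeGroup.IsReduced g.toWord := FreeGroup.isReduced_toWord
  rcases hw : g.toWord with _ | ⟨x, L⟩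
  · exact hne (FreeGroup.toWord_eq_nil_iff.1 hw)
  rw [hw] at hred
  obtain ⟨d, e, f, he, htop, hrel⟩ := magnus_mk_powRel n x L hred
  rw [← hw, FreeGroup.mk_toWord, hg] at hrel
  have he0 : e ≠ 0 := by
    rintro rfl
    simp at he
  obtain ⟨w, -, hd, hne'⟩ := (htop.powRel he0 hrel).1
  have : w ≠ [] := by
    rintro rfl
    simp at hd
  simp [coeff_one, this] at hne'

/-! ### Expansions of the free group with the same leading terms -/

open NCSeries in
/-- A multiplicative map `T` with `T(x_i) = 1 + X_i + (words of length at least two)` is the Magnus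
expansion, followed by the substitution `X_i ↦ T(x_i) - 1`. -/
theorem subst_magnus {n : ℕ} (T : FreeGroup (Fin n) →* NCSeries (Fin n))
    (hT0 : ∀ i, (T (FreeGroup.of i)).coeff [] = 1) (g : FreeGroup (Fin n)) :
    subst (fun i => T (FreeGroup.of i) - 1) (magnus n g) = T g := by
  classical
  have hY : ∀ i, (T (FreeGroup.of i) - 1).coeff [] = 0 := fun i => by simp [hT0, coeff_one]
  let S : NCSeries (Fin n) →* NCSeries (Fin n) :=
    { toFun := subst fun i => T (FreeGroup.of i) - 1
      map_one' := subst_one hY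
      map_mul' := subst_mul hY }
  have hST : (S.comp (magnus n)).toHomUnits = T.toHomUnits := by
    refine FreeGroup.ext_hom _ _ fun i => Units.ext ?_
    show subst _ (magnus n (FreeGroup.of i)) = T (FreeGroup.of i)
    rw [magnus_of, subst_one_add_X hY]
    abel
  exact congrArg Units.val (DFunLike.congr_fun hST g)

open NCSeries in
/-- The lowest degree parts of `μ(b) - μ(a)` and of `T(b) - T(a)` agree. -/
theorem coeff_sub_eq_magnus {n : ℕ} (T : FreeGroup (Fin n) →* NCSeries (Fin n))
    (hT0 : ∀ i, (T (FreeGroup.of i)).coeff [] = 1)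
    (hT1 : ∀ i j, (T (FreeGroup.of i)).coeff [j] = if i = j then 1 else 0)
    (a b : FreeGroup (Fin n)) {k : ℕ}
    (h : (magnus n b - magnus n a).VanishesBelow k ∨ (T b - T a).VanishesBelow k)
    {w : List (Fin n)} (hw : w.length ≤ k) :
    (T b - T a).coeff w = (magnus n b - magnus n a).coeff w := by
  classical
  have hY : ∀ i, (T (FreeGroup.of i) - 1).coeff [] = 0 := fun i => by simp [hT0, coeff_one]
  have hY1 : ∀ i j, [Decidable (i = j)] →
      (T (FreeGroup.of i) - 1).coeff [j] = if i = j then 1 else 0 := fun i j _ => by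
    simp [hT1, coeff_one]
  have hsub : T b - T a = subst (fun i => T (FreeGroup.of i) - 1) (magnus n b - magnus n a) := by
    rw [subst_sub hY, subst_magnus T hT0, subst_magnus T hT0]
  have main : ∀ m, m ≤ k → (magnus n b - magnus n a).VanishesBelow m := by
    rcases h with h | h
    · exact fun m hm w hw => h w (by omega)
    · intro m
      induction m with
      | zero => exact fun _ w hw => absurd hw (Nat.not_lt_zero _)
      | succ m ih =>
        intro hm w hw
        rw [← coeff_subst_of_vanishesBelow hY hY1 m _ (ih (by omega)) w (by omega), ← hsub]
        exact h w (by omega)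
  rw [hsub]
  exact coeff_subst_of_vanishesBelow hY hY1 k _ (main k le_rfl) w hw

theorem degLexLT_of_length_lt {n : ℕ} {u w : List (Fin n)} (h : u.length < w.length) :
    degLexLT n u w :=
  List.Shortlex.of_length_lt h

theorem length_le_of_degLexLT {n : ℕ} {u w : List (Fin n)} (h : degLexLT n u w) :
    u.length ≤ w.length := by
  rcases List.shortlex_def.1 h with h | h
  · exact h.le
  · exact h.1.le

theorem isWellOrder_degLexLT (n : ℕ) : IsWellOrder (List (Fin n)) (degLexLT n) where
  toTrichotomous := List.Shortlex.trichotomous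
  wf := List.Shortlex.wf wellFounded_lt

open NCSeries in
/-- The Magnus ordering can be read off from `T` instead of `μ`. -/
theorem magnusLT_iff {n : ℕ} (T : FreeGroup (Fin n) →* NCSeries (Fin n))
    (hT0 : ∀ i, (T (FreeGroup.of i)).coeff [] = 1)
    (hT1 : ∀ i j, (T (FreeGroup.of i)).coeff [j] = if i = j then 1 else 0)
    (a b : FreeGroup (Fin n)) :
    MagnusLT n a b ↔ Pi.Lex (degLexLT n) (· < ·) (T a).coeff (T b).coeff := by
  have vanish : ∀ (f g : NCSeries (Fin n)) (w : List (Fin n)),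
      (∀ u, degLexLT n u w → f.coeff u = g.coeff u) → (g - f).VanishesBelow w.length :=
    fun f g w h u hu => by rw [coeff_sub, h u (degLexLT_of_length_lt hu), sub_self]
  constructor
  · rintro ⟨w, hlt, hw⟩
    have key := @coeff_sub_eq_magnus n T hT0 hT1 a b w.length (Or.inl (vanish _ _ w hlt))
    refine ⟨w, fun u hu => ?_, ?_⟩
    · have := key (length_le_of_degLexLT hu)
      rw [coeff_sub, coeff_sub, hlt u hu] at this
      linarith
    · have := key le_rfl
      rw [coeff_sub, coeff_sub] at this
      linarith
  · rintro ⟨w, hlt, hw⟩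
    have key := @coeff_sub_eq_magnus n T hT0 hT1 a b w.length (Or.inr (vanish _ _ w hlt))
    refine ⟨w, fun u hu => ?_, ?_⟩
    · have := key (length_le_of_degLexLT hu)
      rw [coeff_sub, coeff_sub, hlt u hu] at this
      linarith
    · have := key le_rfl
      rw [coeff_sub, coeff_sub] at this
      linarith

open NCSeries in
/-- A multiplicative map `T` with `T(x_i) = 1 + X_i + (words of length at least two)` is injective,
as `T(a) - T(b)` has the same lowest degree part as `μ(a) - μ(b)`. -/
theorem injective_of_leading_terms {n : ℕ} (T : FreeGroup (Fin n) →* NCSeries (Fin n))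
    (hT0 : ∀ i, (T (FreeGroup.of i)).coeff [] = 1)
    (hT1 : ∀ i j, (T (FreeGroup.of i)).coeff [j] = if i = j then 1 else 0) :
    Function.Injective T := by
  intro a b hab
  refine magnus_injective n (ext_coeff fun w => ?_)
  have h := @coeff_sub_eq_magnus n T hT0 hT1 a b w.length
    (Or.inr fun u _ => by rw [hab, sub_self]; rfl) w le_rfl
  rw [hab, sub_self, coeff_zero, coeff_sub] at h
  linarith

open NCSeries in
/-- If a group `G` has an injective expansion by series with constant term `1`, then `G_∞` is trivial:
the expansion sends the `k`-th power of the augmentation ideal to series without words of length less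
than `k`. -/
theorem dimensionInf_eq_bot_of_injective {G ι : Type} [Group G] (T : G →* NCSeries ι)
    (hT : Function.Injective T) (hT0 : ∀ g, (T g).coeff [] = 1) : dimensionInf G = ⊥ := by
  classical
  let A : MonoidAlgebra ℤ G →+* NCSeries ι := (MonoidAlgebra.lift ℤ (NCSeries ι) G T).toRingHom
  have hA : ∀ g, A (MonoidAlgebra.of ℤ G g) = T g := fun g => MonoidAlgebra.lift_of _ _
  have hconst : ∀ x ∈ augmentationIdeal G, (A x).coeff [] = 0 := by
    let c : NCSeries ι →+* ℝ :=
      { toFun := fun f => f.coeff []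
        map_one' := by simp [coeff_one]
        map_mul' := mul_nil
        map_zero' := rfl
        map_add' := fun _ _ => rfl }
    have hc : ∀ x : MonoidAlgebra ℤ G, c (A x) = (MonoidAlgebra.lift ℤ ℤ G 1 x : ℤ) := by
      intro x
      induction x using MonoidAlgebra.induction_on with
      | of g => rw [hA]; simpa using! hT0 g
      | add x y hx hy => simp only [map_add, hx, hy, Int.cast_add]
      | smul r x hx => simp [hx]
    intro x hx
    have hx0 : MonoidAlgebra.lift ℤ ℤ G 1 x = 0 := hx
    have := hc x
    rwa [hx0, Int.cast_zero] at this
  have hpow : ∀ k, ∀ x ∈ augmentationIdeal G ^ k, (A x).VanishesBelow k := by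
    intro k
    induction k with
    | zero => exact fun x _ w hw => absurd hw (Nat.not_lt_zero _)
    | succ k ih =>
      intro x hx
      rw [Submodule.pow_succ] at hx
      refine Submodule.smul_induction_on hx (fun r hr y hy => ?_) fun y z hy hz w hw => ?_
      · rw [smul_eq_mul, map_mul]
        refine (ih r hr).mul (b := 1) fun w hw => ?_
        rw [List.length_eq_zero_iff.1 (by omega : w.length = 0)]
        exact hconst y hy
      · rw [map_add, coeff_add, hy w hw, hz w hw, add_zero]
  rw [eq_bot_iff]
  intro g hg
  have hg' : ∀ k : ℕ, g ∈ dimensionSubgroup G (k + 1) := by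
    simpa [dimensionInf, Subgroup.mem_iInf] using hg
  have : T g - 1 = 0 := by
    refine VanishesBelow.eq_zero fun k w hw => ?_
    have := hpow (k + 1) _ (hg' k) w (by omega)
    rwa [map_sub, map_one, hA] at this
  exact hT (by rw [map_one]; exact sub_eq_zero.1 this)

/-! ### Iterated integrals along piecewise smooth curves -/

section Chen

open MeasureTheory Set

variable {ι : Type}

/-- `chenIter ω c b w s` is the iterated integral of the forms `ω_{w_1}, …, ω_{w_k}` along the part
of the curve `c` between the parameters `s` and `b`. -/
def chenIter (ω : ι → ℂ → ℂ [⋀^Fin 1]→L[ℝ] ℝ) (c : ℝ → ℂ) (b : ℝ) : List ι → ℝ → ℝ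
  | [], _ => 1
  | i :: w, s => ∫ t in s..b, ω i (c t) ![deriv c t] * chenIter ω c b w t

/-- The generating series of the iterated integrals of the forms `ω_i` along the part of the curve
`c` between the parameters `a` and `b`. -/
def chen (ω : ι → ℂ → ℂ [⋀^Fin 1]→L[ℝ] ℝ) (c : ℝ → ℂ) (a b : ℝ) : NCSeries ι :=
  ⟨fun w => chenIter ω c b w a⟩

/-- A regularity condition on curves that suffices for line integrals of continuous forms: the curve
is continuous, differentiable off a countable set, and has an integrable derivative. Unlike piecewise
smoothness, it restricts to subintervals without any bookkeeping. -/
structure PC1 (c : ℝ → ℂ) (a b : ℝ) : Prop where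
  cont : Continuous c
  diff : ∃ s : Set ℝ, s.Countable ∧ ∀ t ∈ Ioo a b, t ∉ s → DifferentiableAt ℝ c t
  int : IntervalIntegrable (deriv c) volume a b

theorem PC1.mono {c : ℝ → ℂ} {a b a' b' : ℝ} (h : PC1 c a b) (ha : a ≤ a') (hab : a' ≤ b')
    (hb : b' ≤ b) : PC1 c a' b' := by
  obtain ⟨s, hs, hd⟩ := h.diff
  refine ⟨h.cont, ⟨s, hs, fun t ht => hd t ⟨ha.trans_lt ht.1, ht.2.trans_le hb⟩⟩, h.int.mono_set ?_⟩
  rw [uIcc_of_le hab, uIcc_of_le (ha.trans (hab.trans hb))]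
  exact Icc_subset_Icc ha hb

theorem PC1.trans {c : ℝ → ℂ} {a b d : ℝ} (h : PC1 c a b) (h' : PC1 c b d) : PC1 c a d := by
  obtain ⟨s, hs, hd⟩ := h.diff
  obtain ⟨s', hs', hd'⟩ := h'.diff
  refine ⟨h.cont, ⟨insert b (s ∪ s'), (hs.union hs').insert b, fun t ht hts => ?_⟩,
    h.int.trans h'.int⟩
  simp only [mem_insert_iff, mem_union, not_or] at hts
  rcases lt_or_gt_of_ne hts.1 with hlt | hlt
  · exact hd t ⟨ht.1, hlt⟩ hts.2.1
  · exact hd' t ⟨hlt, ht.2⟩ hts.2.2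

theorem oneForm_apply (θ : ℂ [⋀^Fin 1]→L[ℝ] ℝ) (v : ℂ) :
    θ ![v] = v.re * θ ![1] + v.im * θ ![Complex.I] := by
  have h1 : ![v] = Function.update ![(0 : ℂ)] 0 (v.re • (1 : ℂ) + v.im • Complex.I) := by
    funext j
    fin_cases j
    simp [Complex.re_add_im]
  have h2 : ∀ u : ℂ, Function.update ![(0 : ℂ)] 0 u = ![u] := fun u => by
    funext j; fin_cases j; simp
  rw [h1, θ.map_update_add, θ.map_update_smul, θ.map_update_smul, h2, h2, smul_eq_mul, smul_eq_mul]

theorem continuousOn_oneForm_apply {X : Type} [TopologicalSpace X]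
    {θ : X → ℂ [⋀^Fin 1]→L[ℝ] ℝ} {s : Set X} (hθ : ContinuousOn θ s) (v : Fin 1 → ℂ) :
    ContinuousOn (fun x => θ x v) s :=
  (ContinuousAlternatingMap.apply ℝ ℂ ℝ v).continuous.comp_continuousOn hθ

variable {ω : ι → ℂ → ℂ [⋀^Fin 1]→L[ℝ] ℝ} {U : Set ℂ} {c : ℝ → ℂ} {a b : ℝ}

theorem intervalIntegrable_pullback {θ : ℂ → ℂ [⋀^Fin 1]→L[ℝ] ℝ} (hθ : ContinuousOn θ U)
    (hab : a ≤ b) (hc : PC1 c a b) (hU : MapsTo c (Icc a b) U) :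
    IntervalIntegrable (fun t => θ (c t) ![deriv c t]) volume a b := by
  have hθc : ContinuousOn (fun t => θ (c t)) (uIcc a b) := by
    rw [uIcc_of_le hab]
    exact hθ.comp hc.cont.continuousOn hU
  have hre : IntervalIntegrable (fun t => (deriv c t).re) volume a b :=
    ⟨hc.int.1.re, hc.int.2.re⟩
  have him : IntervalIntegrable (fun t => (deriv c t).im) volume a b :=
    ⟨hc.int.1.im, hc.int.2.im⟩
  simp_rw [fun t => oneForm_apply (θ (c t)) (deriv c t)]
  exact (hre.mul_continuousOn (continuousOn_oneForm_apply hθc _)).add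
    (him.mul_continuousOn (continuousOn_oneForm_apply hθc _))

theorem continuousOn_chenIter (hω : ∀ i, ContinuousOn (ω i) U) (hab : a ≤ b) (hc : PC1 c a b)
    (hU : MapsTo c (Icc a b) U) (w : List ι) : ContinuousOn (chenIter ω c b w) (Icc a b) := by
  induction w with
  | nil => exact continuousOn_const
  | cons i w ih =>
    have hint : IntegrableOn (fun t => ω i (c t) ![deriv c t] * chenIter ω c b w t)
        (uIcc a b) := by
      rw [uIcc_of_le hab]
      rw [← uIcc_of_le hab] at ih
      exact (intervalIntegrable_iff_integrableOn_Icc_of_le hab).1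
        ((intervalIntegrable_pullback (hω i) hab hc hU).mul_continuousOn ih)
    have := intervalIntegral.continuousOn_primitive_interval_left hint
    rwa [uIcc_of_le hab] at this

theorem intervalIntegrable_chenIter (hω : ∀ i, ContinuousOn (ω i) U) (hab : a ≤ b)
    (hc : PC1 c a b) (hU : MapsTo c (Icc a b) U) (i : ι) (w : List ι) :
    IntervalIntegrable (fun t => ω i (c t) ![deriv c t] * chenIter ω c b w t) volume a b := by
  refine (intervalIntegrable_pullback (hω i) hab hc hU).mul_continuousOn ?_
  rw [uIcc_of_le hab]
  exact continuousOn_chenIter hω hab hc hU w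

theorem coeff_chen_mul_cons (hω : ∀ i, ContinuousOn (ω i) U) (hab : a ≤ b)
    (hc : PC1 c a b) (hU : MapsTo c (Icc a b) U) (f : NCSeries ι) (i : ι) (w : List ι) :
    (chen ω c a b * f).coeff (i :: w) = f.coeff (i :: w) +
      ∫ t in a..b, ω i (c t) ![deriv c t] * (chen ω c t b * f).coeff w := by
  rw [NCSeries.mul_cons]
  congr 1
  · simp [chen, chenIter]
  · simp_rw [NCSeries.coeff_mul, Finset.mul_sum]
    rw [intervalIntegral.integral_finsetSum]
    · refine Finset.sum_congr rfl fun k _ => ?_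
      simp_rw [← mul_assoc]
      rw [intervalIntegral.integral_mul_const]
      rfl
    · intro k _
      simp_rw [← mul_assoc]
      exact (intervalIntegrable_chenIter hω hab hc hU i _).mul_const _

/-- Chen's product formula for a curve that is cut into two pieces. -/
theorem chen_mul (hω : ∀ i, ContinuousOn (ω i) U) {d : ℝ} (hab : a ≤ b) (hbd : b ≤ d)
    (hc : PC1 c a d) (hU : MapsTo c (Icc a d) U) :
    chen ω c a b * chen ω c b d = chen ω c a d := by
  refine NCSeries.ext_coeff fun w => ?_
  induction w generalizing a with
  | nil => rw [NCSeries.mul_nil]; simp [chen, chenIter]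
  | cons i w ih =>
    have hc1 := hc.mono le_rfl hab hbd
    have hc2 := hc.mono hab hbd le_rfl
    have hU1 : MapsTo c (Icc a b) U := hU.mono_left (Icc_subset_Icc_right hbd)
    have hU2 : MapsTo c (Icc b d) U := hU.mono_left (Icc_subset_Icc_left hab)
    have hI := intervalIntegrable_chenIter hω (hab.trans hbd) hc hU i w
    rw [coeff_chen_mul_cons hω hab hc1 hU1]
    have : ∫ t in a..b, ω i (c t) ![deriv c t] * (chen ω c t b * chen ω c b d).coeff w =
        ∫ t in a..b, ω i (c t) ![deriv c t] * chenIter ω c d w t := by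
      refine intervalIntegral.integral_congr fun t ht => ?_
      rw [uIcc_of_le hab] at ht
      rw [ih ht.2 (hc.mono ht.1 (ht.2.trans hbd) le_rfl)
        (hU.mono_left (Icc_subset_Icc_left ht.1))]
      rfl
    rw [this, add_comm]
    refine intervalIntegral.integral_add_adjacent_intervals (hI.mono_set ?_) (hI.mono_set ?_)
    · rw [uIcc_of_le hab, uIcc_of_le (hab.trans hbd)]
      exact Icc_subset_Icc_right hbd
    · rw [uIcc_of_le hbd, uIcc_of_le (hab.trans hbd)]
      exact Icc_subset_Icc_left hab

/-- Iterated integrals depend only on the restriction of the curve to the parameter interval. -/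
theorem chen_congr {c' : ℝ → ℂ} (hab : a ≤ b) (h : EqOn c c' (Icc a b)) :
    chen ω c a b = chen ω c' a b := by
  refine NCSeries.ext_coeff fun w => ?_
  show chenIter ω c b w a = chenIter ω c' b w a
  induction w generalizing a with
  | nil => rfl
  | cons i w ih =>
    refine intervalIntegral.integral_congr_ae ?_
    have hne : ∀ᵐ t : ℝ, t ≠ b := by simp [ae_iff, measure_singleton]
    filter_upwards [hne] with t htb ht
    rw [uIoc_of_le hab] at ht
    have ht' : t < b := lt_of_le_of_ne ht.2 htb
    have hev : c =ᶠ[nhds t] c' := by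
      filter_upwards [Ioo_mem_nhds ht.1 ht'] with s hs using h (Ioo_subset_Icc_self hs)
    rw [hev.deriv_eq, hev.eq_of_nhds, ih ht.2 (h.mono (Icc_subset_Icc_left ht.1.le))]

/-- Iterated integrals are invariant under increasing affine changes of the parameter. -/
theorem chen_comp_mul_add (k d : ℝ) :
    chen ω (fun t => c (k * t + d)) a b = chen ω c (k * a + d) (k * b + d) := by
  refine NCSeries.ext_coeff fun w => ?_
  show chenIter ω (fun t => c (k * t + d)) b w a = chenIter ω c (k * b + d) w (k * a + d)
  induction w generalizing a with
  | nil => rfl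
  | cons i w ih =>
    have hder : ∀ t, deriv (fun t => c (k * t + d)) t = k • deriv c (k * t + d) := fun t => by
      have h1 : (fun t => c (k * t + d)) = fun t => (fun s => c (s + d)) (k * t) := rfl
      rw [h1, deriv_comp_mul_left k (fun s => c (s + d)), deriv_comp_add_const]
    have hsm : ∀ (θ : ℂ [⋀^Fin 1]→L[ℝ] ℝ) (v : ℂ), θ ![k • v] = k * θ ![v] := fun θ v => by
      rw [oneForm_apply, oneForm_apply θ v]
      simp only [Complex.real_smul, Complex.re_ofReal_mul, Complex.im_ofReal_mul]
      ring
    simp only [chenIter, hder, ih, hsm]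
    rw [← intervalIntegral.smul_integral_comp_mul_add (fun s => ω i (c s) ![deriv c s] *
      chenIter ω c (k * b + d) w s), smul_eq_mul, ← intervalIntegral.integral_const_mul]
    simp only [mul_assoc]

/-! ### Parallel sections of the connection `∑ ω_i X_i` -/

/-- `Φ` is a parallel section over `V`, with constant term `1`: `dΦ = - ω Φ` for `ω = ∑ ω_i X_i`. -/
structure IsParallel (ω : ι → ℂ → ℂ [⋀^Fin 1]→L[ℝ] ℝ) (V : Set ℂ) (Φ : ℂ → NCSeries ι) : Prop where
  coeff_nil : ∀ z ∈ V, (Φ z).coeff [] = 1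
  deriv_cons : ∀ i w, ∀ z ∈ V, ∃ L : ℂ →L[ℝ] ℝ, HasFDerivAt (fun z => (Φ z).coeff (i :: w)) L z ∧
    ∀ v, L v = -((Φ z).coeff w * ω i z ![v])

theorem IsParallel.continuousOn {V : Set ℂ} {Φ : ℂ → NCSeries ι} (h : IsParallel ω V Φ)
    (w : List ι) : ContinuousOn (fun z => (Φ z).coeff w) V := by
  rcases w with _ | ⟨i, w⟩
  · exact continuousOn_const.congr h.coeff_nil
  · intro z hz
    obtain ⟨L, hL, -⟩ := h.deriv_cons i w z hz
    exact hL.continuousAt.continuousWithinAt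

/-- The generating series of iterated integrals is the parallel transport of the connection. -/
theorem IsParallel.chen_mul {V : Set ℂ} {Φ : ℂ → NCSeries ι} (h : IsParallel ω V Φ)
    (hω : ∀ i, ContinuousOn (ω i) V) (hab : a ≤ b) (hc : PC1 c a b) (hV : MapsTo c (Icc a b) V) :
    chen ω c a b * Φ (c b) = Φ (c a) := by
  refine NCSeries.ext_coeff fun w => ?_
  induction w generalizing a with
  | nil =>
    rw [NCSeries.mul_nil, h.coeff_nil _ (hV ⟨le_rfl, hab⟩), h.coeff_nil _ (hV ⟨hab, le_rfl⟩)]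
    simp [chen, chenIter]
  | cons i w ih =>
    rw [coeff_chen_mul_cons hω hab hc hV]
    have h1 : ∫ t in a..b, ω i (c t) ![deriv c t] * (chen ω c t b * Φ (c b)).coeff w =
        ∫ t in a..b, -(-((Φ (c t)).coeff w * ω i (c t) ![deriv c t])) := by
      refine intervalIntegral.integral_congr fun t ht => ?_
      rw [uIcc_of_le hab] at ht
      rw [ih ht.2 (hc.mono ht.1 ht.2 le_rfl) (hV.mono_left (Icc_subset_Icc_left ht.1))]
      ring
    obtain ⟨s, hs, hd⟩ := hc.diff
    have hcont : ContinuousOn (fun t => (Φ (c t)).coeff w) (uIcc a b) := by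
      rw [uIcc_of_le hab]
      exact (h.continuousOn w).comp hc.cont.continuousOn hV
    have h2 : ∫ t in a..b, -((Φ (c t)).coeff w * ω i (c t) ![deriv c t]) =
        (Φ (c b)).coeff (i :: w) - (Φ (c a)).coeff (i :: w) := by
      refine integral_eq_of_hasDerivAt_off_countable_of_le
        (fun t => (Φ (c t)).coeff (i :: w)) _ hab hs ?_ (fun t ht => ?_) ?_
      · exact (h.continuousOn (i :: w)).comp hc.cont.continuousOn hV
      · obtain ⟨L, hL, hL'⟩ := h.deriv_cons i w (c t) (hV (Ioo_subset_Icc_self ht.1))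
        rw [← hL']
        exact hL.comp_hasDerivAt t (hd t ht.1 ht.2).hasDerivAt
      · exact ((intervalIntegrable_pullback (hω i) hab hc hV).continuousOn_mul hcont).neg
    rw [h1, intervalIntegral.integral_neg, h2]
    ring

/-- A `1`-form at a point as a linear functional. -/
def oneFormCLM (θ : ℂ [⋀^Fin 1]→L[ℝ] ℝ) : ℂ →L[ℝ] ℝ :=
  θ ![1] • Complex.reCLM + θ ![Complex.I] • Complex.imCLM

theorem oneFormCLM_apply (θ : ℂ [⋀^Fin 1]→L[ℝ] ℝ) (v : ℂ) : oneFormCLM θ v = θ ![v] := by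
  rw [oneForm_apply]
  simp [oneFormCLM, mul_comm]

theorem contDiffOn_oneFormCLM {θ : ℂ → ℂ [⋀^Fin 1]→L[ℝ] ℝ} {V : Set ℂ} {n : WithTop ℕ∞}
    (hθ : ContDiffOn ℝ n θ V) : ContDiffOn ℝ n (fun z => oneFormCLM (θ z)) V := by
  have h : ∀ v : Fin 1 → ℂ, ContDiffOn ℝ n (fun z => θ z v) V := fun v =>
    (ContinuousAlternatingMap.apply ℝ ℂ ℝ v).contDiff.comp_contDiffOn hθ
  exact ((h _).smul contDiffOn_const).add ((h _).smul contDiffOn_const)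

theorem differentiableAt_form_apply {X : Type} [NormedAddCommGroup X] [NormedSpace ℝ X] {q : ℕ}
    {θ : X → ℂ [⋀^Fin q]→L[ℝ] ℝ} {z : X} (hθ : DifferentiableAt ℝ θ z) (v : Fin q → ℂ) :
    DifferentiableAt ℝ (fun z => θ z v) z :=
  (ContinuousAlternatingMap.apply ℝ ℂ ℝ v).differentiableAt.comp z hθ

theorem extDeriv_oneForm_apply {θ : ℂ → ℂ [⋀^Fin 1]→L[ℝ] ℝ} {z : ℂ}
    (hθ : DifferentiableAt ℝ θ z) (u v : ℂ) :
    extDeriv θ z ![u, v] = fderiv ℝ (fun z => θ z ![v]) z u - fderiv ℝ (fun z => θ z ![u]) z v := by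
  rw [extDeriv_apply hθ, Fin.sum_univ_two]
  have h0 : Fin.removeNth 0 ![u, v] = ![v] := by
    funext j; fin_cases j; rfl
  have h1 : Fin.removeNth 1 ![u, v] = ![u] := by
    funext j; fin_cases j; rfl
  rw [h0, h1]
  simp [sub_eq_add_neg]

theorem fderiv_oneFormCLM {θ : ℂ → ℂ [⋀^Fin 1]→L[ℝ] ℝ} {z : ℂ}
    (hθ : DifferentiableAt ℝ θ z) (u v : ℂ) :
    fderiv ℝ (fun z => oneFormCLM (θ z)) z u v = fderiv ℝ (fun z => θ z ![v]) z u := by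
  have hd : DifferentiableAt ℝ (fun z => oneFormCLM (θ z)) z := by
    exact ((differentiableAt_form_apply hθ _).smul_const _).add
      ((differentiableAt_form_apply hθ _).smul_const _)
  have : (fun z => θ z ![v]) = fun z => oneFormCLM (θ z) v :=
    funext fun z => (oneFormCLM_apply _ _).symm
  rw [this, fderiv_clm_apply hd (differentiableAt_const v)]
  simp

open Classical in
/-- A primitive on `V` of the field `Θ` of linear functionals, if there is one. -/
def primitiveOn (V : Set ℂ) (Θ : ℂ → ℂ →L[ℝ] ℝ) : ℂ → ℝ :=
  if h : ∃ f : ℂ → ℝ, ∀ z ∈ V, HasFDerivAt f (Θ z) z then h.choose else 0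

/-- The coefficients of a parallel section, by successive integration: `dΦ_{i w} = - Φ_w ω_i`. -/
def parallelCoeff (ω : ι → ℂ → ℂ [⋀^Fin 1]→L[ℝ] ℝ) (V : Set ℂ) : List ι → ℂ → ℝ
  | [] => fun _ => 1
  | i :: w => primitiveOn V fun z => -(parallelCoeff ω V w z • oneFormCLM (ω i z))

/-- Over a convex open set, the connection `∑ ω_i X_i` has a parallel section: as the forms are
closed and have wedge products zero, all forms `Φ_w ω_i` that have to be integrated are closed. -/
theorem exists_isParallel {V : Set ℂ} (hV : Convex ℝ V) (hVo : IsOpen V)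
    (hd : ∀ i, DifferentiableOn ℝ (ω i) V) (hcl : ∀ i, ∀ z ∈ V, extDeriv (ω i) z = 0)
    (hw : ∀ i j, ∀ z ∈ V, ∀ u v : ℂ, ω i z ![u] * ω j z ![v] - ω i z ![v] * ω j z ![u] = 0) :
    ∃ Φ, IsParallel ω V Φ := by
  have step : ∀ (w : List ι) (i : ι), (∃ L : ℂ → ℂ →L[ℝ] ℝ,
      (∀ z ∈ V, HasFDerivAt (parallelCoeff ω V w) (L z) z) ∧
      ∀ i, ∀ z ∈ V, ∀ u v, L z u * ω i z ![v] = L z v * ω i z ![u]) →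
      ∀ z ∈ V, HasFDerivAt (parallelCoeff ω V (i :: w))
        (-(parallelCoeff ω V w z • oneFormCLM (ω i z))) z := by
    rintro w i ⟨L, hL, hsym⟩
    have hdi : ∀ z ∈ V, DifferentiableAt ℝ (ω i) z := fun z hz =>
      (hd i z hz).differentiableAt (hVo.mem_nhds hz)
    have hdc : ∀ z ∈ V, DifferentiableAt ℝ (fun z => oneFormCLM (ω i z)) z := fun z hz =>
      ((differentiableAt_form_apply (hdi z hz) _).smul_const _).add
        ((differentiableAt_form_apply (hdi z hz) _).smul_const _)
    have hex : ∃ f : ℂ → ℝ, ∀ z ∈ V, HasFDerivAt f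
        (-(parallelCoeff ω V w z • oneFormCLM (ω i z))) z := by
      refine hV.exists_forall_hasFDerivAt_of_fderiv_symmetric hVo
        (ω := fun z => -(parallelCoeff ω V w z • oneFormCLM (ω i z))) ?_ ?_
      · exact fun z hz => (((hL z hz).differentiableAt.smul (hdc z hz)).neg).differentiableWithinAt
      · intro z hz u v
        have hF := ((hL z hz).smul (hdc z hz).hasFDerivAt).neg
        have hcl' : fderiv ℝ (fun z => ω i z ![v]) z u - fderiv ℝ (fun z => ω i z ![u]) z v = 0 := by
          rw [← extDeriv_oneForm_apply (hdi z hz), hcl i z hz]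
          rfl
        have hs := hsym i z hz u v
        have hF' : fderiv ℝ (fun z => -(parallelCoeff ω V w z • oneFormCLM (ω i z))) z = _ :=
          hF.fderiv
        rw [hF']
        simp only [neg_apply, add_apply,
          smul_apply, ContinuousLinearMap.smulRight_apply,
          fderiv_oneFormCLM (hdi z hz), oneFormCLM_apply, smul_eq_mul]
        linear_combination (-(parallelCoeff ω V w z)) * hcl' - hs
    intro z hz
    have : parallelCoeff ω V (i :: w) = hex.choose := by
      rw [parallelCoeff, primitiveOn, dif_pos hex]
    rw [this]
    exact hex.choose_spec z hz
  have key : ∀ w : List ι, ∃ L : ℂ → ℂ →L[ℝ] ℝ,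
      (∀ z ∈ V, HasFDerivAt (parallelCoeff ω V w) (L z) z) ∧
      ∀ i, ∀ z ∈ V, ∀ u v, L z u * ω i z ![v] = L z v * ω i z ![u] := by
    intro w
    induction w with
    | nil => exact ⟨fun _ => 0, fun z _ => hasFDerivAt_const _ _, fun i z _ u v => by simp⟩
    | cons i w ih =>
      refine ⟨_, step w i ih, fun j z hz u v => ?_⟩
      have := hw i j z hz u v
      simp only [neg_apply, smul_apply, oneFormCLM_apply,
        smul_eq_mul]
      linear_combination (-(parallelCoeff ω V w z)) * this
  refine ⟨fun z => ⟨fun w => parallelCoeff ω V w z⟩, fun z _ => rfl, fun i w z hz => ?_⟩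
  refine ⟨_, step w i (key w) z hz, fun v => ?_⟩
  simp [oneFormCLM_apply]

end Chen

/-! ### Homotopy invariance of local transports -/

section Homotopy

open Set unitInterval

/-- The product `τ(f_0, f_1) τ(f_1, f_2) ⋯ τ(f_{N-1}, f_N)`. -/
def stepProd {X M : Type} [Monoid M] (τ : X → X → M) (f : ℕ → X) : ℕ → M
  | 0 => 1
  | n + 1 => stepProd τ f n * τ (f n) (f (n + 1))

/-- Comparison of two rows of a grid, all of whose squares commute. -/
theorem stepProd_ladder {X M : Type} [Monoid M] (τ : X → X → M) (f g : ℕ → X)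
    (h : ∀ n, τ (f n) (f (n + 1)) * τ (f (n + 1)) (g (n + 1)) =
      τ (f n) (g n) * τ (g n) (g (n + 1))) (N : ℕ) :
    stepProd τ f N * τ (f N) (g N) = τ (f 0) (g 0) * stepProd τ g N := by
  induction N with
  | zero => simp [stepProd]
  | succ n ih => rw [stepProd, stepProd, mul_assoc, h, ← mul_assoc, ih, mul_assoc]

/-- Two homotopic paths have a common subdivision, fine with respect to a given open cover, along
which they have the same product of local transports `τ`. -/
theorem exists_stepProd_eq_of_homotopic {X M : Type} [TopologicalSpace X] [Monoid M]
    (τ : X → X → M) (good : Set X → Prop)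
    (hcover : ∀ x, ∃ V, IsOpen V ∧ x ∈ V ∧ good V)
    (hτ : ∀ V, good V → ∀ a ∈ V, ∀ b ∈ V, ∀ c ∈ V, τ a b * τ b c = τ a c)
    (hone : ∀ x, τ x x = 1) {x y : X} {γ₀ γ₁ : Path x y} (h : γ₀.Homotopic γ₁) :
    ∃ (t : ℕ → I) (N : ℕ), t 0 = 0 ∧ Monotone t ∧ t N = 1 ∧
      (∀ n, ∃ V, good V ∧ ∀ s ∈ Icc (t n) (t (n + 1)), γ₀ s ∈ V) ∧
      (∀ n, ∃ V, good V ∧ ∀ s ∈ Icc (t n) (t (n + 1)), γ₁ s ∈ V) ∧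
      stepProd τ (fun n => γ₀ (t n)) N = stepProd τ (fun n => γ₁ (t n)) N := by
  obtain ⟨H⟩ := h
  choose V hVo hxV hV using hcover
  obtain ⟨t, ht0, htm, ⟨N, hN⟩, ht⟩ := exists_monotone_Icc_subset_open_cover_unitInterval_prod_self
    (c := fun x => H ⁻¹' V x) (fun x => (hVo x).preimage H.continuous)
    (fun p _ => mem_iUnion.2 ⟨H p, hxV _⟩)
  have hle : ∀ n, t n ∈ Icc (t n) (t (n + 1)) := fun n => ⟨le_rfl, htm (Nat.le_succ n)⟩
  have hle' : ∀ n, t (n + 1) ∈ Icc (t n) (t (n + 1)) := fun n => ⟨htm (Nat.le_succ n), le_rfl⟩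
  have hrow : ∀ j, stepProd τ (fun n => H (t j, t n)) N =
      stepProd τ (fun n => H (t (j + 1), t n)) N := by
    intro j
    have := stepProd_ladder τ (fun n => H (t j, t n)) (fun n => H (t (j + 1), t n)) (fun n => by
      obtain ⟨v, hv⟩ := ht j n
      have m : ∀ {a b}, a ∈ Icc (t j) (t (j + 1)) → b ∈ Icc (t n) (t (n + 1)) → H (a, b) ∈ V v :=
        fun ha hb => hv (mk_mem_prod ha hb)
      rw [hτ _ (hV v) _ (m (hle j) (hle n)) _ (m (hle j) (hle' n)) _ (m (hle' j) (hle' n)),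
        hτ _ (hV v) _ (m (hle j) (hle n)) _ (m (hle' j) (hle n)) _ (m (hle' j) (hle' n))]) N
    simpa [hN N le_rfl, ht0, hone] using this
  have hall : ∀ j, stepProd τ (fun n => H (t 0, t n)) N = stepProd τ (fun n => H (t j, t n)) N := by
    intro j
    induction j with
    | zero => rfl
    | succ j ih => rw [ih, hrow]
  refine ⟨t, N, ht0, htm, hN N le_rfl, fun n => ?_, fun n => ?_, ?_⟩
  · obtain ⟨v, hv⟩ := ht 0 n
    refine ⟨V v, hV v, fun s hs => ?_⟩
    have := hv (mk_mem_prod (hle 0) hs)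
    rw [ht0] at this
    simpa using this
  · obtain ⟨v, hv⟩ := ht N n
    refine ⟨V v, hV v, fun s hs => ?_⟩
    have := hv (mk_mem_prod (hle N) hs)
    rw [hN N le_rfl] at this
    simpa using this
  · have := hall N
    rw [ht0, hN N le_rfl] at this
    simpa using this

/-- A property of homotopy classes of paths that is closed under composition and holds for all short
paths holds for all paths. -/
theorem pathClass_induction {X : Type} [TopologicalSpace X]
    (P : ∀ {x y : X}, Path.Homotopic.Quotient x y → Prop)
    (htrans : ∀ {x y z : X} (δ : Path.Homotopic.Quotient x y) (δ' : Path.Homotopic.Quotient y z),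
      P δ → P δ' → P (δ.trans δ'))
    (hcover : ∀ x : X, ∃ V : Set X, IsOpen V ∧ x ∈ V ∧
      ∀ {y z : X} (γ : Path y z), (∀ t, γ t ∈ V) → P (Path.Homotopic.Quotient.mk γ))
    {x y : X} (δ : Path.Homotopic.Quotient x y) : P δ := by
  obtain ⟨γ, rfl⟩ := Path.Homotopic.Quotient.mk_surjective δ
  choose V hVo hxV hV using hcover
  obtain ⟨t, ht0, htm, ⟨N, hN⟩, ht⟩ := exists_monotone_Icc_subset_open_cover_unitInterval
    (c := fun x => γ ⁻¹' V x) (fun x => (hVo x).preimage γ.continuous)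
    (fun p _ => mem_iUnion.2 ⟨γ p, hxV _⟩)
  have hsub : ∀ n, P (Path.Homotopic.Quotient.mk (γ.subpath (t 0) (t n))) := by
    intro n
    induction n with
    | zero =>
      refine hV (γ (t 0)) _ fun s => ?_
      have : (γ.subpath (t 0) (t 0)) s = γ (t 0) := by simp
      rw [this]
      exact hxV _
    | succ n ih =>
      obtain ⟨v, hv⟩ := ht n
      have h1 : P (Path.Homotopic.Quotient.mk (γ.subpath (t n) (t (n + 1)))) := by
        refine hV v _ fun s => ?_
        have hs : (γ.subpath (t n) (t (n + 1))) s ∈ range (γ.subpath (t n) (t (n + 1))) :=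
          mem_range_self s
        rw [Path.range_subpath_of_le _ _ _ (htm (Nat.le_succ n))] at hs
        obtain ⟨u, hu, hus⟩ := hs
        rw [← hus]
        exact hv hu
      have h2 := htrans _ _ ih h1
      rw [← Path.Homotopic.Quotient.mk_trans, Path.Homotopic.Quotient.eq.2
        ⟨Path.Homotopy.subpathTransSubpath γ (t 0) (t n) (t (n + 1))⟩] at h2
      exact h2
  have h1 := hsub N
  rw [ht0, hN N le_rfl, Path.subpath_zero_one] at h1
  have hx := γ.source
  have hy := γ.target
  have : ∀ (x' y' : X) (hx : x' = x) (hy : y' = y),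
      P (Path.Homotopic.Quotient.mk (γ.cast hx hy)) → P (Path.Homotopic.Quotient.mk γ) := by
    rintro _ _ rfl rfl h
    exact h
  exact this _ _ hx hy h1

/-- Two paths inside a simply connected set are homotopic. -/
theorem homotopic_of_mem {U S : Set ℂ} (hSU : S ⊆ U) [SimplyConnectedSpace S] {x y : U}
    (γ γ' : Path x y) (h : ∀ t, (γ t : ℂ) ∈ S) (h' : ∀ t, (γ' t : ℂ) ∈ S) : γ.Homotopic γ' := by
  have hx : (x : ℂ) ∈ S := by simpa using h 0
  have hy : (y : ℂ) ∈ S := by simpa using h 1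
  let lift : ∀ δ : Path x y, (∀ t, (δ t : ℂ) ∈ S) → Path (⟨x, hx⟩ : S) ⟨y, hy⟩ := fun δ hδ =>
    { toFun := fun t => ⟨δ t, hδ t⟩
      continuous_toFun := by fun_prop
      source' := by simp
      target' := by simp }
  have := (SimplyConnectedSpace.paths_homotopic (lift γ h) (lift γ' h')).map
    ⟨inclusion hSU, continuous_inclusion hSU⟩
  exact this

end Homotopy

/-! ### Piecewise smooth curves -/

section Piecewise

open Set MeasureTheory

/-- The curve in `ℂ` that underlies a path in a subset, constant outside the unit interval. -/
def pathCurve {U : Set ℂ} {x y : U} (γ : Path x y) : ℝ → ℂ := fun t => (γ.extend t : ℂ)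

theorem continuous_pathCurve {U : Set ℂ} {x y : U} (γ : Path x y) : Continuous (pathCurve γ) :=
  continuous_subtype_val.comp γ.continuous_extend

theorem pathCurve_mem {U : Set ℂ} {x y : U} (γ : Path x y) (t : ℝ) : pathCurve γ t ∈ U :=
  (γ.extend t).2

theorem pathCurve_zero {U : Set ℂ} {x y : U} (γ : Path x y) : pathCurve γ 0 = x := by
  simp [pathCurve]

theorem pathCurve_one {U : Set ℂ} {x y : U} (γ : Path x y) : pathCurve γ 1 = y := by
  simp [pathCurve]

theorem pathCurve_coe {U : Set ℂ} {x y : U} (γ : Path x y) (t : unitInterval) :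
    pathCurve γ t = γ t := by
  simp [pathCurve]

theorem PC1.refl {c : ℝ → ℂ} (hc : Continuous c) (a : ℝ) : PC1 c a a :=
  ⟨hc, ⟨∅, countable_empty, fun _ ht => absurd (ht.1.trans ht.2) (lt_irrefl _)⟩,
    IntervalIntegrable.refl⟩

theorem PC1.of_contDiffOn {c : ℝ → ℂ} (hc : Continuous c) {a b : ℝ} (hab : a ≤ b)
    (h : ContDiffOn ℝ (⊤ : ℕ∞) c (Icc a b)) : PC1 c a b := by
  rcases hab.eq_or_lt with rfl | hlt
  · exact PC1.refl hc a
  refine ⟨hc, ⟨∅, countable_empty, fun t ht _ => ?_⟩, ?_⟩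
  · exact (h.differentiableOn (by simp) t (Ioo_subset_Icc_self ht)).differentiableAt
      (Icc_mem_nhds ht.1 ht.2)
  · have h1 : ContinuousOn (derivWithin c (Icc a b)) (Icc a b) :=
      h.continuousOn_derivWithin (uniqueDiffOn_Icc hlt) (by simp)
    refine (h1.intervalIntegrable_of_Icc hab).congr_ae ?_
    have hne : ∀ᵐ t : ℝ, t ≠ b := by simp [ae_iff, measure_singleton]
    rw [Filter.EventuallyEq, ae_restrict_iff' measurableSet_uIoc]
    filter_upwards [hne] with t htb ht
    rw [uIoc_of_le hab] at ht
    exact derivWithin_of_mem_nhds (Icc_mem_nhds ht.1 (lt_of_le_of_ne ht.2 htb))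

/-- The curve is smooth on each piece of some finite partition of `[a, b]`. -/
inductive PSOn (c : ℝ → ℂ) : ℝ → ℝ → Prop
  | refl (a : ℝ) : PSOn c a a
  | cons {a b d : ℝ} : a ≤ b → ContDiffOn ℝ (⊤ : ℕ∞) c (Icc a b) → PSOn c b d → PSOn c a d

theorem PSOn.le {c : ℝ → ℂ} {a b : ℝ} (h : PSOn c a b) : a ≤ b := by
  induction h with
  | refl => exact le_rfl
  | cons hab _ _ ih => exact hab.trans ih

theorem PSOn.trans {c : ℝ → ℂ} {a b d : ℝ} (h : PSOn c a b) (h' : PSOn c b d) : PSOn c a d := by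
  induction h with
  | refl => exact h'
  | cons hab hs _ ih => exact .cons hab hs (ih h')

theorem PSOn.congr {c c' : ℝ → ℂ} {a b : ℝ} (h : PSOn c a b) (hcc : EqOn c' c (Icc a b)) :
    PSOn c' a b := by
  induction h with
  | refl => exact .refl _
  | cons hab hs h ih =>
    exact .cons hab (hs.congr fun t ht => hcc ⟨ht.1, ht.2.trans h.le⟩)
      (ih fun t ht => hcc ⟨hab.trans ht.1, ht.2⟩)

theorem PSOn.comp_mul_add {c : ℝ → ℂ} {a b : ℝ} (h : PSOn c a b) {k : ℝ} (hk : 0 < k) (d : ℝ) :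
    PSOn (fun t => c (k * t + d)) ((a - d) / k) ((b - d) / k) := by
  induction h with
  | refl => exact .refl _
  | cons hab hs _ ih =>
    refine .cons (by gcongr) (hs.comp (by fun_prop) fun t ht => ?_) ih
    have h1 := (div_le_iff₀ hk).1 ht.1
    have h2 := (le_div_iff₀ hk).1 ht.2
    constructor <;> linarith

theorem PSOn.pc1 {c : ℝ → ℂ} {a b : ℝ} (h : PSOn c a b) (hc : Continuous c) : PC1 c a b := by
  induction h with
  | refl a => exact PC1.refl hc a
  | cons hab hs _ ih => exact (PC1.of_contDiffOn hc hab hs).trans ih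

theorem PSOn.exists_partition {c : ℝ → ℂ} {a b : ℝ} (h : PSOn c a b) :
    ∃ (m : ℕ) (t : Fin (m + 1) → ℝ), Monotone t ∧ t 0 = a ∧ t (Fin.last m) = b ∧
      ∀ i : Fin m, ContDiffOn ℝ (⊤ : ℕ∞) c (Icc (t i.castSucc) (t i.succ)) := by
  induction h with
  | refl a => exact ⟨0, fun _ => a, monotone_const, rfl, rfl, fun i => i.elim0⟩
  | @cons a b d hab hs _ ih =>
    obtain ⟨m, t, hm, h0, h1, hi⟩ := ih
    refine ⟨m + 1, Fin.cons a t, ?_, rfl, ?_, fun i => ?_⟩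
    · refine Fin.monotone_iff_le_succ.2 fun i => ?_
      refine Fin.cases ?_ (fun j => ?_) i
      · simpa [h0] using hab
      · rw [← Fin.succ_castSucc, Fin.cons_succ, Fin.cons_succ]
        exact hm (Fin.castSucc_le_succ j)
    · rw [← Fin.succ_last, Fin.cons_succ, h1]
    · refine Fin.cases ?_ (fun j => ?_) i
      · simpa [h0] using hs
      · rw [← Fin.succ_castSucc, Fin.cons_succ, Fin.cons_succ]
        exact hi j

theorem PSOn.piecewiseSmooth {U : Set ℂ} {x₀ : U} {γ : Path x₀ x₀} (h : PSOn (pathCurve γ) 0 1) :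
    PiecewiseSmooth γ :=
  h.exists_partition

theorem _root_.PiecewiseSmooth.pc1 {U : Set ℂ} {x₀ : U} {γ : Path x₀ x₀} (h : PiecewiseSmooth γ) :
    PC1 (pathCurve γ) 0 1 := by
  obtain ⟨m, t, hm, h0, h1, hi⟩ := h
  have key : ∀ k : Fin (m + 1), PC1 (pathCurve γ) (t 0) (t k) := by
    intro k
    induction k using Fin.induction with
    | zero => exact PC1.refl (continuous_pathCurve γ) _
    | succ i ih =>
      exact ih.trans (PC1.of_contDiffOn (continuous_pathCurve γ) (hm (Fin.castSucc_le_succ i)) (hi i))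
  have := key (Fin.last m)
  rwa [h0, h1] at this

theorem pathCurve_trans_left {U : Set ℂ} {x y z : U} (γ : Path x y) (γ' : Path y z) :
    EqOn (pathCurve (γ.trans γ')) (fun t => pathCurve γ (2 * t + 0)) (Icc 0 (1 / 2)) := by
  intro t ht
  simp only [pathCurve]
  rw [Path.extend_trans_of_le_half _ _ ht.2, add_zero]

theorem pathCurve_trans_right {U : Set ℂ} {x y z : U} (γ : Path x y) (γ' : Path y z) :
    EqOn (pathCurve (γ.trans γ')) (fun t => pathCurve γ' (2 * t + -1)) (Icc (1 / 2) 1) := by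
  intro t ht
  simp only [pathCurve]
  rw [Path.extend_trans_of_half_le _ _ ht.1, ← sub_eq_add_neg]

theorem PSOn.path_trans {U : Set ℂ} {x y z : U} {γ : Path x y} {γ' : Path y z}
    (h : PSOn (pathCurve γ) 0 1) (h' : PSOn (pathCurve γ') 0 1) :
    PSOn (pathCurve (γ.trans γ')) 0 1 := by
  have h1 := h.comp_mul_add (two_pos) 0
  have h2 := h'.comp_mul_add (two_pos) (-1)
  norm_num at h1 h2
  refine PSOn.trans (b := 1 / 2) (h1.congr ?_) (h2.congr ?_)
  · simpa using pathCurve_trans_left γ γ'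
  · simpa using pathCurve_trans_right γ γ'

theorem exists_segment_path {U V : Set ℂ} (hVU : V ⊆ U) (hV : Convex ℝ V) {y z : U}
    (hy : (y : ℂ) ∈ V) (hz : (z : ℂ) ∈ V) :
    ∃ σ : Path y z, PSOn (pathCurve σ) 0 1 ∧ ∀ t, (σ t : ℂ) ∈ V := by
  have hmem : ∀ t : unitInterval, Path.segment (y : ℂ) z t ∈ V := fun t =>
    hV.lineMap_mem hy hz t.2
  let σ : Path y z :=
    { toFun := fun t => ⟨Path.segment (y : ℂ) z t, hVU (hmem t)⟩
      continuous_toFun := by fun_prop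
      source' := by simp
      target' := by simp }
  refine ⟨σ, .cons zero_le_one ?_ (.refl 1), hmem⟩
  refine ContDiffOn.congr (f := fun t : ℝ => AffineMap.lineMap (y : ℂ) (z : ℂ) t) ?_ ?_
  · simp only [AffineMap.lineMap_apply_module']
    fun_prop
  · intro t ht
    exact pathCurve_coe σ ⟨t, ht⟩

/-- Every homotopy class of paths in an open set contains a piecewise smooth path. -/
theorem exists_psOn_of_isOpen {U : Set ℂ} (hU : IsOpen U) {x y : U}
    (δ : Path.Homotopic.Quotient x y) :
    ∃ γ : Path x y, PSOn (pathCurve γ) 0 1 ∧ Path.Homotopic.Quotient.mk γ = δ := by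
  refine pathClass_induction (fun {x y} δ => ∃ γ : Path x y, PSOn (pathCurve γ) 0 1 ∧
    Path.Homotopic.Quotient.mk γ = δ) ?_ ?_ δ
  · rintro x y z _ _ ⟨γ, hγ, rfl⟩ ⟨γ', hγ', rfl⟩
    exact ⟨γ.trans γ', hγ.path_trans hγ', Path.Homotopic.Quotient.mk_trans _ _⟩
  · intro x
    obtain ⟨r, hr, hball⟩ := Metric.isOpen_iff.1 hU x x.2
    refine ⟨Subtype.val ⁻¹' Metric.ball (x : ℂ) r, Metric.isOpen_ball.preimage continuous_subtype_val,
      Metric.mem_ball_self hr, fun {y z} γ hγ => ?_⟩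
    have hy : (y : ℂ) ∈ Metric.ball (x : ℂ) r := by
      have := hγ 0
      rwa [γ.source] at this
    have hz : (z : ℂ) ∈ Metric.ball (x : ℂ) r := by
      have := hγ 1
      rwa [γ.target] at this
    obtain ⟨σ, hσ, hmem⟩ := exists_segment_path hball (convex_ball (x : ℂ) r) hy hz
    have : ContractibleSpace (Metric.ball (x : ℂ) r) :=
      (convex_ball (x : ℂ) r).contractibleSpace ⟨x, Metric.mem_ball_self hr⟩
    exact ⟨σ, hσ, Path.Homotopic.Quotient.eq.2 (homotopic_of_mem hball σ γ hmem hγ)⟩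

end Piecewise

/-! ### Parallel transport along homotopy classes -/

section Transport

open Set MeasureTheory

variable {ι : Type}

/-- Smooth closed `1`-forms on `U` all of whose wedge products vanish; equivalently, the connection
`∑ ω_i X_i` is flat. -/
structure IsFlatSystem (ω : ι → ℂ → ℂ [⋀^Fin 1]→L[ℝ] ℝ) (U : Set ℂ) : Prop where
  smooth : ∀ i, ContDiffOn ℝ (⊤ : ℕ∞) (ω i) U
  closed : ∀ i, ∀ z ∈ U, extDeriv (ω i) z = 0
  wedge : ∀ i j, ∀ z ∈ U, ∀ u v : ℂ, ω i z ![u] * ω j z ![v] - ω i z ![v] * ω j z ![u] = 0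

theorem IsFlatSystem.exists_isParallel {ω : ι → ℂ → ℂ [⋀^Fin 1]→L[ℝ] ℝ} {U V : Set ℂ}
    (h : IsFlatSystem ω U) (hVU : V ⊆ U) (hV : Convex ℝ V) (hVo : IsOpen V) :
    ∃ Φ, IsParallel ω V Φ :=
  _root_.exists_isParallel hV hVo (fun i => ((h.smooth i).differentiableOn (by simp)).mono hVU)
    (fun i z hz => h.closed i z (hVU hz)) fun i j z hz => h.wedge i j z (hVU hz)

theorem isFlatSystem_single {θ : ℂ → ℂ [⋀^Fin 1]→L[ℝ] ℝ} {U : Set ℂ}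
    (hθ : ContDiffOn ℝ (⊤ : ℕ∞) θ U) (hcl : ∀ z ∈ U, extDeriv θ z = 0) :
    IsFlatSystem (fun _ : Unit => θ) U :=
  ⟨fun _ => hθ, fun _ => hcl, fun _ _ z _ u v => by ring⟩

/-- The generating series of iterated integrals along a straight segment. -/
def segTransport (ω : ι → ℂ → ℂ [⋀^Fin 1]→L[ℝ] ℝ) (x y : ℂ) : NCSeries ι :=
  chen ω (fun t => AffineMap.lineMap x y t) 0 1

theorem pc1_lineMap (x y : ℂ) : PC1 (fun t : ℝ => AffineMap.lineMap x y t) 0 1 := by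
  have h : ContDiff ℝ (⊤ : ℕ∞) (fun t : ℝ => AffineMap.lineMap x y t) := by
    simp only [AffineMap.lineMap_apply_module']
    fun_prop
  exact PC1.of_contDiffOn h.continuous zero_le_one h.contDiffOn

variable {ω : ι → ℂ → ℂ [⋀^Fin 1]→L[ℝ] ℝ} {U : Set ℂ}

theorem IsParallel.segTransport_mul {V : Set ℂ} {Φ : ℂ → NCSeries ι} (h : IsParallel ω V Φ)
    (hω : ∀ i, ContinuousOn (ω i) V) (hV : Convex ℝ V) {x y : ℂ} (hx : x ∈ V) (hy : y ∈ V) :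
    segTransport ω x y * Φ y = Φ x := by
  have := h.chen_mul hω zero_le_one (pc1_lineMap x y) fun t ht => hV.lineMap_mem hx hy ht
  simpa [segTransport] using this

theorem chen_eq_segTransport (h : IsFlatSystem ω U) {V : Set ℂ} (hVU : V ⊆ U) (hV : Convex ℝ V)
    (hVo : IsOpen V) {c : ℝ → ℂ} {a b : ℝ} (hab : a ≤ b) (hc : PC1 c a b)
    (hcV : MapsTo c (Icc a b) V) : chen ω c a b = segTransport ω (c a) (c b) := by
  obtain ⟨Φ, hΦ⟩ := h.exists_isParallel hVU hV hVo
  have hω : ∀ i, ContinuousOn (ω i) V := fun i => (h.smooth i).continuousOn.mono hVU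
  have ha := hcV ⟨le_rfl, hab⟩
  have hb := hcV ⟨hab, le_rfl⟩
  refine NCSeries.mul_right_cancel_of_coeff_nil (g := Φ (c b)) ?_ ?_
  · rw [hΦ.coeff_nil _ hb]
    exact one_ne_zero
  · rw [hΦ.chen_mul hω hab hc hcV, hΦ.segTransport_mul hω hV ha hb]

theorem segTransport_mul (h : IsFlatSystem ω U) {V : Set ℂ} (hVU : V ⊆ U) (hV : Convex ℝ V)
    (hVo : IsOpen V) {x y z : ℂ} (hx : x ∈ V) (hy : y ∈ V) (hz : z ∈ V) :
    segTransport ω x y * segTransport ω y z = segTransport ω x z := by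
  obtain ⟨Φ, hΦ⟩ := h.exists_isParallel hVU hV hVo
  have hω : ∀ i, ContinuousOn (ω i) V := fun i => (h.smooth i).continuousOn.mono hVU
  refine NCSeries.mul_right_cancel_of_coeff_nil (g := Φ z) ?_ ?_
  · rw [hΦ.coeff_nil _ hz]
    exact one_ne_zero
  · rw [mul_assoc, hΦ.segTransport_mul hω hV hy hz, hΦ.segTransport_mul hω hV hx hy,
      hΦ.segTransport_mul hω hV hx hz]

theorem chen_self (c : ℝ → ℂ) (a : ℝ) : chen ω c a a = 1 := by
  classical
  refine NCSeries.ext_coeff fun w => ?_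
  rcases w with _ | ⟨i, w⟩ <;> simp [chen, chenIter, NCSeries.coeff_one]

theorem segTransport_self (hU : IsOpen U) (h : IsFlatSystem ω U) {x : ℂ} (hx : x ∈ U) :
    segTransport ω x x = 1 := by
  obtain ⟨r, hr, hball⟩ := Metric.isOpen_iff.1 hU x hx
  rw [← chen_self (ω := ω) (fun _ => x) 0]
  exact (chen_eq_segTransport h hball (convex_ball x r) Metric.isOpen_ball le_rfl
    (PC1.refl continuous_const 0) fun t _ => Metric.mem_ball_self hr).symm

/-- Iterated integrals of a flat system depend only on the homotopy class of the path. -/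
theorem chen_eq_of_homotopic (hU : IsOpen U) (h : IsFlatSystem ω U) {x y : U} {γ₀ γ₁ : Path x y}
    (h₀ : PC1 (pathCurve γ₀) 0 1) (h₁ : PC1 (pathCurve γ₁) 0 1) (hγ : γ₀.Homotopic γ₁) :
    chen ω (pathCurve γ₀) 0 1 = chen ω (pathCurve γ₁) 0 1 := by
  have hω : ∀ i, ContinuousOn (ω i) U := fun i => (h.smooth i).continuousOn
  let good : Set U → Prop := fun W => ∃ V : Set ℂ, V ⊆ U ∧ Convex ℝ V ∧ IsOpen V ∧
    W = Subtype.val ⁻¹' V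
  obtain ⟨t, N, ht0, htm, htN, hg₀, hg₁, heq⟩ := exists_stepProd_eq_of_homotopic
    (fun a b : U => segTransport ω a b) good
    (fun x => by
      obtain ⟨r, hr, hball⟩ := Metric.isOpen_iff.1 hU x x.2
      exact ⟨_, Metric.isOpen_ball.preimage continuous_subtype_val, Metric.mem_ball_self hr,
        Metric.ball (x : ℂ) r, hball, convex_ball _ _, Metric.isOpen_ball, rfl⟩)
    (by
      rintro W ⟨V, hVU, hV, hVo, rfl⟩ a ha b hb c hc
      exact segTransport_mul h hVU hV hVo ha hb hc)
    (fun x => segTransport_self hU h x.2) hγ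
  have key : ∀ γ : Path x y, PC1 (pathCurve γ) 0 1 →
      (∀ n, ∃ V, good V ∧ ∀ s ∈ Icc (t n) (t (n + 1)), γ s ∈ V) → ∀ n,
      chen ω (pathCurve γ) 0 (t n) =
        stepProd (fun a b : U => segTransport ω a b) (fun n => γ (t n)) n := by
    intro γ hγ hg n
    have hmaps : ∀ s : Set ℝ, MapsTo (pathCurve γ) s U := fun s r _ => pathCurve_mem γ r
    induction n with
    | zero => rw [ht0]; exact chen_self _ _
    | succ n ih =>
      have hle : (t n : ℝ) ≤ t (n + 1) := htm (Nat.le_succ n)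
      obtain ⟨W, ⟨V, hVU, hV, hVo, rfl⟩, hW⟩ := hg n
      rw [stepProd, ← ih, ← _root_.chen_mul hω (t n).2.1 hle
        (hγ.mono le_rfl (t (n + 1)).2.1 (t (n + 1)).2.2) (hmaps _)]
      congr 1
      rw [← pathCurve_coe, ← pathCurve_coe]
      refine chen_eq_segTransport h hVU hV hVo hle
        (hγ.mono (t n).2.1 hle (t (n + 1)).2.2) fun s hs => ?_
      have hs' : s ∈ unitInterval := ⟨(t n).2.1.trans hs.1, hs.2.trans (t (n + 1)).2.2⟩
      have := hW ⟨s, hs'⟩ ⟨hs.1, hs.2⟩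
      exact (pathCurve_coe γ ⟨s, hs'⟩).symm ▸ this
  have e₀ := key γ₀ h₀ hg₀ N
  have e₁ := key γ₁ h₁ hg₁ N
  rw [htN] at e₀ e₁
  exact e₀.trans (heq.trans e₁.symm)

/-- A piecewise smooth path in a given homotopy class. -/
def psRep (hU : IsOpen U) {x y : U} (δ : Path.Homotopic.Quotient x y) : Path x y :=
  (exists_psOn_of_isOpen hU δ).choose

theorem psOn_psRep (hU : IsOpen U) {x y : U} (δ : Path.Homotopic.Quotient x y) :
    PSOn (pathCurve (psRep hU δ)) 0 1 :=
  (exists_psOn_of_isOpen hU δ).choose_spec.1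

theorem mk_psRep (hU : IsOpen U) {x y : U} (δ : Path.Homotopic.Quotient x y) :
    Path.Homotopic.Quotient.mk (psRep hU δ) = δ :=
  (exists_psOn_of_isOpen hU δ).choose_spec.2

theorem pc1_psRep (hU : IsOpen U) {x y : U} (δ : Path.Homotopic.Quotient x y) :
    PC1 (pathCurve (psRep hU δ)) 0 1 :=
  (psOn_psRep hU δ).pc1 (continuous_pathCurve _)

/-- The generating series of the iterated integrals along a homotopy class of paths, computed on a
piecewise smooth representative. -/
def classTransport (hU : IsOpen U) (ω : ι → ℂ → ℂ [⋀^Fin 1]→L[ℝ] ℝ) {x y : U}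
    (δ : Path.Homotopic.Quotient x y) : NCSeries ι :=
  chen ω (pathCurve (psRep hU δ)) 0 1

theorem classTransport_mk (hU : IsOpen U) (h : IsFlatSystem ω U) {x y : U} {γ : Path x y}
    (hγ : PC1 (pathCurve γ) 0 1) :
    classTransport hU ω (Path.Homotopic.Quotient.mk γ) = chen ω (pathCurve γ) 0 1 :=
  chen_eq_of_homotopic hU h (pc1_psRep hU _) hγ (Path.Homotopic.Quotient.exact (mk_psRep hU _))

theorem classTransport_refl (hU : IsOpen U) (h : IsFlatSystem ω U) (x : U) :
    classTransport hU ω (Path.Homotopic.Quotient.refl x) = 1 := by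
  rw [← Path.Homotopic.Quotient.mk_refl, classTransport_mk hU h]
  · have hc : pathCurve (Path.refl x) = fun _ => (x : ℂ) := by
      funext t
      simp [pathCurve]
    obtain ⟨r, hr, hball⟩ := Metric.isOpen_iff.1 hU x x.2
    rw [hc, chen_eq_segTransport h hball (convex_ball _ r) Metric.isOpen_ball zero_le_one
      (PC1.of_contDiffOn continuous_const zero_le_one contDiffOn_const)
      fun t _ => Metric.mem_ball_self hr, segTransport_self hU h x.2]
  · have hc : pathCurve (Path.refl x) = fun _ => (x : ℂ) := by
      funext t
      simp [pathCurve]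
    rw [hc]
    exact PC1.of_contDiffOn continuous_const zero_le_one contDiffOn_const

theorem chen_pathCurve_trans (h : IsFlatSystem ω U) {x y z : U} {γ : Path x y} {γ' : Path y z}
    (hγ : PSOn (pathCurve γ) 0 1) (hγ' : PSOn (pathCurve γ') 0 1) :
    chen ω (pathCurve (γ.trans γ')) 0 1 =
      chen ω (pathCurve γ) 0 1 * chen ω (pathCurve γ') 0 1 := by
  rw [← _root_.chen_mul (U := U) (b := 1 / 2) (fun i => (h.smooth i).continuousOn) (by norm_num)
    (by norm_num) ((hγ.path_trans hγ').pc1 (continuous_pathCurve _)) fun t _ => pathCurve_mem _ t,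
    chen_congr (by norm_num) (pathCurve_trans_left γ γ'),
    chen_congr (by norm_num) (pathCurve_trans_right γ γ'),
    chen_comp_mul_add, chen_comp_mul_add]
  norm_num

theorem classTransport_trans (hU : IsOpen U) (h : IsFlatSystem ω U) {x y z : U}
    (δ : Path.Homotopic.Quotient x y) (δ' : Path.Homotopic.Quotient y z) :
    classTransport hU ω (δ.trans δ') = classTransport hU ω δ * classTransport hU ω δ' := by
  conv_lhs => rw [← mk_psRep hU δ, ← mk_psRep hU δ', ← Path.Homotopic.Quotient.mk_trans]
  have hps := psOn_psRep hU δ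
  have hps' := psOn_psRep hU δ'
  rw [classTransport_mk hU h ((hps.path_trans hps').pc1 (continuous_pathCurve _)),
    chen_pathCurve_trans h hps hps']
  rfl

theorem classTransport_coeff_nil (hU : IsOpen U) {x y : U} (δ : Path.Homotopic.Quotient x y) :
    (classTransport hU ω δ).coeff [] = 1 := rfl

/-- The holonomy representation of the flat connection `∑ ω_i X_i`. -/
def holonomy (hU : IsOpen U) (h : IsFlatSystem ω U) (x₀ : U) : LoopGroup U x₀ →* NCSeries ι where
  toFun g := classTransport hU ω g.unop.toPath
  map_one' := classTransport_refl hU h x₀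
  map_mul' g g' := classTransport_trans hU h g.unop.toPath g'.unop.toPath

theorem holonomy_loopClass (hU : IsOpen U) (h : IsFlatSystem ω U) {x₀ : U} {γ : Path x₀ x₀}
    (hγ : PiecewiseSmooth γ) : holonomy hU h x₀ (loopClass γ) = chen ω (pathCurve γ) 0 1 :=
  classTransport_mk hU h hγ.pc1

theorem exists_piecewiseSmooth (hU : IsOpen U) {x₀ : U} (g : LoopGroup U x₀) :
    ∃ γ : Path x₀ x₀, PiecewiseSmooth γ ∧ loopClass γ = g :=
  ⟨psRep hU g.unop.toPath, (psOn_psRep hU _).piecewiseSmooth,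
    congrArg MulOpposite.op (mk_psRep hU g.unop.toPath)⟩

/-! ### Periods of closed forms -/

/-- The integral of the `1`-form `θ` along a homotopy class. -/
def period (hU : IsOpen U) (θ : ℂ → ℂ [⋀^Fin 1]→L[ℝ] ℝ) {x y : U}
    (δ : Path.Homotopic.Quotient x y) : ℝ :=
  ∫ t in (0 : ℝ)..1, θ (pathCurve (psRep hU δ) t) ![deriv (pathCurve (psRep hU δ)) t]

theorem coeff_chen_singleton (c : ℝ → ℂ) (a b : ℝ) (i : ι) :
    (chen ω c a b).coeff [i] = ∫ t in a..b, ω i (c t) ![deriv c t] := by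
  simp [chen, chenIter]

theorem classTransport_coeff_singleton (hU : IsOpen U) {x y : U} (δ : Path.Homotopic.Quotient x y)
    (i : ι) : (classTransport hU ω δ).coeff [i] = period hU (ω i) δ :=
  coeff_chen_singleton _ _ _ _

theorem intervalIntegrable_psRep (hU : IsOpen U) {θ : ℂ → ℂ [⋀^Fin 1]→L[ℝ] ℝ}
    (hθ : ContinuousOn θ U) {x y : U} (δ : Path.Homotopic.Quotient x y) :
    IntervalIntegrable (fun t => θ (pathCurve (psRep hU δ) t)
      ![deriv (pathCurve (psRep hU δ)) t]) volume 0 1 :=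
  intervalIntegrable_pullback hθ zero_le_one (pc1_psRep hU δ) fun t _ => pathCurve_mem _ t

theorem period_sum (hU : IsOpen U) [Fintype ι] (a : ι → ℝ) (hω : ∀ i, ContinuousOn (ω i) U)
    {x y : U} (δ : Path.Homotopic.Quotient x y) :
    period hU (fun z => ∑ i, a i • ω i z) δ = ∑ i, a i * period hU (ω i) δ := by
  simp only [period]
  simp_rw [← intervalIntegral.integral_const_mul]
  rw [← intervalIntegral.integral_finsetSum fun i _ =>
    (intervalIntegrable_psRep hU (hω i) δ).const_mul (a i)]
  simp [ContinuousAlternatingMap.sum_apply]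

theorem period_sub (hU : IsOpen U) {θ θ' : ℂ → ℂ [⋀^Fin 1]→L[ℝ] ℝ} (hθ : ContinuousOn θ U)
    (hθ' : ContinuousOn θ' U) {x y : U} (δ : Path.Homotopic.Quotient x y) :
    period hU (fun z => θ z - θ' z) δ = period hU θ δ - period hU θ' δ :=
  intervalIntegral.integral_sub (intervalIntegrable_psRep hU hθ δ) (intervalIntegrable_psRep hU hθ' δ)

theorem period_trans (hU : IsOpen U) {θ : ℂ → ℂ [⋀^Fin 1]→L[ℝ] ℝ}
    (hθ : ContDiffOn ℝ (⊤ : ℕ∞) θ U) (hcl : ∀ z ∈ U, extDeriv θ z = 0) {x y z : U}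
    (δ : Path.Homotopic.Quotient x y) (δ' : Path.Homotopic.Quotient y z) :
    period hU θ (δ.trans δ') = period hU θ δ + period hU θ δ' := by
  have h := congrArg (fun f => f.coeff [()])
    (classTransport_trans hU (isFlatSystem_single hθ hcl) δ δ')
  simp only [NCSeries.coeff_mul, classTransport_coeff_singleton] at h
  rw [h]
  simp [Finset.sum_range_succ, classTransport_coeff_nil, classTransport_coeff_singleton, add_comm]

theorem period_mk (hU : IsOpen U) {θ : ℂ → ℂ [⋀^Fin 1]→L[ℝ] ℝ}
    (hθ : ContDiffOn ℝ (⊤ : ℕ∞) θ U) (hcl : ∀ z ∈ U, extDeriv θ z = 0) {x y : U} {γ : Path x y}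
    (hγ : PC1 (pathCurve γ) 0 1) : period hU θ (Path.Homotopic.Quotient.mk γ) =
      ∫ t in (0 : ℝ)..1, θ (pathCurve γ t) ![deriv (pathCurve γ) t] := by
  have h := congrArg (fun f => f.coeff [()]) (classTransport_mk hU (isFlatSystem_single hθ hcl) hγ)
  simpa only [coeff_chen_singleton, classTransport_coeff_singleton] using h

theorem integral_of_primitive {V : Set ℂ} {θ : ℂ → ℂ [⋀^Fin 1]→L[ℝ] ℝ} (hθ : ContinuousOn θ V)
    {f : ℂ → ℝ} (hf : ∀ z ∈ V, HasFDerivAt f (oneFormCLM (θ z)) z) {c : ℝ → ℂ} {a b : ℝ}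
    (hab : a ≤ b) (hc : PC1 c a b) (hV : MapsTo c (Icc a b) V) :
    ∫ t in a..b, θ (c t) ![deriv c t] = f (c b) - f (c a) := by
  obtain ⟨s, hs, hd⟩ := hc.diff
  refine integral_eq_of_hasDerivAt_off_countable_of_le (fun t => f (c t)) _ hab hs ?_
    (fun t ht => ?_) (intervalIntegrable_pullback hθ hab hc hV)
  · exact fun t ht => ((hf _ (hV ht)).continuousAt.comp hc.cont.continuousAt).continuousWithinAt
  · rw [← oneFormCLM_apply]
    exact (hf _ (hV (Ioo_subset_Icc_self ht.1))).comp_hasDerivAt t (hd t ht.1 ht.2).hasDerivAt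

theorem period_of_primitive (hU : IsOpen U) {θ : ℂ → ℂ [⋀^Fin 1]→L[ℝ] ℝ} (hθ : ContinuousOn θ U)
    {f : ℂ → ℝ} (hf : ∀ z ∈ U, HasFDerivAt f (oneFormCLM (θ z)) z) {x y : U}
    (δ : Path.Homotopic.Quotient x y) : period hU θ δ = f y - f x := by
  rw [← pathCurve_one (psRep hU δ), ← pathCurve_zero (psRep hU δ)]
  exact integral_of_primitive hθ hf zero_le_one (pc1_psRep hU δ) fun t _ => pathCurve_mem _ t

/-- A closed form all of whose periods vanish is exact. -/
theorem exists_primitive_of_period_eq_zero (hU : IsOpen U) (hconn : IsPathConnected U)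
    {θ : ℂ → ℂ [⋀^Fin 1]→L[ℝ] ℝ} (hθ : ContDiffOn ℝ (⊤ : ℕ∞) θ U)
    (hcl : ∀ z ∈ U, extDeriv θ z = 0) (x₀ : U)
    (h : ∀ δ : Path.Homotopic.Quotient x₀ x₀, period hU θ δ = 0) :
    ∃ f : ℂ → ℝ, ∀ z ∈ U, HasFDerivAt f (oneFormCLM (θ z)) z := by
  classical
  have : PathConnectedSpace U := isPathConnected_iff_pathConnectedSpace.1 hconn
  let p : ∀ y : U, Path.Homotopic.Quotient x₀ y := fun y =>
    Path.Homotopic.Quotient.mk (PathConnectedSpace.somePath x₀ y)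
  have hind : ∀ {y : U} (δ : Path.Homotopic.Quotient x₀ y), period hU θ δ = period hU θ (p y) := by
    intro y δ
    have h1 := h (δ.trans (p y).symm)
    have h2 := h ((p y).trans (p y).symm)
    rw [period_trans hU hθ hcl] at h1 h2
    linarith
  refine ⟨fun z => if hz : z ∈ U then period hU θ (p ⟨z, hz⟩) else 0, fun z hz => ?_⟩
  obtain ⟨r, hr, hball⟩ := Metric.isOpen_iff.1 hU z hz
  obtain ⟨g, hg⟩ := (convex_ball z r).exists_forall_hasFDerivAt_of_fderiv_symmetric
    Metric.isOpen_ball (ω := fun z => oneFormCLM (θ z))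
    (((contDiffOn_oneFormCLM hθ).differentiableOn (by simp)).mono hball) (fun a ha u v => by
      have hd : DifferentiableAt ℝ θ a := (hθ.differentiableOn (by simp) a (hball ha)).differentiableAt
        (hU.mem_nhds (hball ha))
      rw [fderiv_oneFormCLM hd, fderiv_oneFormCLM hd, ← sub_eq_zero, ← extDeriv_oneForm_apply hd,
        hcl a (hball ha)]
      rfl)
  have hev : (fun w => (if hw : w ∈ U then period hU θ (p ⟨w, hw⟩) else 0)) =ᶠ[nhds z]
      fun w => g w + (period hU θ (p ⟨z, hz⟩) - g z) := by
    filter_upwards [Metric.ball_mem_nhds z hr] with w hw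
    rw [dif_pos (hball hw)]
    obtain ⟨σ, hσ, hmem⟩ := exists_segment_path hball (convex_ball z r)
      (y := ⟨z, hz⟩) (z := ⟨w, hball hw⟩) (Metric.mem_ball_self hr) hw
    have hpc := hσ.pc1 (continuous_pathCurve σ)
    rw [← hind ((p ⟨z, hz⟩).trans (Path.Homotopic.Quotient.mk σ)), period_trans hU hθ hcl,
      period_mk hU hθ hcl hpc, integral_of_primitive (hθ.continuousOn.mono hball) hg zero_le_one hpc
        fun t ht => pathCurve_coe σ ⟨t, ht⟩ ▸ hmem ⟨t, ht⟩, pathCurve_zero, pathCurve_one]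
    ring
  exact ((hg z (Metric.mem_ball_self hr)).add_const _).congr_of_eventuallyEq hev

end Transport

/-! ### Generators of the fundamental group from a cover -/

section Generation

open Set CategoryTheory

variable {U : Set ℂ}

/-- The homotopy class `δ` contains a path inside `S`. -/
def InSet (S : Set ℂ) {y z : U} (δ : FundamentalGroupoid.mk y ⟶ FundamentalGroupoid.mk z) : Prop :=
  ∃ γ : Path y z, (∀ t, (γ t : ℂ) ∈ S) ∧ Path.Homotopic.Quotient.mk γ = δ

theorem InSet.mono {S S' : Set ℂ} (hS : S ⊆ S') {y z : U}
    {δ : FundamentalGroupoid.mk y ⟶ FundamentalGroupoid.mk z} (h : InSet S δ) : InSet S' δ :=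
  let ⟨γ, hγ, e⟩ := h
  ⟨γ, fun t => hS (hγ t), e⟩

theorem InSet.comp {S : Set ℂ} {x y z : U}
    {δ : FundamentalGroupoid.mk x ⟶ FundamentalGroupoid.mk y}
    {δ' : FundamentalGroupoid.mk y ⟶ FundamentalGroupoid.mk z} (h : InSet S δ) (h' : InSet S δ') :
    InSet S (δ ≫ δ') := by
  obtain ⟨γ, hγ, rfl⟩ := h
  obtain ⟨γ', hγ', rfl⟩ := h'
  refine ⟨γ.trans γ', fun t => ?_, Path.Homotopic.Quotient.mk_trans _ _⟩
  rw [Path.trans_apply]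
  split_ifs
  · exact hγ _
  · exact hγ' _

theorem InSet.unique {S : Set ℂ} (hSU : S ⊆ U) [SimplyConnectedSpace S] {y z : U}
    {δ δ' : FundamentalGroupoid.mk y ⟶ FundamentalGroupoid.mk z} (h : InSet S δ)
    (h' : InSet S δ') : δ = δ' := by
  obtain ⟨γ, hγ, rfl⟩ := h
  obtain ⟨γ', hγ', rfl⟩ := h'
  exact Path.Homotopic.Quotient.eq.2 (homotopic_of_mem hSU γ γ' hγ hγ')

theorem InSet.source {S : Set ℂ} {y z : U}
    {δ : FundamentalGroupoid.mk y ⟶ FundamentalGroupoid.mk z} (h : InSet S δ) : (y : ℂ) ∈ S := by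
  obtain ⟨γ, hγ, -⟩ := h
  simpa using hγ 0

theorem InSet.target {S : Set ℂ} {y z : U}
    {δ : FundamentalGroupoid.mk y ⟶ FundamentalGroupoid.mk z} (h : InSet S δ) : (z : ℂ) ∈ S := by
  obtain ⟨γ, hγ, -⟩ := h
  simpa using hγ 1

theorem inSet_id {S : Set ℂ} {y : U} (hy : (y : ℂ) ∈ S) :
    InSet S (𝟙 (FundamentalGroupoid.mk y)) :=
  ⟨Path.refl y, fun _ => hy, rfl⟩

theorem exists_inSet {S : Set ℂ} (hSU : S ⊆ U) [PathConnectedSpace S] {y z : U} (hy : (y : ℂ) ∈ S)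
    (hz : (z : ℂ) ∈ S) :
    ∃ δ : FundamentalGroupoid.mk y ⟶ FundamentalGroupoid.mk z, InSet S δ := by
  let γ := PathConnectedSpace.somePath (⟨y, hy⟩ : S) ⟨z, hz⟩
  let γ' : Path y z :=
    { toFun := fun t => ⟨γ t, hSU (γ t).2⟩
      continuous_toFun := by fun_prop
      source' := by simp
      target' := by simp }
  exact ⟨Path.Homotopic.Quotient.mk γ', γ', fun t => (γ t).2, rfl⟩

/-- One half of a van Kampen theorem. Let `U` be covered by a simply connected open set `A` and
disjoint simply connected open sets `S_i`, and let `A ∩ S_i` consist of two path connected parts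
`P_i` and `N_i`. Then `π₁(U)` is generated by the loops that run in `A` to `P_i`, through `S_i` to
`N_i`, and back in `A`. -/
theorem exists_generators {n : ℕ} {A : Set ℂ} {S P N : Fin n → Set ℂ} (hAo : IsOpen A)
    (hSo : ∀ i, IsOpen (S i)) (hAU : A ⊆ U) (hSU : ∀ i, S i ⊆ U)
    (hcover : ∀ z ∈ U, z ∈ A ∨ ∃ i, z ∈ S i) [SimplyConnectedSpace A]
    [∀ i, SimplyConnectedSpace (S i)] [∀ i, PathConnectedSpace (P i)]
    [∀ i, PathConnectedSpace (N i)] (hdisj : ∀ i j, i ≠ j → Disjoint (S i) (S j))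
    (hP : ∀ i, P i ⊆ A ∩ S i) (hN : ∀ i, N i ⊆ A ∩ S i) (hPN : ∀ i, A ∩ S i ⊆ P i ∪ N i)
    {x₀ : U} (hx₀ : (x₀ : ℂ) ∈ A) :
    ∃ g : Fin n → LoopGroup U x₀, Subgroup.closure (range g) = ⊤ := by
  classical
  have hα : ∀ z : U, (z : ℂ) ∈ A →
      ∃ δ : FundamentalGroupoid.mk x₀ ⟶ FundamentalGroupoid.mk z, InSet A δ :=
    fun z hz => exists_inSet hAU hx₀ hz
  have hpts : ∀ i, ∃ s : U × U, (s.1 : ℂ) ∈ P i ∧ (s.2 : ℂ) ∈ N i := fun i => by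
    obtain ⟨a⟩ := (inferInstance : Nonempty (P i))
    obtain ⟨b⟩ := (inferInstance : Nonempty (N i))
    exact ⟨(⟨a, hAU (hP i a.2).1⟩, ⟨b, hAU (hN i b.2).1⟩), a.2, b.2⟩
  choose α hαA using hα
  choose s hsP hsN using hpts
  have hκ : ∀ i, ∀ z : U, (z : ℂ) ∈ S i →
      ∃ δ : FundamentalGroupoid.mk (s i).1 ⟶ FundamentalGroupoid.mk z, InSet (S i) δ :=
    fun i z hz => exists_inSet (hSU i) (hP i (hsP i)).2 hz
  choose κ hκS using hκ
  let g : Fin n → LoopGroup U x₀ := fun i => MulOpposite.op (α (s i).1 (hP i (hsP i)).1 ≫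
    κ i (s i).2 (hN i (hsN i)).2 ≫ Groupoid.inv (α (s i).2 (hN i (hsN i)).1))
  let H := Subgroup.closure (range g)
  -- a class of paths from the base point to every point of `U`
  have hr : ∀ z : U, ∃ r : FundamentalGroupoid.mk x₀ ⟶ FundamentalGroupoid.mk z,
      (∀ hz : (z : ℂ) ∈ A, r = α z hz) ∧ ∀ i, ∀ hz : (z : ℂ) ∈ S i,
        ∃ h : LoopGroup U x₀, h ∈ H ∧ r = h.unop ≫ α (s i).1 (hP i (hsP i)).1 ≫ κ i z hz := by
    intro z
    by_cases hzA : (z : ℂ) ∈ A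
    · refine ⟨α z hzA, fun _ => rfl, fun i hz => ?_⟩
      rcases hPN i ⟨hzA, hz⟩ with hzP | hzN
      · refine ⟨1, one_mem _, ?_⟩
        obtain ⟨δ, hδ⟩ := exists_inSet ((hP i).trans (inter_subset_left.trans hAU)) (hsP i) hzP
        have e1 : κ i z hz = δ :=
          (hκS i z hz).unique (hSU i) (hδ.mono ((hP i).trans inter_subset_right))
        have e2 : α z hzA = α (s i).1 (hP i (hsP i)).1 ≫ δ :=
          (hαA z hzA).unique hAU ((hαA _ _).comp (hδ.mono ((hP i).trans inter_subset_left)))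
        rw [e1, e2]
        exact (Category.id_comp _).symm
      · refine ⟨(g i)⁻¹, inv_mem (Subgroup.subset_closure (mem_range_self i)), ?_⟩
        obtain ⟨δ, hδ⟩ := exists_inSet ((hN i).trans (inter_subset_left.trans hAU)) (hsN i) hzN
        have e1 : κ i z hz = κ i (s i).2 (hN i (hsN i)).2 ≫ δ :=
          (hκS i z hz).unique (hSU i)
            ((hκS _ _ _).comp (hδ.mono ((hN i).trans inter_subset_right)))
        have e2 : α z hzA = α (s i).2 (hN i (hsN i)).1 ≫ δ :=
          (hαA z hzA).unique hAU ((hαA _ _).comp (hδ.mono ((hN i).trans inter_subset_left)))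
        have e3 : ((g i)⁻¹).unop = Groupoid.inv (α (s i).1 (hP i (hsP i)).1 ≫
            κ i (s i).2 (hN i (hsN i)).2 ≫ Groupoid.inv (α (s i).2 (hN i (hsN i)).1)) := rfl
        rw [e1, e2, e3]
        simp
    · obtain ⟨i, hi⟩ := (hcover z z.2).resolve_left hzA
      refine ⟨α (s i).1 (hP i (hsP i)).1 ≫ κ i z hi, fun hz => absurd hz hzA, fun j hj => ?_⟩
      obtain rfl : i = j := by
        by_contra hij
        exact (Set.disjoint_left.1 (hdisj i j hij)) hi hj
      exact ⟨1, one_mem _, (Category.id_comp _).symm⟩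
  choose r hrA hrS using hr
  have hgood : ∀ {y z : U} (δ : Path.Homotopic.Quotient y z),
      (MulOpposite.op (r y ≫ (show FundamentalGroupoid.mk y ⟶ FundamentalGroupoid.mk z from δ) ≫
        Groupoid.inv (r z)) : LoopGroup U x₀) ∈ H := by
    intro y z δ
    refine pathClass_induction (fun {y z} δ => (MulOpposite.op (r y ≫
      (show FundamentalGroupoid.mk y ⟶ FundamentalGroupoid.mk z from δ) ≫
        Groupoid.inv (r z)) : LoopGroup U x₀) ∈ H) ?_ ?_ δ
    · intro x y z δ δ' h h'
      have := mul_mem h h'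
      convert this using 1
      refine congrArg MulOpposite.op ?_
      show _ = (r x ≫ _ ≫ Groupoid.inv (r y)) ≫ (r y ≫ _ ≫ Groupoid.inv (r z))
      have e : (show FundamentalGroupoid.mk x ⟶ FundamentalGroupoid.mk z from δ.trans δ') =
        (show FundamentalGroupoid.mk x ⟶ FundamentalGroupoid.mk y from δ) ≫
          (show FundamentalGroupoid.mk y ⟶ FundamentalGroupoid.mk z from δ') := rfl
      rw [e]
      simp
    · intro x
      rcases hcover x x.2 with hx | ⟨i, hx⟩
      · refine ⟨Subtype.val ⁻¹' A, hAo.preimage continuous_subtype_val, hx, fun {y z} γ hγ => ?_⟩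
        have hδ : InSet A (show FundamentalGroupoid.mk y ⟶ FundamentalGroupoid.mk z from
          Path.Homotopic.Quotient.mk γ) := ⟨γ, hγ, rfl⟩
        rw [hrA y hδ.source, hrA z hδ.target, ← Category.assoc,
          ((hαA y hδ.source).comp hδ).unique hAU (hαA z hδ.target), Groupoid.comp_inv]
        exact one_mem H
      · refine ⟨Subtype.val ⁻¹' S i, (hSo i).preimage continuous_subtype_val, hx,
          fun {y z} γ hγ => ?_⟩
        have hδ : InSet (S i) (show FundamentalGroupoid.mk y ⟶ FundamentalGroupoid.mk z from
          Path.Homotopic.Quotient.mk γ) := ⟨γ, hγ, rfl⟩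
        obtain ⟨h, hh, e⟩ := hrS y i hδ.source
        obtain ⟨h', hh', e'⟩ := hrS z i hδ.target
        have e'' := ((hκS i y hδ.source).comp hδ).unique (hSU i) (hκS i z hδ.target)
        have hmem : h * h'⁻¹ ∈ H := mul_mem hh (inv_mem hh')
        convert hmem using 1
        refine congrArg MulOpposite.op ?_
        show _ = h.unop ≫ Groupoid.inv h'.unop
        rw [e, e', ← e'']
        simp
  refine ⟨g, eq_top_iff.2 fun a _ => ?_⟩
  have := hgood a.unop.toPath
  have e : r x₀ = 𝟙 _ := (hrA x₀ hx₀).trans ((hαA x₀ hx₀).unique hAU (inSet_id hx₀))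
  rw [e] at this
  convert this using 1
  refine congrArg MulOpposite.op ?_
  show _ = 𝟙 _ ≫ _ ≫ Groupoid.inv (𝟙 _)
  simp
  rfl

end Generation

/-! ### Slits and cones in the punctured disc -/

section Slits

open Set

/-- The affine coordinate in which `q` is `0` and `a` is `1`. -/
def rayCoord (q a z : ℂ) : ℂ := (z - q) / (a - q)

theorem rayCoord_combo (q a x y : ℂ) {s t : ℝ} (hst : s + t = 1) :
    rayCoord q a (s • x + t • y) = s • rayCoord q a x + t • rayCoord q a y := by
  have : (s : ℂ) + t = 1 := by exact_mod_cast hst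
  simp only [rayCoord, Complex.real_smul]
  rw [← mul_div_assoc, ← mul_div_assoc, ← add_div]
  congr 1
  linear_combination q * this

theorem continuous_rayCoord (q a : ℂ) : Continuous (rayCoord q a) := by
  unfold rayCoord
  fun_prop

/-- A half plane, in terms of the coordinate `rayCoord q a`. -/
def halfPlane (q a : ℂ) (A B C : ℝ) : Set ℂ :=
  {z | 0 < A * (rayCoord q a z).re + B * (rayCoord q a z).im + C}

theorem convex_halfPlane (q a : ℂ) (A B C : ℝ) : Convex ℝ (halfPlane q a A B C) := by
  rw [convex_iff_forall_pos]
  intro x hx y hy s t hs ht hst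
  simp only [halfPlane, mem_ofPred_eq] at hx hy ⊢
  rw [rayCoord_combo q a x y hst]
  have h1 := mul_pos hs hx
  have h2 := mul_pos ht hy
  simp only [Complex.add_re, Complex.add_im, Complex.real_smul, Complex.re_ofReal_mul,
    Complex.im_ofReal_mul]
  have : C = s * C + t * C := by rw [← add_mul, hst, one_mul]
  linarith

theorem isOpen_halfPlane (q a : ℂ) (A B C : ℝ) : IsOpen (halfPlane q a A B C) := by
  have := continuous_rayCoord q a
  have h2 := Complex.continuous_re
  have h3 := Complex.continuous_im
  exact isOpen_lt continuous_const (by fun_prop)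

/-- The cone of aperture `ε` with vertex `q` around the ray from `q` through `a`. -/
def bigCone (q a : ℂ) (ε : ℝ) : Set ℂ := {z | |(rayCoord q a z).im| < ε * (rayCoord q a z).re}

/-- The cone of aperture `ε` with vertex `a` around the ray from `a` in the direction away from
`q`. -/
def cone (q a : ℂ) (ε : ℝ) : Set ℂ := {z | |(rayCoord q a z).im| < ε * ((rayCoord q a z).re - 1)}

/-- The closed ray from `a` in the direction away from `q`. -/
def slit (q a : ℂ) : Set ℂ := {z | (rayCoord q a z).im = 0 ∧ 1 ≤ (rayCoord q a z).re}

theorem cone_subset_bigCone {q a : ℂ} {ε : ℝ} (hε : 0 < ε) : cone q a ε ⊆ bigCone q a ε := by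
  intro z hz
  simp only [cone, bigCone, mem_ofPred_eq] at hz ⊢
  linarith

theorem cone_eq (q a : ℂ) (ε : ℝ) :
    cone q a ε = halfPlane q a ε 1 (-ε) ∩ halfPlane q a ε (-1) (-ε) := by
  ext z
  simp only [cone, halfPlane, mem_inter_iff, mem_ofPred_eq, abs_lt]
  constructor
  · rintro ⟨h1, h2⟩
    constructor <;> linarith
  · rintro ⟨h1, h2⟩
    constructor <;> linarith

theorem convex_cone (q a : ℂ) (ε : ℝ) : Convex ℝ (cone q a ε) := by
  rw [cone_eq]
  exact (convex_halfPlane _ _ _ _ _).inter (convex_halfPlane _ _ _ _ _)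

theorem isOpen_cone (q a : ℂ) (ε : ℝ) : IsOpen (cone q a ε) := by
  rw [cone_eq]
  exact (isOpen_halfPlane _ _ _ _ _).inter (isOpen_halfPlane _ _ _ _ _)

theorem isClosed_slit (q a : ℂ) : IsClosed (slit q a) := by
  have := continuous_rayCoord q a
  exact (isClosed_eq (Complex.continuous_im.comp this) continuous_const).inter
    (isClosed_le continuous_const (Complex.continuous_re.comp this))

theorem rayCoord_self {q a : ℂ} (h : a ≠ q) : rayCoord q a a = 1 :=
  div_self (sub_ne_zero.2 h)

theorem rayCoord_base (q a : ℂ) : rayCoord q a q = 0 := by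
  simp [rayCoord]

theorem rayCoord_point {q a : ℂ} (h : a ≠ q) (w : ℂ) : rayCoord q a (q + (a - q) * w) = w := by
  rw [rayCoord, add_sub_cancel_left, mul_div_cancel_left₀ _ (sub_ne_zero.2 h)]

theorem mem_bigCone_self {q a : ℂ} (h : a ≠ q) {ε : ℝ} (hε : 0 < ε) : a ∈ bigCone q a ε := by
  simp [bigCone, rayCoord_self h, hε]

theorem slit_subset_cone {q a : ℂ} (h : a ≠ q) {ε : ℝ} (hε : 0 < ε) {z : ℂ} (hz : z ∈ slit q a)
    (hza : z ≠ a) : z ∈ cone q a ε := by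
  obtain ⟨h0, h1⟩ := hz
  have hne : (rayCoord q a z).re ≠ 1 := by
    intro h2
    apply hza
    have : rayCoord q a z = 1 := Complex.ext h2 h0
    rw [rayCoord, div_eq_one_iff_eq (sub_ne_zero.2 h)] at this
    exact sub_left_injective this
  have : 1 < (rayCoord q a z).re := lt_of_le_of_ne h1 hne.symm
  simp only [cone, mem_ofPred_eq, h0, abs_zero]
  exact mul_pos hε (by linarith)

/-- Points `w` with `q + (a - q) w` in the open set `V`, close to the vertex `a`. -/
theorem exists_near_vertex {q a : ℂ} {V : Set ℂ} (hV : IsOpen V) (ha : a ∈ V) :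
    ∃ δ : ℝ, 0 < δ ∧ ∀ w : ℂ, ‖w‖ < δ → q + (a - q) * (1 + w) ∈ V := by
  have hc : Continuous fun w : ℂ => q + (a - q) * (1 + w) := by fun_prop
  have h0 : (0 : ℂ) ∈ (fun w : ℂ => q + (a - q) * (1 + w)) ⁻¹' V := by simpa using ha
  obtain ⟨δ, hδ, hball⟩ := Metric.isOpen_iff.1 (hV.preimage hc) 0 h0
  exact ⟨δ, hδ, fun w hw => hball (by simpa using hw)⟩

/-- A centre `q` and an aperture `ε` for which the rays and cones behind the points `p_i`, as seen
from `q`, are disjoint and the base point does not lie on any of the rays. -/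
structure IsSlitCentre {n : ℕ} (p : Fin n → ℂ) (x₀ q : ℂ) (ε : ℝ) : Prop where
  norm_lt : ‖q‖ < 1
  pos : 0 < ε
  ne : ∀ i, p i ≠ q
  base : ∀ i, x₀ ∉ slit q (p i)
  disjoint : ∀ i j, i ≠ j → Disjoint (bigCone q (p i) ε) (bigCone q (p j) ε)

/-- Rays from `q` in different directions have disjoint cones of small aperture. -/
theorem eventually_disjoint_bigCone {q a b : ℂ} (ha : a ≠ q) (hb : b ≠ q)
    (h : (rayCoord q a b).im ≠ 0) :
    ∀ᶠ ε in nhdsWithin (0 : ℝ) (Ioi 0), Disjoint (bigCone q a ε) (bigCone q b ε) := by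
  set m := (rayCoord q a b).re
  set k := (rayCoord q a b).im
  have hk : 0 < |k| := abs_pos.2 h
  have hcont : Filter.Tendsto (fun ε : ℝ => ε * (2 * |m| + |k|)) (nhdsWithin (0 : ℝ) (Ioi 0))
      (nhds 0) := by
    have : Continuous fun ε : ℝ => ε * (2 * |m| + |k|) := by fun_prop
    simpa using (this.tendsto 0).mono_left nhdsWithin_le_nhds
  have h1 : ∀ᶠ ε in nhdsWithin (0 : ℝ) (Ioi 0), ε < 1 :=
    nhdsWithin_le_nhds (Iio_mem_nhds one_pos)
  filter_upwards [hcont.eventually (gt_mem_nhds hk), h1, self_mem_nhdsWithin] with ε he h1 h0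
  have h0 : 0 < ε := h0
  refine Set.disjoint_left.2 fun z hza hzb => ?_
  -- with `u`, `t` the two coordinates of `z`, one has `u = (m + i k) t`
  set t := rayCoord q b z with ht
  have hu : rayCoord q a z = rayCoord q a b * t := by
    rw [ht, rayCoord, rayCoord, rayCoord]
    have := sub_ne_zero.2 ha
    have := sub_ne_zero.2 hb
    field_simp
  simp only [bigCone, mem_ofPred_eq] at hza hzb
  rw [hu, Complex.mul_re, Complex.mul_im] at hza
  change |m * t.im + k * t.re| < ε * (m * t.re - k * t.im) at hza
  have htre : 0 < t.re := by
    by_contra hneg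
    have := abs_nonneg t.im
    nlinarith
  have e1 : |k| * t.re ≤ |m * t.im + k * t.re| + |m| * |t.im| := by
    have : k * t.re = (m * t.im + k * t.re) - m * t.im := by ring
    calc |k| * t.re = |k * t.re| := by rw [abs_mul, abs_of_pos htre]
      _ = |(m * t.im + k * t.re) - m * t.im| := by rw [← this]
      _ ≤ |m * t.im + k * t.re| + |m * t.im| := abs_sub _ _
      _ = _ := by rw [abs_mul]
  have e2 : m * t.re - k * t.im ≤ |m| * t.re + |k| * |t.im| := by
    have h3 : m * t.re ≤ |m| * t.re := by gcongr; exact le_abs_self m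
    have h4 : -(k * t.im) ≤ |k| * |t.im| := by rw [← abs_mul]; exact neg_le_abs _
    linarith
  have e3 : |t.im| ≤ ε * t.re := hzb.le
  have e4 : |t.im| ≤ t.re := e3.trans (by nlinarith)
  have e5 : |k| * t.re < ε * (2 * |m| + |k|) * t.re := by
    calc |k| * t.re < ε * (m * t.re - k * t.im) + |m| * |t.im| := by linarith
      _ ≤ ε * (|m| * t.re + |k| * t.re) + |m| * (ε * t.re) := by
        have := mul_le_mul_of_nonneg_left e4 (abs_nonneg k)
        gcongr
        linarith
      _ = _ := by ring
  have := lt_of_mul_lt_mul_right e5 htre.le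
  linarith

/-- If `q` is not on the line through `a` and `b`, these points lie on different rays from `q`. -/
theorem rayCoord_im_ne_zero {q a b : ℂ} (hab : a ≠ b) (hq : q ∉ line[ℝ, a, b]) :
    (rayCoord q a b).im ≠ 0 := by
  intro h
  apply hq
  by_cases haq : a = q
  · rw [← haq]
    exact left_mem_affineSpan_pair ℝ a b
  set r := (rayCoord q a b).re with hr
  have h1 : rayCoord q a b = r := Complex.ext (by simp [hr]) (by simp [h])
  rw [rayCoord, div_eq_iff (sub_ne_zero.2 haq)] at h1
  have hr1 : (1 : ℂ) - r ≠ 0 := by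
    intro h2
    have : (r : ℂ) = 1 := (sub_eq_zero.1 h2).symm
    rw [this, one_mul] at h1
    exact hab (sub_left_injective h1).symm
  have hr1' : 1 - r ≠ 0 := by exact_mod_cast hr1
  -- `q = (b - r a) / (1 - r)`
  refine mem_affineSpan_pair_iff_exists_lineMap_eq.2 ⟨1 / (1 - r), ?_⟩
  rw [AffineMap.lineMap_apply_module', Complex.real_smul]
  push_cast
  field_simp
  linear_combination h1

/-- Almost every point `q` of the disc avoids the finitely many lines through two of the points
`p_i` and `x₀`. -/
theorem exists_isSlitCentre {n : ℕ} {p : Fin n → ℂ} (hp : Function.Injective p) {x₀ : ℂ}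
    (hx₀ : ∀ i, x₀ ≠ p i) : ∃ q ε, IsSlitCentre p x₀ q ε := by
  have hline : ∀ a b : ℂ, a ≠ b → ∀ᵐ q : ℂ, q ∉ line[ℝ, a, b] := by
    intro a b hab
    have htop : line[ℝ, a, b] ≠ ⊤ := by
      intro h
      have hmem : a + Complex.I * (b - a) ∈ line[ℝ, a, b] := h ▸ AffineSubspace.mem_top _ _ _
      obtain ⟨r, hr⟩ := mem_affineSpan_pair_iff_exists_lineMap_eq.1 hmem
      rw [AffineMap.lineMap_apply_module', Complex.real_smul, add_comm] at hr
      have := mul_right_cancel₀ (sub_ne_zero.2 hab.symm) (add_left_cancel hr)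
      have := congrArg Complex.im this
      simp at this
    rw [MeasureTheory.ae_iff]
    simpa using! MeasureTheory.Measure.addHaar_affineSubspace MeasureTheory.volume _ htop
  have hae : ∀ᵐ q : ℂ, (∀ i j, p i ≠ p j → q ∉ line[ℝ, p i, p j]) ∧
      ∀ i, q ∉ line[ℝ, p i, x₀] := by
    refine Filter.Eventually.and ?_ ?_
    · simp only [MeasureTheory.ae_all_iff]
      exact fun i j hij => hline _ _ hij
    · exact MeasureTheory.ae_all_iff.2 fun i => hline _ _ (hx₀ i).symm
  obtain ⟨q, ⟨hq1, hq2⟩, hq⟩ := (MeasureTheory.Measure.dense_of_ae hae).exists_mem_open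
    Metric.isOpen_ball ⟨(0 : ℂ), Metric.mem_ball_self one_pos⟩
  have hne : ∀ i, p i ≠ q := fun i h => hq2 i (h ▸ left_mem_affineSpan_pair ℝ _ _)
  have hev : ∀ᶠ ε in nhdsWithin (0 : ℝ) (Ioi 0), ∀ i j, i ≠ j →
      Disjoint (bigCone q (p i) ε) (bigCone q (p j) ε) := by
    simp only [Filter.eventually_all]
    exact fun i j hij => eventually_disjoint_bigCone (hne i) (hne j)
      (rayCoord_im_ne_zero (hp.ne hij) (hq1 i j (hp.ne hij)))
  obtain ⟨ε, hε, hε0⟩ := (hev.and self_mem_nhdsWithin).exists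
  exact ⟨q, ε, by simpa using hq, hε0, hne,
    fun i h => rayCoord_im_ne_zero (hx₀ i).symm (hq2 i) h.1, hε⟩

theorem isOpen_puncturedDisc {n : ℕ} (p : Fin n → ℂ) : IsOpen (puncturedDisc p) := by
  have : puncturedDisc p = {z | ‖z‖ < 1} ∩ ⋂ i, {z | z ≠ p i} := by
    ext z
    simp [puncturedDisc]
  rw [this]
  exact (isOpen_lt continuous_norm continuous_const).inter
    (isOpen_iInter_of_finite fun i => isOpen_ne)

variable {n : ℕ} {p : Fin n → ℂ} {x₀ q : ℂ} {ε : ℝ}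

/-- The unit disc without the slits behind the points `p_i`. -/
def slitDisc (p : Fin n → ℂ) (q : ℂ) : Set ℂ := {z | ‖z‖ < 1 ∧ ∀ i, z ∉ slit q (p i)}

theorem isOpen_slitDisc : IsOpen (slitDisc p q) := by
  have : slitDisc p q = {z | ‖z‖ < 1} ∩ ⋂ i, (slit q (p i))ᶜ := by
    ext z
    simp [slitDisc]
  rw [this]
  exact (isOpen_lt continuous_norm continuous_const).inter
    (isOpen_iInter_of_finite fun i => (isClosed_slit _ _).isOpen_compl)

theorem mem_slitDisc_centre (h : IsSlitCentre p x₀ q ε) : q ∈ slitDisc p q :=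
  ⟨h.norm_lt, fun i hi => by
    have := hi.2
    rw [rayCoord_base] at this
    norm_num at this⟩

theorem starConvex_slitDisc (h : IsSlitCentre p x₀ q ε) : StarConvex ℝ q (slitDisc p q) := by
  intro y hy a b ha hb hab
  refine ⟨?_, fun i hi => hy.2 i ?_⟩
  · have := convex_ball (0 : ℂ) 1 (x := q) (by simpa using h.norm_lt) (y := y) (by simpa using hy.1)
      ha hb hab
    simpa using this
  · obtain ⟨h0, h1⟩ := hi
    rw [rayCoord_combo _ _ _ _ hab, rayCoord_base, smul_zero, zero_add, Complex.real_smul] at h0 h1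
    rw [Complex.im_ofReal_mul] at h0
    rw [Complex.re_ofReal_mul] at h1
    have hb0 : b ≠ 0 := by
      rintro rfl
      norm_num at h1
    refine ⟨(mul_eq_zero.1 h0).resolve_left hb0, ?_⟩
    have hb1 : b ≤ 1 := by linarith
    by_contra hlt
    push Not at hlt
    have := hb.lt_of_ne' hb0
    nlinarith

theorem slitDisc_subset (h : IsSlitCentre p x₀ q ε) : slitDisc p q ⊆ puncturedDisc p :=
  fun z hz => ⟨hz.1, fun i e => hz.2 i (by
    rw [e]
    simp [slit, rayCoord_self (h.ne i)])⟩

theorem IsSlitCentre.notMem_cone (h : IsSlitCentre p x₀ q ε) (i j : Fin n) :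
    p j ∉ cone q (p i) ε := by
  intro hj
  by_cases hij : i = j
  · subst hij
    simp [cone, rayCoord_self (h.ne i)] at hj
  · exact Set.disjoint_left.1 (h.disjoint i j hij) (cone_subset_bigCone h.pos hj)
      (mem_bigCone_self (h.ne j) h.pos)

theorem IsSlitCentre.disjoint_cone (h : IsSlitCentre p x₀ q ε) {i j : Fin n} (hij : i ≠ j) :
    Disjoint (cone q (p i) ε) (cone q (p j) ε) :=
  (h.disjoint i j hij).mono (cone_subset_bigCone h.pos) (cone_subset_bigCone h.pos)

/-- The cone behind `p_i` contains points of the disc on either side of the slit. -/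
theorem IsSlitCentre.exists_mem_cone (h : IsSlitCentre p x₀ q ε) (hdisc : ∀ i, ‖p i‖ < 1)
    (i : Fin n) {σ : ℝ} (hσ : |σ| < 1) : ∃ z ∈ Metric.ball (0 : ℂ) 1 ∩ cone q (p i) ε, ∃ d > 0,
      (rayCoord q (p i) z).im = σ * d := by
  obtain ⟨δ, hδ, hmem⟩ := exists_near_vertex (q := q) (a := p i) (V := Metric.ball (0 : ℂ) 1)
    Metric.isOpen_ball (by simpa using hdisc i)
  have hlim : Filter.Tendsto (fun d : ℝ => ‖(⟨d, σ * (ε * d)⟩ : ℂ)‖)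
      (nhdsWithin (0 : ℝ) (Ioi 0)) (nhds 0) := by
    have hc : Continuous fun d : ℝ => ‖(d : ℂ) + ((σ * (ε * d) : ℝ) : ℂ) * Complex.I‖ := by
      fun_prop
    have := (hc.tendsto 0).mono_left (nhdsWithin_le_nhds (s := Ioi 0))
    simpa [Complex.mk_eq_add_mul_I] using this
  obtain ⟨d, hd, hd0⟩ := ((hlim.eventually (gt_mem_nhds hδ)).and self_mem_nhdsWithin).exists
  have hd0 : 0 < d := hd0
  have hpos := mul_pos h.pos hd0
  refine ⟨_, ⟨hmem _ hd, ?_⟩, ε * d, hpos, ?_⟩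
  · simp only [cone, mem_ofPred_eq, rayCoord_point (h.ne i), Complex.add_im, Complex.one_im,
      Complex.add_re, Complex.one_re, zero_add, add_sub_cancel_left, abs_mul, abs_of_pos h.pos,
      abs_of_pos hd0]
    nlinarith
  · simp [rayCoord_point (h.ne i)]

theorem IsSlitCentre.mem_slitDisc (h : IsSlitCentre p x₀ q ε) {i : Fin n} {z : ℂ}
    (hz : z ∈ Metric.ball (0 : ℂ) 1 ∩ cone q (p i) ε) (him : (rayCoord q (p i) z).im ≠ 0) :
    z ∈ slitDisc p q := by
  refine ⟨by simpa using hz.1, fun j hj => ?_⟩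
  by_cases hij : i = j
  · subst hij
    exact him hj.1
  · have hzj : z ≠ p j := fun e => h.notMem_cone i j (e ▸ hz.2)
    exact Set.disjoint_left.1 (h.disjoint_cone hij) hz.2
      (slit_subset_cone (h.ne j) h.pos hj hzj)

theorem IsSlitCentre.cone_subset (h : IsSlitCentre p x₀ q ε) (i : Fin n) :
    Metric.ball (0 : ℂ) 1 ∩ cone q (p i) ε ⊆ puncturedDisc p :=
  fun z hz => ⟨by simpa using hz.1, fun j e => h.notMem_cone i j (e ▸ hz.2)⟩

theorem IsSlitCentre.cover (h : IsSlitCentre p x₀ q ε) {z : ℂ} (hz : z ∈ puncturedDisc p) :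
    z ∈ slitDisc p q ∨ ∃ i, z ∈ Metric.ball (0 : ℂ) 1 ∩ cone q (p i) ε := by
  by_cases hs : ∃ i, z ∈ slit q (p i)
  · obtain ⟨i, hi⟩ := hs
    exact Or.inr ⟨i, by simpa using hz.1, slit_subset_cone (h.ne i) h.pos hi (hz.2 i)⟩
  · exact Or.inl ⟨hz.1, fun i hi => hs ⟨i, hi⟩⟩

theorem isPathConnected_puncturedDisc (h : IsSlitCentre p x₀ q ε) (hdisc : ∀ i, ‖p i‖ < 1) :
    IsPathConnected (puncturedDisc p) := by
  have hA : ∀ z ∈ slitDisc p q, JoinedIn (puncturedDisc p) q z := fun z hz =>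
    (((starConvex_slitDisc h).isPathConnected (mem_slitDisc_centre h)).joinedIn q
      (mem_slitDisc_centre h) z hz).mono (slitDisc_subset h)
  refine ⟨q, slitDisc_subset h (mem_slitDisc_centre h), fun {z} hz => ?_⟩
  rcases h.cover hz with hz | ⟨i, hi⟩
  · exact hA z hz
  · obtain ⟨y, hy, d, hd, e⟩ := h.exists_mem_cone hdisc i (σ := 1 / 2)
      (by rw [abs_of_pos] <;> norm_num)
    have hconv := (convex_ball (0 : ℂ) 1).inter (convex_cone q (p i) ε)
    exact (hA y (h.mem_slitDisc hy (by rw [e]; positivity))).trans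
      (((hconv.isPathConnected ⟨y, hy⟩).joinedIn y hy z hi).mono (h.cone_subset i))

/-- The fundamental group of the disc with `n` punctures is generated by `n` elements. -/
theorem exists_generators_puncturedDisc (hdisc : ∀ i, ‖p i‖ < 1) {x₀ : puncturedDisc p}
    (h : IsSlitCentre p x₀ q ε) :
    ∃ g : Fin n → LoopGroup (puncturedDisc p) x₀, Subgroup.closure (range g) = ⊤ := by
  let S : Fin n → Set ℂ := fun i => Metric.ball 0 1 ∩ cone q (p i) ε
  let P : Fin n → Set ℂ := fun i => S i ∩ halfPlane q (p i) 0 1 0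
  let N : Fin n → Set ℂ := fun i => S i ∩ halfPlane q (p i) 0 (-1) 0
  have hSc : ∀ i, Convex ℝ (S i) := fun i => (convex_ball _ _).inter (convex_cone _ _ _)
  have hPne : ∀ i, (P i).Nonempty := fun i => by
    obtain ⟨z, hz, d, hd, e⟩ := h.exists_mem_cone hdisc i (σ := 1 / 2)
      (by rw [abs_of_pos] <;> norm_num)
    refine ⟨z, hz, ?_⟩
    simp only [halfPlane, mem_ofPred_eq, e]
    linarith
  have hNne : ∀ i, (N i).Nonempty := fun i => by
    obtain ⟨z, hz, d, hd, e⟩ := h.exists_mem_cone hdisc i (σ := -1 / 2)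
      (by rw [abs_of_neg] <;> norm_num)
    refine ⟨z, hz, ?_⟩
    simp only [halfPlane, mem_ofPred_eq, e]
    linarith
  have : ContractibleSpace (slitDisc p q) :=
    (starConvex_slitDisc h).contractibleSpace ⟨q, mem_slitDisc_centre h⟩
  have : ∀ i, ContractibleSpace (S i) := fun i =>
    (hSc i).contractibleSpace ((hPne i).mono inter_subset_left)
  have : ∀ i, ContractibleSpace (P i) := fun i =>
    ((hSc i).inter (convex_halfPlane _ _ _ _ _)).contractibleSpace (hPne i)
  have : ∀ i, ContractibleSpace (N i) := fun i =>
    ((hSc i).inter (convex_halfPlane _ _ _ _ _)).contractibleSpace (hNne i)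
  refine exists_generators (A := slitDisc p q) (S := S) (P := P) (N := N) isOpen_slitDisc
    (fun i => Metric.isOpen_ball.inter (isOpen_cone _ _ _)) (slitDisc_subset h) h.cone_subset
    (fun z hz => h.cover hz) ?_ ?_ ?_ ?_
    ⟨x₀.2.1, h.base⟩
  · exact fun i j hij => (h.disjoint_cone hij).mono inter_subset_right inter_subset_right
  · intro i z hz
    refine ⟨h.mem_slitDisc hz.1 ?_, hz.1⟩
    have : 0 < 0 * (rayCoord q (p i) z).re + 1 * (rayCoord q (p i) z).im + 0 := hz.2
    intro h0
    rw [h0] at this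
    norm_num at this
  · intro i z hz
    refine ⟨h.mem_slitDisc hz.1 ?_, hz.1⟩
    have : 0 < 0 * (rayCoord q (p i) z).re + -1 * (rayCoord q (p i) z).im + 0 := hz.2
    intro h0
    rw [h0] at this
    norm_num at this
  · rintro i z ⟨hzA, hzS⟩
    have him : (rayCoord q (p i) z).im ≠ 0 := by
      intro h0
      refine hzA.2 i ⟨h0, ?_⟩
      have := hzS.2
      simp only [cone, mem_ofPred_eq, h0, abs_zero] at this
      have := pos_of_mul_pos_right this h.pos.le
      linarith
    rcases lt_or_gt_of_ne him with hlt | hgt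
    · refine Or.inr ⟨hzS, ?_⟩
      simp only [halfPlane, mem_ofPred_eq]
      linarith
    · refine Or.inl ⟨hzS, ?_⟩
      simp only [halfPlane, mem_ofPred_eq]
      linarith

end Slits

/-! ### Standard forms on the punctured disc -/

section StandardForms

open Set

/-- The differential of a function as a `1`-form. -/
def exactForm (F : ℂ → ℝ) (z : ℂ) : ℂ [⋀^Fin 1]→L[ℝ] ℝ :=
  ContinuousAlternatingMap.ofSubsingleton ℝ ℂ ℝ (0 : Fin 1) (fderiv ℝ F z)

theorem exactForm_apply (F : ℂ → ℝ) (z v : ℂ) : exactForm F z ![v] = fderiv ℝ F z v := by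
  simp [exactForm]

theorem oneFormCLM_exactForm (F : ℂ → ℝ) (z : ℂ) : oneFormCLM (exactForm F z) = fderiv ℝ F z := by
  ext v
  rw [oneFormCLM_apply, exactForm_apply]

theorem oneFormCLM_injective : Function.Injective oneFormCLM := by
  intro θ θ' h
  ext v
  have : v = ![v 0] := by
    funext j
    fin_cases j
    rfl
  rw [this, ← oneFormCLM_apply, h, oneFormCLM_apply]

theorem exactForm_eq_extDeriv (F : ℂ → ℝ) :
    exactForm F =
      extDeriv fun z => ContinuousAlternatingMap.constOfIsEmpty ℝ ℂ (Fin 0) (F z) :=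
  funext fun z => (extDeriv_constOfIsEmpty F z).symm

theorem contDiffAt_constOfIsEmpty {F : ℂ → ℝ} {z : ℂ} {m : WithTop ℕ∞} (hF : ContDiffAt ℝ m F z) :
    ContDiffAt ℝ m (fun z => ContinuousAlternatingMap.constOfIsEmpty ℝ ℂ (Fin 0) (F z)) z :=
  (ContinuousAlternatingMap.constOfIsEmptyLIE ℝ ℂ ℝ (Fin 0)).contDiff.contDiffAt.comp z hF

theorem extDeriv_exactForm {F : ℂ → ℝ} {z : ℂ} (hF : ContDiffAt ℝ (⊤ : ℕ∞) F z) :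
    extDeriv (exactForm F) z = 0 := by
  rw [exactForm_eq_extDeriv]
  exact extDeriv_extDeriv_apply (contDiffAt_constOfIsEmpty hF) (by
    rw [minSmoothness_of_isRCLikeNormedField]
    exact WithTop.coe_le_coe.2 le_top)

theorem contDiffAt_exactForm {F : ℂ → ℝ} {z : ℂ} (hF : ContDiffAt ℝ (⊤ : ℕ∞) F z) :
    ContDiffAt ℝ (⊤ : ℕ∞) (exactForm F) z :=
  (ContinuousAlternatingMap.ofSubsingletonLIE (𝕜 := ℝ) (E := ℂ) (F := ℝ)
    (0 : Fin 1)).contDiff.contDiffAt.comp z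
    (hF.fderiv_right (m := (⊤ : ℕ∞)) (by simp))

/-- The slope coordinate at the vertex `a`; on the cone of aperture `ε` it has values in `(-1, 1)`. -/
def coneAngle (q a : ℂ) (ε : ℝ) (z : ℂ) : ℝ :=
  (rayCoord q a z).im / (ε * ((rayCoord q a z).re - 1))

/-- A function on the cone that rises from `0` on the lower side to `1` on the upper side. -/
def coneStep (q a : ℂ) (ε : ℝ) (z : ℂ) : ℝ := Real.smoothTransition (coneAngle q a ε z + 1 / 2)

open Classical in
/-- The differential of `coneStep`, extended by zero outside the cone. Its integral over a loop
counts how often the loop crosses the cone. -/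
def coneForm (q a : ℂ) (ε : ℝ) (z : ℂ) : ℂ [⋀^Fin 1]→L[ℝ] ℝ :=
  if z ∈ cone q a ε then exactForm (coneStep q a ε) z else 0

variable {q a : ℂ} {ε : ℝ}

theorem re_pos_of_mem_cone (hε : 0 < ε) {z : ℂ} (hz : z ∈ cone q a ε) :
    0 < (rayCoord q a z).re - 1 := by
  simp only [cone, mem_ofPred_eq] at hz
  exact pos_of_mul_pos_right ((abs_nonneg _).trans_lt hz) hε.le

theorem contDiff_rayCoord (q a : ℂ) : ContDiff ℝ (⊤ : ℕ∞) (rayCoord q a) := by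
  unfold rayCoord
  simp only [div_eq_mul_inv]
  fun_prop

theorem contDiffAt_coneStep (hε : 0 < ε) {z : ℂ} (hz : z ∈ cone q a ε) :
    ContDiffAt ℝ (⊤ : ℕ∞) (coneStep q a ε) z := by
  have h1 : ContDiffAt ℝ (⊤ : ℕ∞) (fun z => (rayCoord q a z).im) z :=
    (Complex.imCLM.contDiff.comp (contDiff_rayCoord q a)).contDiffAt
  have h2 : ContDiffAt ℝ (⊤ : ℕ∞) (fun z => (rayCoord q a z).re) z :=
    (Complex.reCLM.contDiff.comp (contDiff_rayCoord q a)).contDiffAt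
  refine Real.smoothTransition.contDiff.contDiffAt.comp z ((h1.div
    (contDiffAt_const.mul (h2.sub contDiffAt_const)) ?_).add contDiffAt_const)
  exact (mul_pos hε (re_pos_of_mem_cone hε hz)).ne'

/-- The form vanishes outside the inner half of the cone, as `coneStep` is locally constant on the
outer half. -/
theorem coneForm_eq_zero (hε : 0 < ε) {z : ℂ}
    (hz : ε * ((rayCoord q a z).re - 1) < 2 * |(rayCoord q a z).im|) : coneForm q a ε z = 0 := by
  classical
  by_cases hc : z ∈ cone q a ε
  swap
  · rw [coneForm, if_neg hc]
  rw [coneForm, if_pos hc]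
  have hcont := continuous_rayCoord q a
  have hpos : ∀ y ∈ cone q a ε, 0 < ε * ((rayCoord q a y).re - 1) := fun y hy =>
    mul_pos hε (re_pos_of_mem_cone hε hy)
  have him := Complex.continuous_im.comp hcont
  have hre := Complex.continuous_re.comp hcont
  have hopen : cone q a ε ∈ nhds z := (isOpen_cone q a ε).mem_nhds hc
  have key : ∃ k : ℝ, coneStep q a ε =ᶠ[nhds z] fun _ => k := by
    rcases lt_or_ge (rayCoord q a z).im 0 with hneg | hnn
    · rw [abs_of_neg hneg] at hz
      refine ⟨0, ?_⟩
      have h1 : ∀ᶠ y in nhds z, ε * ((rayCoord q a y).re - 1) < 2 * -(rayCoord q a y).im :=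
        (isOpen_lt (continuous_const.mul (hre.sub continuous_const))
          (continuous_const.mul him.neg)).mem_nhds hz
      filter_upwards [h1, hopen] with y hy hyc
      refine Real.smoothTransition.zero_of_nonpos ?_
      have := hpos y hyc
      have : coneAngle q a ε y ≤ -(1 / 2) := by
        rw [coneAngle, div_le_iff₀ this]
        linarith
      linarith
    · rw [abs_of_nonneg hnn] at hz
      refine ⟨1, ?_⟩
      have h1 : ∀ᶠ y in nhds z, ε * ((rayCoord q a y).re - 1) < 2 * (rayCoord q a y).im :=
        (isOpen_lt (continuous_const.mul (hre.sub continuous_const))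
          (continuous_const.mul him)).mem_nhds hz
      filter_upwards [h1, hopen] with y hy hyc
      refine Real.smoothTransition.one_of_one_le ?_
      have := hpos y hyc
      have : 1 / 2 ≤ coneAngle q a ε y := by
        rw [coneAngle, le_div_iff₀ this]
        linarith
      linarith
  obtain ⟨k, hk⟩ := key
  apply oneFormCLM_injective
  rw [oneFormCLM_exactForm, hk.fderiv_eq]
  ext v
  simp [oneFormCLM_apply]

/-- Away from the vertex the form is locally the differential of a smooth function; in particular it
is smooth and closed there. -/
theorem coneForm_locally_exact (hε : 0 < ε) (haq : a ≠ q) {z : ℂ} (hz : z ≠ a) :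
    ∃ F : ℂ → ℝ, ContDiffAt ℝ (⊤ : ℕ∞) F z ∧ coneForm q a ε =ᶠ[nhds z] exactForm F := by
  classical
  by_cases hc : z ∈ cone q a ε
  · refine ⟨_, contDiffAt_coneStep hε hc, ?_⟩
    filter_upwards [(isOpen_cone q a ε).mem_nhds hc] with y hy
    rw [coneForm, if_pos hy]
  · refine ⟨0, contDiffAt_const, ?_⟩
    have hlt : ε * ((rayCoord q a z).re - 1) < 2 * |(rayCoord q a z).im| := by
      simp only [cone, mem_ofPred_eq, not_lt] at hc
      by_contra hle
      push Not at hle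
      have h1 := abs_nonneg (rayCoord q a z).im
      have h2 : |(rayCoord q a z).im| = 0 := by linarith
      have h3 : (rayCoord q a z).re - 1 = 0 := by
        have : ε * ((rayCoord q a z).re - 1) = 0 := by linarith
        exact (mul_eq_zero.1 this).resolve_left hε.ne'
      have h4 : rayCoord q a z = 1 := Complex.ext (by simpa using sub_eq_zero.1 h3)
        (by simpa using h2)
      rw [rayCoord, div_eq_one_iff_eq (sub_ne_zero.2 haq)] at h4
      exact hz (sub_left_injective h4)
    have hcont := continuous_rayCoord q a
    have him := Complex.continuous_im.comp hcont
    have hre := Complex.continuous_re.comp hcont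
    filter_upwards [(isOpen_lt (continuous_const.mul (hre.sub continuous_const))
      (continuous_const.mul him.abs)).mem_nhds hlt] with y hy
    rw [coneForm_eq_zero hε hy]
    apply oneFormCLM_injective
    rw [oneFormCLM_exactForm]
    ext v
    simp [oneFormCLM_apply]

theorem isOpen_bigCone (q a : ℂ) (ε : ℝ) : IsOpen (bigCone q a ε) := by
  have hcont := continuous_rayCoord q a
  exact isOpen_lt (Complex.continuous_im.comp hcont).abs
    (continuous_const.mul (Complex.continuous_re.comp hcont))

variable {n : ℕ} {p : Fin n → ℂ} {x₀ : ℂ}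

theorem IsSlitCentre.isFlatSystem_coneForm (h : IsSlitCentre p x₀ q ε) :
    IsFlatSystem (fun i => coneForm q (p i) ε) (puncturedDisc p) where
  smooth i z hz := by
    obtain ⟨F, hF, he⟩ := coneForm_locally_exact h.pos (h.ne i) (hz.2 i)
    exact ((contDiffAt_exactForm hF).congr_of_eventuallyEq he).contDiffWithinAt
  closed i z hz := by
    obtain ⟨F, hF, he⟩ := coneForm_locally_exact h.pos (h.ne i) (hz.2 i)
    rw [he.extDeriv_eq, extDeriv_exactForm hF]
  wedge i j z _ u v := by
    by_cases hij : i = j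
    · subst hij
      ring
    · by_cases hi : z ∈ cone q (p i) ε
      · have hj : z ∉ cone q (p j) ε := Set.disjoint_left.1 (h.disjoint_cone hij) hi
        simp [coneForm, if_neg hj]
      · simp [coneForm, if_neg hi]

theorem eq_of_hasFDerivAt_zero {V : Set ℂ} (hV : Convex ℝ V) (hVo : IsOpen V) {f : ℂ → ℝ}
    (hf : ∀ z ∈ V, HasFDerivAt f (0 : ℂ →L[ℝ] ℝ) z) {x y : ℂ} (hx : x ∈ V) (hy : y ∈ V) :
    f x = f y :=
  hVo.is_const_of_fderiv_eq_zero hV.isPreconnected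
    (fun z hz => (hf z hz).differentiableAt.differentiableWithinAt)
    (fun z hz => (hf z hz).fderiv) hx hy

/-- The classes of the standard forms are linearly independent. A primitive `f` of `∑ c_i ω_i` is
constant near `p_i` outside the cone, and jumps by `c_i` from one side of the cone to the other. -/
theorem IsSlitCentre.coeff_eq_zero (h : IsSlitCentre p x₀ q ε) (hdisc : ∀ i, ‖p i‖ < 1)
    {c : Fin n → ℝ} {f : ℂ → ℝ} (hf : ∀ z ∈ puncturedDisc p,
      HasFDerivAt f (oneFormCLM (∑ i, c i • coneForm q (p i) ε z)) z) (i : Fin n) : c i = 0 := by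
  classical
  obtain ⟨r, hr, hball⟩ := Metric.isOpen_iff.1 ((Metric.isOpen_ball (x := (0 : ℂ)) (ε := 1)).inter
    (isOpen_bigCone q (p i) ε)) (p i) ⟨by simpa using hdisc i, mem_bigCone_self (h.ne i) h.pos⟩
  -- near `p_i` only the form with index `i` does not vanish
  have hnear : ∀ z ∈ Metric.ball (p i) r, z ≠ p i →
      HasFDerivAt f (c i • oneFormCLM (coneForm q (p i) ε z)) z := by
    intro z hz hzi
    have hzj : ∀ j, j ≠ i → z ∉ bigCone q (p j) ε := fun j hj hzj =>
      Set.disjoint_left.1 (h.disjoint j i hj) hzj (hball hz).2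
    have hU : z ∈ puncturedDisc p := by
      refine ⟨by simpa using (hball hz).1, fun j e => ?_⟩
      by_cases hj : j = i
      · exact hzi (hj ▸ e)
      · exact hzj j hj (e ▸ mem_bigCone_self (h.ne j) h.pos)
    have := hf z hU
    rw [Finset.sum_eq_single i (fun j _ hj => by
      rw [coneForm, if_neg fun hz => hzj j hj (cone_subset_bigCone h.pos hz), smul_zero])
      (by simp)] at this
    convert this using 1
    ext v
    simp [oneFormCLM_apply]
  let B := Metric.ball (p i) r
  have hzero : ∀ z ∈ B, ε * ((rayCoord q (p i) z).re - 1) < 2 * |(rayCoord q (p i) z).im| →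
      HasFDerivAt f (0 : ℂ →L[ℝ] ℝ) z := by
    intro z hz hlt
    have hzi : z ≠ p i := by
      rintro rfl
      simp [rayCoord_self (h.ne i)] at hlt
    have := hnear z hz hzi
    rw [coneForm_eq_zero h.pos hlt] at this
    convert this using 1
    ext v
    simp [oneFormCLM_apply]
  obtain ⟨δ, hδ, hmem⟩ := exists_near_vertex (q := q) (a := p i) (V := B) Metric.isOpen_ball
    (Metric.mem_ball_self hr)
  -- three points around `p_i`: one on the far side and two on the two sides of the cone
  obtain ⟨d, hd, hdδ⟩ : ∃ d : ℝ, 0 < d ∧ d * (1 + ε) < δ :=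
    ⟨δ / (2 * (1 + ε)), by have := h.pos; positivity, by
      have := h.pos
      rw [div_mul_eq_mul_div, div_lt_iff₀ (by positivity)]
      nlinarith [mul_pos hδ this]⟩
  have hεd := mul_pos h.pos hd
  let pt : ℝ → ℝ → ℂ := fun s t => q + (p i - q) * (1 + (⟨s, t⟩ : ℂ))
  have hpt : ∀ s t : ℝ, |s| ≤ d → |t| ≤ ε * d → pt s t ∈ B := by
    intro s t hs ht
    refine hmem _ ((Complex.norm_le_abs_re_add_abs_im _).trans_lt ?_)
    simp only
    nlinarith
  have hre : ∀ s t, (rayCoord q (p i) (pt s t)).re = 1 + s := fun s t => by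
    simp [pt, rayCoord_point (h.ne i)]
  have him : ∀ s t, (rayCoord q (p i) (pt s t)).im = t := fun s t => by
    simp [pt, rayCoord_point (h.ne i)]
  have hL := hpt (-d) 0 (by rw [abs_neg, abs_of_pos hd]) (by simpa using hεd.le)
  have hP := hpt d (3 / 4 * (ε * d)) (abs_of_pos hd).le (by rw [abs_of_pos (by positivity)]; linarith)
  have hN := hpt d (-(3 / 4 * (ε * d))) (abs_of_pos hd).le
    (by rw [abs_neg, abs_of_pos (by positivity)]; linarith)
  have e1 : f (pt (-d) 0) = f (pt d (3 / 4 * (ε * d))) := by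
    refine eq_of_hasFDerivAt_zero (V := B ∩ halfPlane q (p i) (-ε) 2 ε)
      ((convex_ball _ _).inter (convex_halfPlane _ _ _ _ _))
      (Metric.isOpen_ball.inter (isOpen_halfPlane _ _ _ _ _)) (fun z hz => hzero z hz.1 ?_)
      ⟨hL, ?_⟩ ⟨hP, ?_⟩
    · have h1 := hz.2
      simp only [halfPlane, mem_ofPred_eq] at h1
      have := le_abs_self (rayCoord q (p i) z).im
      linarith
    · simp only [halfPlane, mem_ofPred_eq, hre, him]
      linarith
    · simp only [halfPlane, mem_ofPred_eq, hre, him]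
      linarith
  have e2 : f (pt (-d) 0) = f (pt d (-(3 / 4 * (ε * d)))) := by
    refine eq_of_hasFDerivAt_zero (V := B ∩ halfPlane q (p i) (-ε) (-2) ε)
      ((convex_ball _ _).inter (convex_halfPlane _ _ _ _ _))
      (Metric.isOpen_ball.inter (isOpen_halfPlane _ _ _ _ _)) (fun z hz => hzero z hz.1 ?_)
      ⟨hL, ?_⟩ ⟨hN, ?_⟩
    · have h1 := hz.2
      simp only [halfPlane, mem_ofPred_eq] at h1
      have := neg_le_abs (rayCoord q (p i) z).im
      linarith
    · simp only [halfPlane, mem_ofPred_eq, hre, him]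
      linarith
    · simp only [halfPlane, mem_ofPred_eq, hre, him]
      linarith
  have e3 : f (pt d (3 / 4 * (ε * d))) - c i * coneStep q (p i) ε (pt d (3 / 4 * (ε * d))) =
      f (pt d (-(3 / 4 * (ε * d)))) -
        c i * coneStep q (p i) ε (pt d (-(3 / 4 * (ε * d)))) := by
    refine eq_of_hasFDerivAt_zero (V := B ∩ cone q (p i) ε)
      (f := fun z => f z - c i * coneStep q (p i) ε z)
      ((convex_ball _ _).inter (convex_cone _ _ _))
      (Metric.isOpen_ball.inter (isOpen_cone _ _ _)) (fun z hz => ?_) ⟨hP, ?_⟩ ⟨hN, ?_⟩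
    · have hzi : z ≠ p i := fun e => h.notMem_cone i i (e ▸ hz.2)
      have h1 := hnear z hz.1 hzi
      have h2 := ((contDiffAt_coneStep h.pos hz.2).differentiableAt (by simp)).hasFDerivAt.const_mul
        (c i)
      rw [coneForm, if_pos hz.2, oneFormCLM_exactForm] at h1
      have h3 := h1.sub h2
      rw [sub_self] at h3
      exact h3
    · simp only [cone, mem_ofPred_eq, hre, him, abs_of_pos (show 0 < 3 / 4 * (ε * d) by positivity)]
      linarith
    · simp only [cone, mem_ofPred_eq, hre, him, abs_neg,
        abs_of_pos (show 0 < 3 / 4 * (ε * d) by positivity)]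
      linarith
  have s1 : coneStep q (p i) ε (pt d (3 / 4 * (ε * d))) = 1 := by
    refine Real.smoothTransition.one_of_one_le ?_
    rw [coneAngle, hre, him, add_sub_cancel_left, mul_div_cancel_right₀ _ hεd.ne']
    norm_num
  have s2 : coneStep q (p i) ε (pt d (-(3 / 4 * (ε * d)))) = 0 := by
    refine Real.smoothTransition.zero_of_nonpos ?_
    rw [coneAngle, hre, him, add_sub_cancel_left, neg_div, mul_div_cancel_right₀ _ hεd.ne']
    norm_num
  rw [s1, s2] at e3
  linarith

theorem extDeriv_sum {ι : Type} {ω : ι → ℂ → ℂ [⋀^Fin 1]→L[ℝ] ℝ} {z : ℂ}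
    (hω : ∀ i, DifferentiableAt ℝ (ω i) z) (c : ι → ℝ) (s : Finset ι) :
    extDeriv (fun z => ∑ i ∈ s, c i • ω i z) z = ∑ i ∈ s, c i • extDeriv (ω i) z := by
  classical
  induction s using Finset.induction_on with
  | empty =>
    have := extDeriv_smul (x := z) (0 : ℝ) (fun _ : ℂ => (0 : ℂ [⋀^Fin 1]→L[ℝ] ℝ))
    rw [zero_smul, zero_smul] at this
    simpa using! this
  | insert i s hi ih =>
    simp only [Finset.sum_insert hi]
    rw [extDeriv_fun_add (ω₁ := fun z => c i • ω i z)
      (ω₂ := fun z => ∑ i ∈ s, c i • ω i z) ((hω i).const_smul (c i))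
      (DifferentiableAt.fun_sum fun j _ => (hω j).const_smul (c j)), ih]
    exact congrArg (· + _) (extDeriv_fun_smul (c i) (ω i))

/-- Linear combinations of the forms of a flat system form a flat system. -/
theorem IsFlatSystem.linearCombination {ι κ : Type} [Fintype ι] {U : Set ℂ} (hU : IsOpen U)
    {ω : ι → ℂ → ℂ [⋀^Fin 1]→L[ℝ] ℝ} (h : IsFlatSystem ω U) (A : κ → ι → ℝ) :
    IsFlatSystem (fun k z => ∑ i, A k i • ω i z) U where
  smooth k := ContDiffOn.sum fun i _ => (h.smooth i).const_smul (A k i)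
  closed k z hz := by
    rw [extDeriv_sum (fun i => ((h.smooth i).differentiableOn (by simp) z hz).differentiableAt
      (hU.mem_nhds hz))]
    exact Finset.sum_eq_zero fun i _ => by rw [h.closed i z hz, smul_zero]
  wedge k l z hz u v := by
    simp only [ContinuousAlternatingMap.sum_apply, ContinuousAlternatingMap.smul_apply, smul_eq_mul,
      Finset.sum_mul_sum]
    rw [← Finset.sum_sub_distrib]
    refine Finset.sum_eq_zero fun i _ => ?_
    rw [← Finset.sum_sub_distrib]
    refine Finset.sum_eq_zero fun j _ => ?_
    linear_combination A k i * A l j * h.wedge i j z hz u v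

end StandardForms

/-! ### Exactness of 2-forms -/

section TwoForms

open Set MeasureTheory

/-- Integrals over `[a, b]` of smooth functions depend smoothly on parameters. -/
theorem contDiffOn_integral_nat {V : Set ℂ} (hV : IsOpen V) {Ω : Set (ℂ × ℝ)} (hΩ : IsOpen Ω)
    {a b : ℝ} (hsub : V ×ˢ uIcc a b ⊆ Ω) (m : ℕ) :
    ∀ {G : Type} [NormedAddCommGroup G] [NormedSpace ℝ G] [CompleteSpace G] {F : ℂ × ℝ → G},
      ContDiffOn ℝ m F Ω → ContDiffOn ℝ m (fun z => ∫ s in a..b, F (z, s)) V := by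
  have hbound : ∀ {G : Type} [NormedAddCommGroup G] {F : ℂ × ℝ → G}, ContinuousOn F Ω →
      ∀ z ∈ V, ∃ r > 0, Metric.ball z r ⊆ V ∧ ∃ C, ∀ y ∈ Metric.ball z r, ∀ s ∈ uIcc a b,
        ‖F (y, s)‖ ≤ C := by
    intro G _ F hF z hz
    obtain ⟨r, hr, hball⟩ := Metric.nhds_basis_closedBall.mem_iff.1 (hV.mem_nhds hz)
    obtain ⟨C, hC⟩ := ((isCompact_closedBall z r).prod isCompact_uIcc).exists_bound_of_continuousOn
      (hF.mono ((prod_mono hball le_rfl).trans hsub))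
    exact ⟨r, hr, Metric.ball_subset_closedBall.trans hball, C,
      fun y hy s hs => hC (y, s) ⟨Metric.ball_subset_closedBall hy, hs⟩⟩
  have hslice : ∀ {G : Type} [NormedAddCommGroup G] {F : ℂ × ℝ → G}, ContinuousOn F Ω →
      ∀ z ∈ V, ContinuousOn (fun s => F (z, s)) (uIcc a b) := by
    intro G _ F hF z hz
    exact hF.comp (by fun_prop) fun s hs => hsub ⟨hz, hs⟩
  have hmeas : ∀ {G : Type} [NormedAddCommGroup G] {F : ℂ × ℝ → G}, ContinuousOn F Ω →
      ∀ z ∈ V, AEStronglyMeasurable (fun s => F (z, s)) (volume.restrict (uIoc a b)) := by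
    intro G _ F hF z hz
    exact ((hslice hF z hz).mono uIoc_subset_uIcc).aestronglyMeasurable measurableSet_uIoc
  induction m with
  | zero =>
    intro G _ _ _ F hF
    rw [Nat.cast_zero, contDiffOn_zero] at hF ⊢
    intro z hz
    obtain ⟨r, hr, -, C, hC⟩ := hbound hF z hz
    refine (intervalIntegral.continuousAt_of_dominated_interval (bound := fun _ => C)
      ?_ ?_ intervalIntegrable_const ?_).continuousWithinAt
    · filter_upwards [hV.mem_nhds hz] with y hy using hmeas hF y hy
    · filter_upwards [Metric.ball_mem_nhds z hr] with y hy
      exact ae_of_all _ fun s hs => hC y hy s (uIoc_subset_uIcc hs)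
    · refine ae_of_all _ fun s hs => ?_
      have hzs : (z, s) ∈ Ω := hsub ⟨hz, uIoc_subset_uIcc hs⟩
      exact (hF.continuousAt (hΩ.mem_nhds hzs)).comp (f := fun y => (y, s)) (by fun_prop)
  | succ m ih =>
    intro G _ _ _ F hF
    rw [Nat.cast_succ] at hF ⊢
    rw [contDiffOn_succ_iff_fderiv_of_isOpen hΩ] at hF
    obtain ⟨hd, -, hF'⟩ := hF
    let F' : ℂ × ℝ → ℂ →L[ℝ] G := fun x => (fderiv ℝ F x).comp (ContinuousLinearMap.inl ℝ ℂ ℝ)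
    have hF'' : ContDiffOn ℝ m F' Ω := hF'.clm_comp contDiffOn_const
    have hder : ∀ z ∈ V, HasFDerivAt (fun z => ∫ s in a..b, F (z, s)) (∫ s in a..b, F' (z, s)) z := by
      intro z hz
      obtain ⟨r, hr, hball, C, hC⟩ := hbound hF''.continuousOn z hz
      refine intervalIntegral.hasFDerivAt_integral_of_dominated_of_fderiv_le (bound := fun _ => C)
        (F := fun z s => F (z, s)) (F' := fun z s => F' (z, s)) (Metric.ball_mem_nhds z hr) ?_
        (hslice hd.continuousOn z hz).intervalIntegrable (hmeas hF''.continuousOn z hz) ?_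
        intervalIntegrable_const ?_
      · filter_upwards [hV.mem_nhds hz] with y hy using hmeas hd.continuousOn y hy
      · exact ae_of_all _ fun s hs y hy => hC y hy s (uIoc_subset_uIcc hs)
      · refine ae_of_all _ fun s hs y hy => ?_
        have hys : (y, s) ∈ Ω := hsub ⟨hball hy, uIoc_subset_uIcc hs⟩
        exact ((hd _ hys).differentiableAt (hΩ.mem_nhds hys)).hasFDerivAt.comp y
          (hasFDerivAt_prodMk_left y s)
    rw [contDiffOn_succ_iff_fderiv_of_isOpen hV]
    refine ⟨fun z hz => (hder z hz).differentiableAt.differentiableWithinAt, by simp, ?_⟩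
    exact (ih hF'').congr fun z hz => (hder z hz).fderiv

theorem contDiffOn_integral {V : Set ℂ} (hV : IsOpen V) {Ω : Set (ℂ × ℝ)} (hΩ : IsOpen Ω)
    {a b : ℝ} (hsub : V ×ˢ uIcc a b ⊆ Ω) {F : ℂ × ℝ → ℝ} (hF : ContDiffOn ℝ (⊤ : ℕ∞) F Ω) :
    ContDiffOn ℝ (⊤ : ℕ∞) (fun z => ∫ s in a..b, F (z, s)) V :=
  contDiffOn_infty.2 fun m =>
    contDiffOn_integral_nat hV hΩ hsub m (hF.of_le (by exact_mod_cast le_top))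

/-- A `2`-form on the plane is determined by its value on the standard basis. -/
theorem eq_of_apply_one_I {θ θ' : ℂ [⋀^Fin 2]→L[ℝ] ℝ}
    (h : θ ![1, Complex.I] = θ' ![1, Complex.I]) : θ = θ' := by
  apply ContinuousAlternatingMap.toAlternatingMap_injective
  refine Module.Basis.ext_alternating Complex.basisOneI fun v hv => ?_
  have h01 : v 0 ≠ v 1 := fun e => absurd (hv e) (by decide)
  have key : ∀ φ : ℂ [⋀^Fin 2]→L[ℝ] ℝ, (φ fun i => Complex.basisOneI (v i)) =
      if v 0 = 0 then φ ![1, Complex.I] else -φ ![1, Complex.I] := by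
    intro φ
    split_ifs with h0
    · have h1 : v 1 = 1 := by
        have := h0 ▸ h01
        omega
      congr 1
      funext i
      fin_cases i
      · simp [h0]
      · simp [h1]
    · have h0 : v 0 = 1 := by omega
      have h1 : v 1 = 0 := by omega
      have := φ.toAlternatingMap.map_swap ![1, Complex.I] (show (0 : Fin 2) ≠ 1 by decide)
      rw [← show φ.toAlternatingMap ![1, Complex.I] = φ ![1, Complex.I] from rfl, ← this]
      show φ _ = φ _
      congr 1
      funext i
      fin_cases i
      · simp [h0]
      · simp [h1]
  show (θ fun i => Complex.basisOneI (v i)) = θ' fun i => Complex.basisOneI (v i)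
  rw [key, key, h]

theorem form_eq_zero_of_two_lt {k : ℕ} (hk : 2 < k) (θ : ℂ [⋀^Fin k]→L[ℝ] ℝ) : θ = 0 := by
  apply ContinuousAlternatingMap.toAlternatingMap_injective
  refine Module.Basis.ext_alternating Complex.basisOneI fun v hv => ?_
  have := Fintype.card_le_of_injective v hv
  simp at this
  omega

/-- The `1`-form `(x - a) dy - (y - b) dx` with `p = a + i b`. -/
def rotForm (p z : ℂ) : ℂ [⋀^Fin 1]→L[ℝ] ℝ :=
  ContinuousAlternatingMap.ofSubsingletonLIE (𝕜 := ℝ) (E := ℂ) (F := ℝ) (0 : Fin 1)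
    ((z - p).re • Complex.imCLM - (z - p).im • Complex.reCLM)

theorem contDiff_rotForm (p : ℂ) : ContDiff ℝ (⊤ : ℕ∞) (rotForm p) := by
  have hre : ContDiff ℝ (⊤ : ℕ∞) fun z : ℂ => (z - p).re :=
    Complex.reCLM.contDiff.comp (contDiff_id.sub contDiff_const)
  have him : ContDiff ℝ (⊤ : ℕ∞) fun z : ℂ => (z - p).im :=
    Complex.imCLM.contDiff.comp (contDiff_id.sub contDiff_const)
  exact (ContinuousAlternatingMap.ofSubsingletonLIE (𝕜 := ℝ) (E := ℂ) (F := ℝ)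
    (0 : Fin 1)).contDiff.comp ((hre.smul contDiff_const).sub (him.smul contDiff_const))

theorem rotForm_apply (p z v : ℂ) : rotForm p z ![v] = (z - p).re * v.im - (z - p).im * v.re := by
  simp [rotForm]

/-- `d(A ((x - a) dy - (y - b) dx)) = (2 A + (z - p) ⬝ ∇A) dx ∧ dy`. -/
theorem extDeriv_smul_rotForm {A : ℂ → ℝ} {L : ℂ →L[ℝ] ℝ} {p z : ℂ} (hA : HasFDerivAt A L z) :
    extDeriv (fun z => A z • rotForm p z) z ![1, Complex.I] = 2 * A z + L (z - p) := by
  have hd : DifferentiableAt ℝ (fun z => A z • rotForm p z) z :=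
    hA.differentiableAt.smul ((contDiff_rotForm p).differentiable (by simp) z)
  rw [extDeriv_oneForm_apply hd]
  have hre : HasFDerivAt (fun z : ℂ => (z - p).re) Complex.reCLM z :=
    Complex.reCLM.hasFDerivAt.comp z ((hasFDerivAt_id z).sub_const p)
  have him : HasFDerivAt (fun z : ℂ => (z - p).im) Complex.imCLM z :=
    Complex.imCLM.hasFDerivAt.comp z ((hasFDerivAt_id z).sub_const p)
  have e1 : (fun z => (A z • rotForm p z) ![Complex.I]) = fun z => A z * (z - p).re := by
    funext z
    rw [ContinuousAlternatingMap.smul_apply, rotForm_apply]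
    simp
  have e2 : (fun z => (A z • rotForm p z) ![1]) = fun z => -(A z * (z - p).im) := by
    funext z
    rw [ContinuousAlternatingMap.smul_apply, rotForm_apply]
    simp
    ring
  have hz : L (z - p) = (z - p).re * L 1 + (z - p).im * L Complex.I := by
    conv_lhs => rw [show z - p = (z - p).re • (1 : ℂ) + (z - p).im • Complex.I by
      rw [Complex.real_smul, Complex.real_smul, mul_one, Complex.re_add_im]]
    rw [map_add, map_smul, map_smul, smul_eq_mul, smul_eq_mul]
  have f1 : HasFDerivAt (fun z => A z * (z - p).re) _ z := hA.mul hre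
  have f2 : HasFDerivAt (fun z => -(A z * (z - p).im)) _ z := (hA.mul him).neg
  rw [e1, e2, f1.fderiv, f2.fderiv, hz]
  simp
  ring

/-- Poincaré lemma for `2`-forms by radial integration. The radial integral from the point with
parameter `τ(z)` to `z` yields a primitive as soon as `τ` is homogeneous of degree `-1`, that is,
as soon as the starting point depends only on the ray. -/
theorem exists_primitive_of_radial {V : Set ℂ} (hV : IsOpen V) {p : ℂ} {τ g : ℂ → ℝ}
    (hτ : ContDiffOn ℝ (⊤ : ℕ∞) τ V) (hg : ContDiffOn ℝ (⊤ : ℕ∞) g V)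
    (hhom : ∀ (w : ℂ) (r : ℝ), 0 < r → τ (p + r • w) = τ (p + w) / r)
    (hseg : ∀ z ∈ V, ∀ u ∈ uIcc (τ z) 1, p + u • (z - p) ∈ V) :
    ∃ η : ℂ → ℂ [⋀^Fin 1]→L[ℝ] ℝ, ContDiffOn ℝ (⊤ : ℕ∞) η V ∧
      ∀ z ∈ V, extDeriv η z ![1, Complex.I] = g z := by
  let σ : ℂ × ℝ → ℝ := fun x => τ x.1 + (1 - τ x.1) * x.2
  let P : ℂ × ℝ → ℂ := fun x => p + σ x • (x.1 - p)
  let F : ℂ × ℝ → ℝ := fun x => (1 - τ x.1) * (g (P x) * σ x)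
  let A : ℂ → ℝ := fun z => ∫ s in (0 : ℝ)..1, F (z, s)
  let S : Set (ℂ × ℝ) := V ×ˢ univ
  have hS : IsOpen S := hV.prod isOpen_univ
  have hτS : ContDiffOn ℝ (⊤ : ℕ∞) (fun x : ℂ × ℝ => τ x.1) S :=
    hτ.comp contDiffOn_fst fun x hx => hx.1
  have hσS : ContDiffOn ℝ (⊤ : ℕ∞) σ S :=
    hτS.add ((contDiffOn_const.sub hτS).mul contDiffOn_snd)
  have hPS : ContDiffOn ℝ (⊤ : ℕ∞) P S :=
    contDiffOn_const.add (hσS.smul (contDiffOn_fst.sub contDiffOn_const))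
  let Ω : Set (ℂ × ℝ) := S ∩ P ⁻¹' V
  have hΩ : IsOpen Ω := hPS.continuousOn.isOpen_inter_preimage hS hV
  have hF : ContDiffOn ℝ (⊤ : ℕ∞) F Ω :=
    (contDiffOn_const.sub (hτS.mono inter_subset_left)).mul
      ((hg.comp (hPS.mono inter_subset_left) fun x hx => hx.2).mul (hσS.mono inter_subset_left))
  have hsub : V ×ˢ uIcc (0 : ℝ) 1 ⊆ Ω := by
    rintro ⟨z, s⟩ ⟨hz, hs⟩
    refine ⟨⟨hz, mem_univ _⟩, hseg z hz _ ?_⟩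
    rw [uIcc_of_le zero_le_one] at hs
    rw [← segment_eq_uIcc]
    refine ⟨1 - s, s, by linarith [hs.2], hs.1, by ring, ?_⟩
    simp only [σ, smul_eq_mul]
    ring
  have hA : ContDiffOn ℝ (⊤ : ℕ∞) A V := contDiffOn_integral hV hΩ hsub hF
  have hA' : ∀ z, A z = ∫ u in τ z..1, g (p + u • (z - p)) * u := by
    intro z
    have := intervalIntegral.smul_integral_comp_add_mul (a := 0) (b := 1)
      (fun u : ℝ => g (p + u • (z - p)) * u) (1 - τ z) (τ z)
    rw [mul_zero, add_zero, mul_one, add_sub_cancel] at this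
    rw [← this, smul_eq_mul, ← intervalIntegral.integral_const_mul]
  -- `r² A(p + r w)` is the integral of `t g(p + t w)` from `τ` to `r`
  have hscale : ∀ (w : ℂ) (r : ℝ), 0 < r →
      r ^ 2 * A (p + r • w) = ∫ t in τ (p + w)..r, g (p + t • w) * t := by
    intro w r hr
    have := intervalIntegral.smul_integral_comp_mul_left (a := τ (p + w) / r) (b := 1)
      (fun t : ℝ => g (p + t • w) * t) r
    rw [mul_div_cancel₀ _ hr.ne', mul_one] at this
    rw [hA', hhom w r hr, ← this, pow_two, mul_assoc, ← intervalIntegral.integral_const_mul,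
      smul_eq_mul]
    congr 1
    refine intervalIntegral.integral_congr fun t _ => ?_
    simp only [add_sub_cancel_left, smul_smul, mul_comm t r]
    ring
  refine ⟨fun z => A z • rotForm p z, hA.smul (contDiff_rotForm p).contDiffOn, fun z hz => ?_⟩
  have hL : HasFDerivAt A (fderiv ℝ A z) z :=
    ((hA.differentiableOn (by simp) z hz).differentiableAt (hV.mem_nhds hz)).hasFDerivAt
  rw [extDeriv_smul_rotForm hL]
  have hz' : p + (1 : ℝ) • (z - p) = z := by simp
  let O : Set ℝ := (fun t : ℝ => p + t • (z - p)) ⁻¹' V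
  have hO : IsOpen O := hV.preimage (by fun_prop)
  have hG : ContinuousOn (fun t : ℝ => g (p + t • (z - p)) * t) O :=
    (hg.continuousOn.comp (f := fun t : ℝ => p + t • (z - p)) (by fun_prop)
      fun t ht => ht).mul continuousOn_id
  have h1O : (1 : ℝ) ∈ O := by
    show p + (1 : ℝ) • (z - p) ∈ V
    rwa [hz']
  have d1 : HasDerivAt (fun r => ∫ t in τ z..r, g (p + t • (z - p)) * t) (g z) 1 := by
    have := intervalIntegral.integral_hasDerivAt_right
      ((hG.mono fun t ht => hseg z hz t ht).intervalIntegrable)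
      (hG.stronglyMeasurableAtFilter hO 1 h1O) (hG.continuousAt (hO.mem_nhds h1O))
    rwa [hz', mul_one] at this
  have d2 : HasDerivAt (fun r : ℝ => r ^ 2 * A (p + r • (z - p)))
      (2 * A z + fderiv ℝ A z (z - p)) 1 := by
    have hc : HasDerivAt (fun r : ℝ => p + r • (z - p)) (z - p) 1 := by
      simpa using! ((hasDerivAt_id (1 : ℝ)).smul_const (z - p)).const_add p
    have hL' : HasFDerivAt A (fderiv ℝ A z) (p + (1 : ℝ) • (z - p)) := by rwa [hz']
    have := ((hasDerivAt_id (1 : ℝ)).pow 2).mul (hL'.comp_hasDerivAt (1 : ℝ) hc)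
    rw [Function.comp_apply, hz'] at this
    have e : 2 * A z + fderiv ℝ A z (z - p) =
        ((2 : ℕ) : ℝ) * id (1 : ℝ) ^ (2 - 1) * 1 * A z +
          ((id : ℝ → ℝ) ^ 2) 1 * fderiv ℝ A z (z - p) := by
      simp
    rw [e]
    exact this
  refine d2.unique (d1.congr_of_eventuallyEq ?_)
  filter_upwards [lt_mem_nhds (zero_lt_one' ℝ)] with r hr
  have := hscale (z - p) r hr
  rwa [add_sub_cancel] at this

/-- Radial integration from the centre of the disc. -/
theorem exists_primitive_disc {g : ℂ → ℝ} (hg : ContDiffOn ℝ (⊤ : ℕ∞) g (Metric.ball 0 1)) :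
    ∃ η : ℂ → ℂ [⋀^Fin 1]→L[ℝ] ℝ, ContDiffOn ℝ (⊤ : ℕ∞) η (Metric.ball 0 1) ∧
      ∀ z ∈ Metric.ball (0 : ℂ) 1, extDeriv η z ![1, Complex.I] = g z := by
  refine exists_primitive_of_radial (p := 0) (τ := 0) Metric.isOpen_ball contDiffOn_const hg
    (fun w r _ => by simp) fun z hz u hu => ?_
  rw [Pi.zero_apply, uIcc_of_le zero_le_one] at hu
  rw [zero_add, sub_zero, mem_ball_zero_iff, norm_smul, Real.norm_of_nonneg hu.1]
  rw [mem_ball_zero_iff] at hz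
  exact (mul_le_of_le_one_left (norm_nonneg z) hu.2).trans_lt hz

/-- Radial integration from a small circle around the puncture. -/
theorem exists_primitive_punctured {p : ℂ} (hp : ‖p‖ < 1) {g : ℂ → ℝ}
    (hg : ContDiffOn ℝ (⊤ : ℕ∞) g (Metric.ball 0 1 ∩ {z | z ≠ p})) :
    ∃ η : ℂ → ℂ [⋀^Fin 1]→L[ℝ] ℝ, ContDiffOn ℝ (⊤ : ℕ∞) η (Metric.ball 0 1 ∩ {z | z ≠ p}) ∧
      ∀ z ∈ Metric.ball 0 1 ∩ {z | z ≠ p}, extDeriv η z ![1, Complex.I] = g z := by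
  obtain ⟨c, hc, hc1⟩ : ∃ c : ℝ, 0 < c ∧ ‖p‖ + c < 1 := ⟨(1 - ‖p‖) / 2, by linarith, by linarith⟩
  refine exists_primitive_of_radial (p := p) (τ := fun z => c / ‖z - p‖)
    (Metric.isOpen_ball.inter isOpen_ne) (fun z hz => ?_) hg (fun w r hr => ?_)
    fun z hz u hu => ?_
  · have hne : z - p ≠ 0 := sub_ne_zero.2 hz.2
    exact (contDiffAt_const.div ((contDiffAt_id.sub contDiffAt_const).norm ℝ hne)
      (norm_ne_zero_iff.2 hne)).contDiffWithinAt
  · simp only [add_sub_cancel_left, norm_smul, Real.norm_of_nonneg hr.le]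
    rw [div_div, mul_comm]
  · have hne : z - p ≠ 0 := sub_ne_zero.2 hz.2
    have hpos : 0 < ‖z - p‖ := norm_pos_iff.2 hne
    have hu0 : 0 < u := lt_of_lt_of_le (lt_min (div_pos hc hpos) one_pos) hu.1
    refine ⟨?_, fun e => ?_⟩
    · rw [mem_ball_zero_iff]
      rcases le_max_iff.1 hu.2 with h | h
      · calc ‖p + u • (z - p)‖ ≤ ‖p‖ + ‖u • (z - p)‖ := norm_add_le _ _
          _ ≤ ‖p‖ + c := by
            rw [norm_smul, Real.norm_of_nonneg hu0.le]
            gcongr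
            exact (le_div_iff₀ hpos).1 h
          _ < 1 := hc1
      · have := (convex_ball (0 : ℂ) 1).add_smul_sub_mem (x := p) (y := z)
          (by simpa using hp) hz.1 ⟨hu0.le, h⟩
        simpa using this
    · rcases smul_eq_zero.1 (add_eq_left.1 e) with h | h
      · exact hu0.ne' h
      · exact hne h

/-- Smooth functions `χ_0, χ_1, …, χ_n` with sum `1`, such that `χ_0` vanishes near all the points
`p_j`, and `χ_i` vanishes near `p_j` for `j ≠ i`. -/
theorem exists_cutoffs {n : ℕ} {p : Fin n → ℂ} (hp : Function.Injective p) :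
    ∃ χ : Option (Fin n) → ℂ → ℝ, (∀ o, ContDiff ℝ (⊤ : ℕ∞) (χ o)) ∧ (∀ z, ∑ o, χ o z = 1) ∧
      ∀ o j, o ≠ some j → χ o =ᶠ[nhds (p j)] 0 := by
  classical
  have hr : ∃ r > 0, ∀ i j, i ≠ j → r < dist (p i) (p j) := by
    have : ∀ᶠ r in nhdsWithin (0 : ℝ) (Ioi 0), ∀ i j, i ≠ j → r < dist (p i) (p j) := by
      simp only [Filter.eventually_all]
      exact fun i j hij => nhdsWithin_le_nhds (gt_mem_nhds (dist_pos.2 (hp.ne hij)))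
    obtain ⟨r, hr, hr0⟩ := (this.and self_mem_nhdsWithin).exists
    exact ⟨r, hr0, hr⟩
  obtain ⟨r, hr0, hr⟩ := hr
  let B : ∀ i, ContDiffBump (p i) := fun i => ⟨r / 2, r, by linarith, by linarith⟩
  have hfar : ∀ i j, i ≠ j → (fun z => B i z) =ᶠ[nhds (p j)] 0 := by
    intro i j hij
    have : ∀ᶠ z in nhds (p j), r < dist z (p i) :=
      (isOpen_lt continuous_const (continuous_id.dist continuous_const)).mem_nhds (hr j i hij.symm)
    filter_upwards [this] with z hz
    exact (B i).zero_of_le_dist hz.le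
  refine ⟨fun o z => o.elim (1 - ∑ i, B i z) fun i => B i z, fun o => ?_, fun z => ?_,
    fun o j hoj => ?_⟩
  · rcases o with _ | i
    · exact contDiff_const.sub (ContDiff.sum fun i _ => (B i).contDiff)
    · exact (B i).contDiff
  · simp [Fintype.sum_option]
  · rcases o with _ | i
    · have hall : ∀ᶠ z in nhds (p j), ∀ i, i ≠ j → B i z = 0 := by
        simp only [Filter.eventually_all]
        exact fun i hij => hfar i j hij
      filter_upwards [hall, (B j).eventuallyEq_one] with z hz h1
      show 1 - ∑ i, B i z = 0
      rw [Finset.sum_eq_single j (fun i _ hij => hz i hij) (by simp), h1]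
      simp
    · exact hfar i j fun e => hoj (e ▸ rfl)

/-- All smooth `2`-forms on the punctured disc are exact. A partition of unity reduces this to forms
that extend smoothly to all punctures but one. -/
theorem exists_primitive_twoForm {n : ℕ} {p : Fin n → ℂ} (hp : Function.Injective p)
    (hdisc : ∀ i, ‖p i‖ < 1) {θ : ℂ → ℂ [⋀^Fin 2]→L[ℝ] ℝ}
    (hθ : ContDiffOn ℝ (⊤ : ℕ∞) θ (puncturedDisc p)) :
    ∃ η : ℂ → ℂ [⋀^Fin 1]→L[ℝ] ℝ, ContDiffOn ℝ (⊤ : ℕ∞) η (puncturedDisc p) ∧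
      ∀ z ∈ puncturedDisc p, θ z = extDeriv η z := by
  obtain ⟨χ, hχ, hsum, hzero⟩ := exists_cutoffs hp
  have hU := isOpen_puncturedDisc p
  let g : Option (Fin n) → ℂ → ℝ := fun o z => χ o z * θ z ![1, Complex.I]
  have hf : ContDiffOn ℝ (⊤ : ℕ∞) (fun z => θ z ![1, Complex.I]) (puncturedDisc p) :=
    (ContinuousAlternatingMap.apply ℝ ℂ ℝ ![1, Complex.I]).contDiff.comp_contDiffOn hθ
  have hg : ∀ o, ∀ z ∈ Metric.ball (0 : ℂ) 1, (∀ j, o = some j → z ≠ p j) →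
      ContDiffAt ℝ (⊤ : ℕ∞) (g o) z := by
    intro o z hz ho
    by_cases hzU : ∃ j, z = p j
    · obtain ⟨j, rfl⟩ := hzU
      have h0 : g o =ᶠ[nhds (p j)] fun _ => 0 := by
        filter_upwards [hzero o j fun e => ho j e rfl] with y hy
        simp [g, hy]
      exact contDiffAt_const.congr_of_eventuallyEq h0
    · have hz' : z ∈ puncturedDisc p := ⟨by simpa using hz, fun j e => hzU ⟨j, e⟩⟩
      exact (hχ o).contDiffAt.mul (hf.contDiffAt (hU.mem_nhds hz'))
  have hex : ∀ o, ∃ η : ℂ → ℂ [⋀^Fin 1]→L[ℝ] ℝ, ContDiffOn ℝ (⊤ : ℕ∞) η (puncturedDisc p) ∧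
      ∀ z ∈ puncturedDisc p, extDeriv η z ![1, Complex.I] = g o z := by
    rintro (_ | i)
    · obtain ⟨η, h1, h2⟩ := exists_primitive_disc fun z hz =>
        (hg none z hz (by simp)).contDiffWithinAt
      have hsub : puncturedDisc p ⊆ Metric.ball 0 1 := fun z hz => by simpa using hz.1
      exact ⟨η, h1.mono hsub, fun z hz => h2 z (hsub hz)⟩
    · obtain ⟨η, h1, h2⟩ := exists_primitive_punctured (hdisc i) fun z hz =>
        (hg (some i) z hz.1 (fun j e => by
          obtain rfl := Option.some_injective _ e
          exact hz.2)).contDiffWithinAt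
      have hsub : puncturedDisc p ⊆ Metric.ball 0 1 ∩ {z | z ≠ p i} :=
        fun z hz => ⟨by simpa using hz.1, hz.2 i⟩
      exact ⟨η, h1.mono hsub, fun z hz => h2 z (hsub hz)⟩
  choose η hη hdη using hex
  refine ⟨fun z => ∑ o, (1 : ℝ) • η o z, ContDiffOn.sum fun o _ => (hη o).const_smul 1,
    fun z hz => eq_of_apply_one_I ?_⟩
  rw [extDeriv_sum (fun o => ((hη o).differentiableOn (by simp) z hz).differentiableAt
    (hU.mem_nhds hz)) fun _ => 1]
  simp only [ContinuousAlternatingMap.sum_apply, one_smul, hdη _ z hz, g]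
  rw [← Finset.sum_mul, hsum, one_mul]

end TwoForms

/-! ### Dual systems of forms -/

section DualSystems

open Set

variable {U : Set ℂ} {x₀ : U}

/-- The periods of a closed form, as a homomorphism on the fundamental group. -/
def periodHom (hU : IsOpen U) {θ : ℂ → ℂ [⋀^Fin 1]→L[ℝ] ℝ} (hθ : ContDiffOn ℝ (⊤ : ℕ∞) θ U)
    (hcl : ∀ z ∈ U, extDeriv θ z = 0) (x₀ : U) : LoopGroup U x₀ →* Multiplicative ℝ :=
  MonoidHom.mk' (fun g => Multiplicative.ofAdd (period hU θ g.unop.toPath)) fun g g' =>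
    congrArg Multiplicative.ofAdd (period_trans hU hθ hcl g.unop.toPath g'.unop.toPath)

/-- Periods are additive, so that it suffices to know them on generators. -/
theorem period_eq_zero_of_generators (hU : IsOpen U) {θ : ℂ → ℂ [⋀^Fin 1]→L[ℝ] ℝ}
    (hθ : ContDiffOn ℝ (⊤ : ℕ∞) θ U) (hcl : ∀ z ∈ U, extDeriv θ z = 0) {ι : Type}
    {g : ι → LoopGroup U x₀} (hg : Subgroup.closure (range g) = ⊤)
    (h : ∀ i, period hU θ (g i).unop.toPath = 0) (δ : Path.Homotopic.Quotient x₀ x₀) :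
    period hU θ δ = 0 := by
  have heq : periodHom hU hθ hcl x₀ = 1 := by
    refine MonoidHom.eq_of_eqOn_dense hg ?_
    rintro _ ⟨i, rfl⟩
    exact congrArg Multiplicative.ofAdd (h i)
  exact congrArg Multiplicative.toAdd
    (DFunLike.congr_fun heq (MulOpposite.op (FundamentalGroup.fromPath δ)))

/-- A closed form whose periods over generators of the fundamental group vanish is the
differential of a smooth function. -/
theorem exists_smooth_primitive (hU : IsOpen U) (hconn : IsPathConnected U)
    {θ : ℂ → ℂ [⋀^Fin 1]→L[ℝ] ℝ} (hθ : ContDiffOn ℝ (⊤ : ℕ∞) θ U)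
    (hcl : ∀ z ∈ U, extDeriv θ z = 0) {ι : Type} {g : ι → LoopGroup U x₀}
    (hg : Subgroup.closure (range g) = ⊤) (h : ∀ i, period hU θ (g i).unop.toPath = 0) :
    ∃ f : ℂ → ℝ, ContDiffOn ℝ (⊤ : ℕ∞) f U ∧ ∀ z ∈ U, HasFDerivAt f (oneFormCLM (θ z)) z := by
  obtain ⟨f, hf⟩ := exists_primitive_of_period_eq_zero hU hconn hθ hcl x₀
    (period_eq_zero_of_generators hU hθ hcl hg h)
  refine ⟨f, (contDiffOn_infty_iff_fderiv_of_isOpen hU).2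
    ⟨fun z hz => (hf z hz).differentiableAt.differentiableWithinAt, ?_⟩, hf⟩
  exact (contDiffOn_oneFormCLM hθ).congr fun z hz => (hf z hz).fderiv

/-- For every family of `n` generators of the fundamental group of the disc with `n` punctures
there is a dual flat system: a linear combination of the standard forms is determined by its periods
over the generators, so that the matrix of these periods is invertible. -/
theorem exists_dual_isFlatSystem {n : ℕ} {p : Fin n → ℂ} {q : ℂ} {ε : ℝ}
    (hdisc : ∀ i, ‖p i‖ < 1) {x₀ : puncturedDisc p} (h : IsSlitCentre p x₀ q ε)
    {g : Fin n → LoopGroup (puncturedDisc p) x₀} (hg : Subgroup.closure (range g) = ⊤) :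
    ∃ ω, IsFlatSystem ω (puncturedDisc p) ∧ ∀ i j,
      period (isOpen_puncturedDisc p) (ω i) (g j).unop.toPath = if i = j then 1 else 0 := by
  have hU := isOpen_puncturedDisc p
  have hstd := h.isFlatSystem_coneForm
  let M : Matrix (Fin n) (Fin n) ℝ := fun i j => period hU (coneForm q (p i) ε) (g j).unop.toPath
  have hper : ∀ (c : Fin n → ℝ) j,
      period hU (fun z => ∑ i, c i • coneForm q (p i) ε z) (g j).unop.toPath =
        Matrix.vecMul c M j :=
    fun c j => period_sum hU c (fun i => (hstd.smooth i).continuousOn) _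
  have hM : IsUnit M := by
    rw [← Matrix.vecMul_injective_iff_isUnit]
    have hker : ∀ c, Matrix.vecMul c M = 0 → c = 0 := by
      intro c hc
      have hflat := hstd.linearCombination hU (fun _ : Unit => c)
      obtain ⟨f, -, hf⟩ := exists_smooth_primitive hU (isPathConnected_puncturedDisc h hdisc)
        (hflat.smooth ()) (hflat.closed ()) hg fun j => by rw [hper, hc]; rfl
      exact funext (h.coeff_eq_zero hdisc hf)
    intro c c' hcc
    refine sub_eq_zero.1 (hker _ ?_)
    rw [Matrix.sub_vecMul, sub_eq_zero]
    exact hcc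
  refine ⟨fun i z => ∑ k, M⁻¹ i k • coneForm q (p k) ε z, hstd.linearCombination hU (M⁻¹ : Matrix _ _ ℝ),
    fun i j => ?_⟩
  have := congrFun (congrFun (Matrix.nonsing_inv_mul M ((Matrix.isUnit_iff_isUnit_det M).1 hM)) i) j
  rw [Matrix.one_apply] at this
  rw [hper, ← this]
  rfl

/-- Elements of the fundamental group that have a dual flat system generate a free group, on which
the holonomy of the system is faithful: the holonomy of the `i`-th element has the leading terms
`1 + X_i`. -/
theorem holonomy_comp_injective (hU : IsOpen U) {n : ℕ}
    {ω : Fin n → ℂ → ℂ [⋀^Fin 1]→L[ℝ] ℝ} (h : IsFlatSystem ω U) {g : Fin n → LoopGroup U x₀}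
    (hdual : ∀ i j, period hU (ω i) (g j).unop.toPath = if i = j then 1 else 0) :
    Function.Injective ((holonomy hU h x₀).comp (FreeGroup.lift g)) := by
  refine injective_of_leading_terms _ (fun i => ?_) fun i j => ?_
  · exact classTransport_coeff_nil hU _
  · rw [MonoidHom.comp_apply, FreeGroup.lift_apply_of]
    refine (classTransport_coeff_singleton hU _ _).trans ((hdual j i).trans ?_)
    simp only [eq_comm]

/-- The isomorphism from the free group onto the fundamental group that is determined by generators
with a dual flat system. -/
def freeGroupEquiv (hU : IsOpen U) {n : ℕ} {ω : Fin n → ℂ → ℂ [⋀^Fin 1]→L[ℝ] ℝ}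
    (h : IsFlatSystem ω U) {g : Fin n → LoopGroup U x₀} (hg : Subgroup.closure (range g) = ⊤)
    (hdual : ∀ i j, period hU (ω i) (g j).unop.toPath = if i = j then 1 else 0) :
    FreeGroup (Fin n) ≃* LoopGroup U x₀ :=
  MulEquiv.ofBijective (FreeGroup.lift g)
    ⟨Function.Injective.of_comp (f := holonomy hU h x₀)
      (holonomy_comp_injective hU h hdual),
      MonoidHom.range_eq_top.1 (by rw [FreeGroup.range_lift_eq_closure, hg])⟩

theorem closure_range_of {n : ℕ} (e : FreeGroup (Fin n) ≃* LoopGroup U x₀) :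
    Subgroup.closure (range fun i => e (FreeGroup.of i)) = ⊤ := by
  have : (range fun i => e (FreeGroup.of i)) = e.toMonoidHom '' range FreeGroup.of := by
    rw [← range_comp]
    rfl
  rw [this, ← MonoidHom.map_closure, FreeGroup.closure_range_of, ← MonoidHom.range_eq_map]
  exact MonoidHom.range_eq_top.2 e.surjective

theorem lift_of_eq {n : ℕ} (e : FreeGroup (Fin n) ≃* LoopGroup U x₀) :
    FreeGroup.lift (fun i => e (FreeGroup.of i)) = e.toMonoidHom :=
  FreeGroup.ext_hom _ _ fun _ => FreeGroup.lift_apply_of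

theorem iterIntFrom_map {n : ℕ} (ω : Fin n → ℂ → ℂ [⋀^Fin 1]→L[ℝ] ℝ) (γ : Path x₀ x₀)
    (w : List (Fin n)) (s : ℝ) :
    iterIntFrom γ (w.map ω) s = chenIter ω (pathCurve γ) 1 w s := by
  induction w generalizing s with
  | nil => rfl
  | cons i w ih =>
    simp only [List.map_cons, iterIntFrom, chenIter, ih]
    rfl

theorem iterInt_map {n : ℕ} (ω : Fin n → ℂ → ℂ [⋀^Fin 1]→L[ℝ] ℝ) (γ : Path x₀ x₀)
    (w : List (Fin n)) : iterInt γ (w.map ω) = (chen ω (pathCurve γ) 0 1).coeff w :=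
  iterIntFrom_map ω γ w 0

theorem iterInt_eq_period (hU : IsOpen U) {n : ℕ} {ω : Fin n → ℂ → ℂ [⋀^Fin 1]→L[ℝ] ℝ}
    (h : IsFlatSystem ω U) {γ : Path x₀ x₀} (hγ : PiecewiseSmooth γ) (i : Fin n) :
    iterInt γ [ω i] = period hU (ω i) (loopClass γ).unop.toPath := by
  have h1 := iterInt_map ω γ [i]
  rw [← holonomy_loopClass hU h hγ] at h1
  exact h1.trans (classTransport_coeff_singleton hU _ _)

theorem IsDualFlatSystem.isFlatSystem {n : ℕ} {ω : Fin n → ℂ → ℂ [⋀^Fin 1]→L[ℝ] ℝ}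
    {g : Fin n → LoopGroup U x₀} (h : IsDualFlatSystem g ω) : IsFlatSystem ω U :=
  ⟨h.smooth, h.closed, h.wedge⟩

theorem IsDualFlatSystem.period_eq (hU : IsOpen U) {n : ℕ}
    {ω : Fin n → ℂ → ℂ [⋀^Fin 1]→L[ℝ] ℝ} {g : Fin n → LoopGroup U x₀}
    (h : IsDualFlatSystem g ω) (i j : Fin n) :
    period hU (ω i) (g j).unop.toPath = if i = j then 1 else 0 := by
  obtain ⟨γ, hγ, e⟩ := exists_piecewiseSmooth hU (g j)
  rw [← e, ← iterInt_eq_period hU h.isFlatSystem hγ, h.dual i j γ hγ e]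

theorem IsFlatSystem.isDualFlatSystem (hU : IsOpen U) {n : ℕ}
    {ω : Fin n → ℂ → ℂ [⋀^Fin 1]→L[ℝ] ℝ} (h : IsFlatSystem ω U) {g : Fin n → LoopGroup U x₀}
    (hdual : ∀ i j, period hU (ω i) (g j).unop.toPath = if i = j then 1 else 0) :
    IsDualFlatSystem g ω where
  smooth := h.smooth
  closed := h.closed
  wedge := h.wedge
  dual i j γ hγ e := by rw [iterInt_eq_period hU h hγ, e, hdual]

end DualSystems

/-! ### The connection `∑ ω_i X_i` -/

section LinearConnection

open Set

variable {n : ℕ} {U : Set ℂ} {x₀ : U} {ω : Fin n → ℂ → ℂ [⋀^Fin 1]→L[ℝ] ℝ}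

theorem linearForm_singleton (ω : Fin n → ℂ → ℂ [⋀^Fin 1]→L[ℝ] ℝ) (i : Fin n) :
    linearForm ω [i] 1 = ω i := by
  simp [linearForm]

theorem linearForm_eq_zero (ω : Fin n → ℂ → ℂ [⋀^Fin 1]→L[ℝ] ℝ) {w : List (Fin n)} {q : ℕ}
    (h : ¬(w.length = 1 ∧ q = 1)) : linearForm ω w q = 0 := by
  match w with
  | [] => rfl
  | [i] =>
    have hq : q ≠ 1 := fun e => h ⟨rfl, e⟩
    simp [linearForm, hq]
  | _ :: _ :: _ => rfl

theorem wordDeg_one {ι : Type} {d : ι → ℕ} (hd : ∀ i, d i = 1) (w : List ι) : wordDeg d w = 0 := by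
  simp [wordDeg, hd]

theorem extDeriv_zero_fun {k : ℕ} (z : ℂ) :
    extDeriv (0 : ℂ → ℂ [⋀^Fin k]→L[ℝ] ℝ) z = 0 := by
  have := extDeriv_smul (x := z) (0 : ℝ) (0 : ℂ → ℂ [⋀^Fin k]→L[ℝ] ℝ)
  rwa [zero_smul, zero_smul] at this

/-- The curvature term `ε(ω) ∧ ω` of the connection vanishes: its coefficient at `X_i X_j` is
`- ω_i ∧ ω_j`. -/
theorem IsFlatSystem.wedgeApply_eq_zero (h : IsFlatSystem ω U) (u w : List (Fin n)) (q : ℕ)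
    {x : ℂ} (hx : x ∈ U) (v : Fin q → ℂ) :
    wedgeApply (epsForm (linearForm ω u)) (linearForm ω w) q x v = 0 := by
  refine Finset.sum_eq_zero fun a _ => ?_
  obtain ⟨a, ha⟩ := a
  by_cases h1 : u.length = 1 ∧ a = 1
  swap
  · simp [epsForm, linearForm_eq_zero ω h1]
  by_cases h2 : w.length = 1 ∧ q - a = 1
  swap
  · simp [linearForm_eq_zero ω h2]
  obtain ⟨hu, rfl⟩ := h1
  obtain ⟨hw, hq⟩ := h2
  obtain rfl : q = 2 := by omega
  obtain ⟨i, rfl⟩ := List.length_eq_one_iff.1 hu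
  obtain ⟨j, rfl⟩ := List.length_eq_one_iff.1 hw
  -- the sum over the permutations is a determinant
  let M : Matrix (Fin 2) (Fin 2) ℝ := fun r c => if c = 0 then -(ω i x ![v r]) else ω j x ![v r]
  have hM : M.det = 0 := by
    rw [Matrix.det_fin_two]
    simp only [M, if_true, one_ne_zero, if_false]
    linear_combination -h.wedge i j x hx (v 0) (v 1)
  rw [Matrix.det_apply'] at hM
  rw [mul_eq_zero]
  refine Or.inr (Eq.trans (Finset.sum_congr rfl fun σ _ => ?_) hM)
  have e1 : epsForm (linearForm ω [i]) 1 x (fun k : Fin 1 => v (σ ⟨k.1, by omega⟩)) =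
      -(ω i x ![v (σ 0)]) := by
    have : (fun k : Fin 1 => v (σ ⟨k.1, by omega⟩)) = ![v (σ 0)] := by
      funext k
      fin_cases k
      rfl
    rw [this]
    simp [epsForm, linearForm_singleton]
  have e2 : linearForm ω [j] 1 x (fun k : Fin 1 => v (σ ⟨1 + k.1, by omega⟩)) =
      ω j x ![v (σ 1)] := by
    have : (fun k : Fin 1 => v (σ ⟨1 + k.1, by omega⟩)) = ![v (σ 1)] := by
      funext k
      fin_cases k
      rfl
    rw [this, linearForm_singleton]
  rw [Fin.prod_univ_two]
  simp only [M, if_true, one_ne_zero, if_false]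
  rw [← e1, ← e2]

theorem zeroForm_eq_constOfIsEmpty (η : ℂ → ℂ [⋀^Fin 0]→L[ℝ] ℝ) :
    η = fun z => ContinuousAlternatingMap.constOfIsEmpty ℝ ℂ (Fin 0) (η z ![]) := by
  funext z
  ext v
  simp [Subsingleton.elim v ![]]

/-- The classes of the forms of a dual system are linearly independent. -/
theorem IsFlatSystem.coeff_eq_zero_of_exact (hU : IsOpen U) (h : IsFlatSystem ω U)
    {g : Fin n → LoopGroup U x₀}
    (hdual : ∀ i j, period hU (ω i) (g j).unop.toPath = if i = j then 1 else 0) {c : Fin n → ℝ}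
    {η : ℂ → ℂ [⋀^Fin 0]→L[ℝ] ℝ} (hη : ContDiffOn ℝ (⊤ : ℕ∞) η U)
    (he : ∀ x ∈ U, ∑ i, c i • ω i x = extDeriv η x) (j : Fin n) : c j = 0 := by
  have hf : ContDiffOn ℝ (⊤ : ℕ∞) (fun z => η z ![]) U :=
    (ContinuousAlternatingMap.apply ℝ ℂ ℝ ![]).contDiff.comp_contDiffOn hη
  have h1 := period_of_primitive (x := x₀) (y := x₀) hU
    (θ := fun z => ∑ i, c i • ω i z) (f := fun z => η z ![])
    ((h.linearCombination hU (fun _ : Unit => c)).smooth ()).continuousOn (fun z hz => by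
      rw [he z hz, zeroForm_eq_constOfIsEmpty η, ← exactForm_eq_extDeriv, oneFormCLM_exactForm]
      exact ((hf.differentiableOn (by simp) z hz).differentiableAt (hU.mem_nhds hz)).hasFDerivAt)
    (g j).unop.toPath
  rw [period_sum hU c fun i => (h.smooth i).continuousOn, sub_self] at h1
  simpa [hdual] using h1

/-- The classes of the forms of a dual system span the first de Rham cohomology. -/
theorem IsFlatSystem.exists_eq_sum_add_exact (hU : IsOpen U) (hconn : IsPathConnected U)
    (h : IsFlatSystem ω U) {g : Fin n → LoopGroup U x₀} (hg : Subgroup.closure (range g) = ⊤)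
    (hdual : ∀ i j, period hU (ω i) (g j).unop.toPath = if i = j then 1 else 0)
    {θ : ℂ → ℂ [⋀^Fin 1]→L[ℝ] ℝ} (hθ : ContDiffOn ℝ (⊤ : ℕ∞) θ U)
    (hcl : ∀ z ∈ U, extDeriv θ z = 0) :
    ∃ (c : Fin n → ℝ) (η : ℂ → ℂ [⋀^Fin 0]→L[ℝ] ℝ), ContDiffOn ℝ (⊤ : ℕ∞) η U ∧
      ∀ x ∈ U, θ x = ∑ i, c i • ω i x + extDeriv η x := by
  let c : Fin n → ℝ := fun i => period hU θ (g i).unop.toPath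
  have hsum := h.linearCombination hU (fun _ : Unit => c)
  have hdiff : ∀ z ∈ U, extDeriv (fun z => θ z - ∑ i, c i • ω i z) z = 0 := by
    intro z hz
    have hd : ∀ {φ : ℂ → ℂ [⋀^Fin 1]→L[ℝ] ℝ}, ContDiffOn ℝ (⊤ : ℕ∞) φ U →
        DifferentiableAt ℝ φ z := fun hφ =>
      (hφ.differentiableOn (by simp) z hz).differentiableAt (hU.mem_nhds hz)
    have e1 : (fun z => θ z - ∑ i, c i • ω i z) =
        fun z => θ z + (-1 : ℝ) • ∑ i, c i • ω i z := by
      funext z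
      module
    have e2 : extDeriv (fun z => (-1 : ℝ) • ∑ i, c i • ω i z) z =
        (-1 : ℝ) • extDeriv (fun z => ∑ i, c i • ω i z) z :=
      extDeriv_smul (-1 : ℝ) fun z => ∑ i, c i • ω i z
    rw [e1, extDeriv_fun_add (hd hθ) (hd ((hsum.smooth ()).const_smul (-1 : ℝ))), e2, hcl z hz,
      hsum.closed () z hz, smul_zero, add_zero]
  obtain ⟨f, hfs, hf⟩ := exists_smooth_primitive hU hconn (hθ.sub (hsum.smooth ())) hdiff hg
    fun j => by
      rw [period_sub hU hθ.continuousOn (hsum.smooth ()).continuousOn,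
        period_sum hU c fun i => (h.smooth i).continuousOn]
      simp [hdual, c]
  refine ⟨c, fun z => ContinuousAlternatingMap.constOfIsEmpty ℝ ℂ (Fin 0) (f z),
    fun z hz => (contDiffAt_constOfIsEmpty (hfs.contDiffAt (hU.mem_nhds hz))).contDiffWithinAt,
    fun z hz => ?_⟩
  rw [← exactForm_eq_extDeriv, ← sub_eq_iff_eq_add']
  apply oneFormCLM_injective
  rw [oneFormCLM_exactForm, (hf z hz).fderiv]

/-- The formal homology connection `(∑ ω_i X_i, 0)` of a flat system that is dual to generators of
the fundamental group, on an open set with vanishing second cohomology. -/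
def linearConnection (hU : IsOpen U) (hconn : IsPathConnected U)
    (hexact : ∀ θ : ℂ → ℂ [⋀^Fin 2]→L[ℝ] ℝ, ContDiffOn ℝ (⊤ : ℕ∞) θ U →
      ∃ η : ℂ → ℂ [⋀^Fin 1]→L[ℝ] ℝ, ContDiffOn ℝ (⊤ : ℕ∞) η U ∧ ∀ z ∈ U, θ z = extDeriv η z)
    (h : IsFlatSystem ω U) {g : Fin n → LoopGroup U x₀} (hg : Subgroup.closure (range g) = ⊤)
    (hdual : ∀ i j, period hU (ω i) (g j).unop.toPath = if i = j then 1 else 0) :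
    FormalHomologyConnection U (Fin n) where
  hdeg _ := 1
  ω := linearForm ω
  δ := 0
  hdeg_pos _ := one_pos
  smooth w q := by
    by_cases hw : w.length = 1 ∧ q = 1
    · obtain ⟨hw, rfl⟩ := hw
      obtain ⟨i, rfl⟩ := List.length_eq_one_iff.1 hw
      rw [linearForm_singleton]
      exact h.smooth i
    · rw [linearForm_eq_zero ω hw]
      exact contDiffOn_const
  ω_nil q x _ := rfl
  ω_deg w q hq x _ := by
    rw [wordDeg_one (fun _ => rfl)] at hq
    rw [linearForm_eq_zero ω fun hw => hq hw.2]
    rfl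
  indep q c η hη he i hq := by
    obtain rfl : q = 0 := by omega
    refine h.coeff_eq_zero_of_exact hU hdual hη (fun x hx => ?_) i
    rw [← he x hx]
    exact Finset.sum_congr rfl fun i _ => by rw [← linearForm_singleton ω i]
  span q θ hθ hcl := by
    match q with
    | 0 =>
      obtain ⟨c, η, hη, he⟩ := h.exists_eq_sum_add_exact hU hconn hg hdual hθ hcl
      refine ⟨c, η, hη, fun x hx => ?_⟩
      rw [he x hx]
      exact congrArg (· + _) (Finset.sum_congr rfl fun i _ => by rw [← linearForm_singleton ω i])
    | 1 =>
      obtain ⟨η, hη, he⟩ := hexact θ hθ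
      exact ⟨0, η, hη, fun x hx => by simp [he x hx]⟩
    | q + 2 =>
      refine ⟨0, 0, contDiffOn_const, fun x _ => ?_⟩
      rw [form_eq_zero_of_two_lt (by omega) (θ x), extDeriv_zero_fun]
      simp
  δ_filt k f _ w _ := rfl
  δ_mul u v := by simp
  δ_deg u w _ := rfl
  δ_δ f := rfl
  δ_letter i w _ := rfl
  flat w q x hx v := by
    have hext : extDeriv (linearForm ω w q) x = 0 := by
      by_cases hw : w.length = 1 ∧ q = 1
      · obtain ⟨hw, rfl⟩ := hw
        obtain ⟨i, rfl⟩ := List.length_eq_one_iff.1 hw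
        rw [linearForm_singleton]
        exact h.closed i x hx
      · rw [linearForm_eq_zero ω hw]
        exact extDeriv_zero_fun x
    rw [hext, Finset.sum_eq_zero fun k _ => h.wedgeApply_eq_zero _ _ _ hx v]
    simp

theorem iterIntFrom_eq_zero (γ : Path x₀ x₀) {l : List (ℂ → ℂ [⋀^Fin 1]→L[ℝ] ℝ)} (h : 0 ∈ l)
    (s : ℝ) : iterIntFrom γ l s = 0 := by
  induction l generalizing s with
  | nil => simp at h
  | cons θ l ih =>
    rcases List.mem_cons.1 h with rfl | h
    · simp [iterIntFrom, pullbackCoeff]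
    · simp [iterIntFrom, ih h]

theorem splitWrtCompositionAux_replicate_one {α : Type} (w : List α) :
    w.splitWrtCompositionAux (List.replicate w.length 1) = w.map fun a => [a] := by
  induction w with
  | nil => rfl
  | cons a w ih =>
    rw [List.length_cons, List.replicate_succ, List.splitWrtCompositionAux_cons, List.map_cons]
    simpa using ih

/-- The transport of `∑ ω_i X_i` along a loop: the coefficient at `w` is the iterated integral of
the forms with the indices of the letters of `w`. -/
theorem transport_linearForm (C : FormalHomologyConnection U (Fin n)) (hC : C.ω = linearForm ω)
    (γ : Path x₀ x₀) : C.transport γ = chen ω (pathCurve γ) 0 1 := by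
  refine NCSeries.ext_coeff fun w => ?_
  rw [← iterInt_map, FormalHomologyConnection.transport, hC]
  show ∑ c : Composition w.length, _ = _
  rw [Finset.sum_eq_single (Composition.ones w.length)]
  · congr 1
    rw [List.splitWrtComposition, Composition.ones_blocks, splitWrtCompositionAux_replicate_one,
      List.map_map]
    exact List.map_congr_left fun i _ => linearForm_singleton ω i
  · intro c _ hc
    obtain ⟨k, hk, hk1⟩ := Composition.ne_ones_iff.1 hc
    rw [← List.map_length_splitWrtComposition, List.mem_map] at hk
    obtain ⟨u, hu, rfl⟩ := hk
    refine iterIntFrom_eq_zero γ (List.mem_map.2 ⟨u, hu, ?_⟩) 0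
    exact linearForm_eq_zero ω fun h => by omega
  · simp

end LinearConnection

/-! ### The holonomy ordering of a connection with `δ = 0` -/

section Coordinates

open Set

variable {U : Set ℂ} {x₀ : U} {n : ℕ} (C : FormalHomologyConnection U (Fin n))

theorem relations_eq_bot (hδ : C.δ = 0) : C.relations = ⊥ := by
  rw [FormalHomologyConnection.relations, hδ, LinearMap.range_zero, eq_bot_iff]
  intro f hf
  exact Subtype.ext ((Submodule.mem_bot ℝ).1 hf)

/-- The coefficient at `w`, as a linear functional on `R`. -/
def coordAt (hδ : C.δ = 0) (w : List (Fin n)) : C.R →ₗ[ℝ] ℝ :=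
  C.relations.liftQ
    { toFun := fun f => (f : NCSeries (Fin n)).coeff w
      map_add' := fun _ _ => rfl
      map_smul' := fun _ _ => rfl }
    (by rw [relations_eq_bot C hδ]; exact bot_le)

theorem coordAt_mkQ (hδ : C.δ = 0) (w : List (Fin n)) (f : C.degZero) :
    coordAt C hδ w (C.relations.mkQ f) = (f : NCSeries (Fin n)).coeff w :=
  rfl

theorem coeff_truncate (hdeg : ∀ i, C.hdeg i = 1) (f : NCSeries (Fin n)) :
    (C.truncate f : NCSeries (Fin n)) = f :=
  NCSeries.ext_coeff fun w => if_pos (wordDeg_one hdeg w)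

theorem coordAt_toR (hdeg : ∀ i, C.hdeg i = 1) (hδ : C.δ = 0) (w : List (Fin n))
    (f : NCSeries (Fin n)) : coordAt C hδ w (C.toR f) = f.coeff w := by
  rw [FormalHomologyConnection.toR, LinearMap.comp_apply, coordAt_mkQ, coeff_truncate C hdeg]

theorem toR_mem_filt (hdeg : ∀ i, C.hdeg i = 1) {k : ℕ} {f : NCSeries (Fin n)}
    (hf : ∀ w : List (Fin n), w.length < k → f.coeff w = 0) : C.toR f ∈ C.filt k :=
  ⟨C.truncate f, fun w hw => by rw [coeff_truncate C hdeg]; exact hf w hw, rfl⟩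

/-- The monomials in DegLex order are an ordered homogeneous basis. -/
theorem isHolonomyBasis_monomial (hdeg : ∀ i, C.hdeg i = 1) (hδ : C.δ = 0) :
    C.IsHolonomyBasis (degLexLT n) List.length (fun w => C.toR (NCSeries.monomial w))
      (coordAt C hδ) := by
  classical
  exact
  { wellOrder := isWellOrder_degLexLT n
    deg_mono := fun u w h => length_le_of_degLexLT h
    v_mem := fun w => toR_mem_filt C hdeg fun u hu => by
      rw [NCSeries.coeff_monomial, if_neg]
      rintro rfl
      exact lt_irrefl _ hu
    span := by
      rintro k _ ⟨f, hf, rfl⟩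
      have hf : ∀ w : List (Fin n), w.length < k → (f : NCSeries (Fin n)).coeff w = 0 := hf
      -- there are only finitely many words of length `k`
      let s := (List.finite_length_eq (Fin n) k).toFinset
      let F : NCSeries (Fin n) := ∑ w ∈ s, (f : NCSeries (Fin n)).coeff w • NCSeries.monomial w
      have hF : ∀ u : List (Fin n), F.coeff u =
          if u.length = k then (f : NCSeries (Fin n)).coeff u else 0 := by
        intro u
        simp only [F, NCSeries.coeff_sum, NCSeries.coeff_smul, NCSeries.coeff_monomial, mul_ite,
          mul_one, mul_zero, Finset.sum_ite_eq]
        simp [s]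
      have hsplit : C.relations.mkQ f = C.toR F + C.toR (f - F) := by
        rw [← map_add, add_sub_cancel]
        exact congrArg _ (Subtype.ext (coeff_truncate C hdeg _).symm)
      rw [hsplit]
      refine Submodule.add_mem_sup ?_ (toR_mem_filt C hdeg fun w hw => ?_)
      · rw [map_sum]
        refine Submodule.sum_mem _ fun w hw => ?_
        rw [map_smul]
        exact Submodule.smul_mem _ _ (Submodule.subset_span
          ⟨w, by simpa [s] using hw, rfl⟩)
      · rw [NCSeries.coeff_sub, hF]
        split_ifs with h
        · exact sub_self _
        · rw [hf w (by omega), sub_self]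
    coord_self := fun w => by rw [coordAt_toR C hdeg, NCSeries.coeff_monomial, if_pos rfl]
    coord_v := fun u w h => by rw [coordAt_toR C hdeg, NCSeries.coeff_monomial, if_neg h]
    coord_filt := by
      rintro w _ ⟨f, hf, rfl⟩
      exact hf w (Nat.lt_succ_self _) }

/-- The Magnus ordering, transported by a free group isomorphism, is the holonomy ordering of a
connection whose holonomy sends the free generators to series with leading terms `1 + X_i`. -/
theorem isHolonomyOrderingOf_magnus (hdeg : ∀ i, C.hdeg i = 1) (hδ : C.δ = 0)
    (e : FreeGroup (Fin n) ≃* LoopGroup U x₀) {T : LoopGroup U x₀ →* NCSeries (Fin n)}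
    (hT0 : ∀ g, (T g).coeff [] = 1)
    (hT1 : ∀ i j, (T (e (FreeGroup.of i))).coeff [j] = if i = j then 1 else 0)
    (hT : C.IsHolonomyMap fun g => C.toR (T g))
    {r : LoopGroup U x₀ ⧸ dimensionInf (LoopGroup U x₀) →
      LoopGroup U x₀ ⧸ dimensionInf (LoopGroup U x₀) → Prop}
    (hr : ∀ a b : FreeGroup (Fin n),
      r (QuotientGroup.mk (e a)) (QuotientGroup.mk (e b)) ↔ MagnusLT n a b) :
    C.IsHolonomyOrderingOf (degLexLT n) (coordAt C hδ) r := by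
  refine ⟨_, hT, fun a b => ?_⟩
  obtain ⟨a, rfl⟩ := e.surjective a
  obtain ⟨b, rfl⟩ := e.surjective b
  rw [hr, magnusLT_iff (T.comp e.toMonoidHom) (fun i => hT0 _) hT1]
  simp only [coordAt_toR C hdeg]
  rfl

end Coordinates

end

/-! ### The Magnus ordering as a holonomy ordering -/

/-- The Magnus ordering of the free group `F_n = π₁(D_n)` is a holonomy ordering. It is the holonomy
ordering of the connection `∑ ω_i X_i` with `δ = 0` and of the DegLex-ordered basis of monomials,
for every choice of free generators of `π₁(D_n)` and every dual system of closed forms with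
`ω_i ∧ ω_j = 0`; such systems exist. -/
theorem proposition3p4 (n : ℕ) (p : Fin n → ℂ) (hp : Function.Injective p)
    (hdisc : ∀ i, ‖p i‖ < 1) (x₀ : puncturedDisc p) :
    Nonempty (FreeGroup (Fin n) ≃* LoopGroup (puncturedDisc p) x₀) ∧
    dimensionInf (LoopGroup (puncturedDisc p) x₀) = ⊥ ∧
    ∀ e : FreeGroup (Fin n) ≃* LoopGroup (puncturedDisc p) x₀,
      ∃ r : LoopGroup (puncturedDisc p) x₀ ⧸ dimensionInf (LoopGroup (puncturedDisc p) x₀) →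
          LoopGroup (puncturedDisc p) x₀ ⧸ dimensionInf (LoopGroup (puncturedDisc p) x₀) → Prop,
        (∀ a b : FreeGroup (Fin n),
          r (QuotientGroup.mk (e a)) (QuotientGroup.mk (e b)) ↔ MagnusLT n a b) ∧
        IsHolonomyOrdering (puncturedDisc p) x₀ r ∧
        (∃ ω : Fin n → ℂ → ℂ [⋀^Fin 1]→L[ℝ] ℝ,
          IsDualFlatSystem (fun i => e (FreeGroup.of i)) ω) ∧
        ∀ ω : Fin n → ℂ → ℂ [⋀^Fin 1]→L[ℝ] ℝ,
          IsDualFlatSystem (fun i => e (FreeGroup.of i)) ω →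
          ∃ C : FormalHomologyConnection (puncturedDisc p) (Fin n),
            (∀ i, C.hdeg i = 1) ∧ C.ω = linearForm ω ∧ C.δ = 0 ∧
            (∃ T : LoopGroup (puncturedDisc p) x₀ →* NCSeries (Fin n),
              Function.Injective T ∧
              (∀ γ : Path x₀ x₀, PiecewiseSmooth γ → T (loopClass γ) = C.transport γ) ∧
              C.IsHolonomyMap fun g => C.toR (T g)) ∧
            ∃ coord : List (Fin n) → C.R →ₗ[ℝ] ℝ,
              C.IsHolonomyBasis (degLexLT n) List.length
                (fun w => C.toR (NCSeries.monomial w)) coord ∧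
              C.IsHolonomyOrderingOf (degLexLT n) coord r := by
  obtain ⟨q, ε, h⟩ := exists_isSlitCentre hp (x₀ := x₀) x₀.2.2
  obtain ⟨g, hg⟩ := exists_generators_puncturedDisc hdisc h
  have hU := isOpen_puncturedDisc p
  have hconn := isPathConnected_puncturedDisc h hdisc
  obtain ⟨ω₀, hω₀, hdual₀⟩ := exists_dual_isFlatSystem hdisc h hg
  have hinj : ∀ (e : FreeGroup (Fin n) ≃* LoopGroup (puncturedDisc p) x₀)
      {ω : Fin n → ℂ → ℂ [⋀^Fin 1]→L[ℝ] ℝ} (hω : IsFlatSystem ω (puncturedDisc p)),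
      (∀ i j, period hU (ω i) (e (FreeGroup.of j)).unop.toPath = if i = j then 1 else 0) →
      Function.Injective (holonomy hU hω x₀) := by
    intro e ω hω hdual
    have := holonomy_comp_injective hU hω hdual
    rw [lift_of_eq] at this
    exact Function.Injective.of_comp_right this e.surjective
  have hbot : dimensionInf (LoopGroup (puncturedDisc p) x₀) = ⊥ := by
    refine dimensionInf_eq_bot_of_injective (holonomy hU hω₀ x₀)
      (hinj (freeGroupEquiv hU hω₀ hg hdual₀) hω₀ fun i j => ?_)
      fun g => classTransport_coeff_nil hU _
    rw [show freeGroupEquiv hU hω₀ hg hdual₀ (FreeGroup.of j) = g j from FreeGroup.lift_apply_of]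
    exact hdual₀ i j
  refine ⟨⟨freeGroupEquiv hU hω₀ hg hdual₀⟩, hbot, fun e => ?_⟩
  have hmk : ∀ a b : FreeGroup (Fin n),
      (QuotientGroup.mk (e a) : _ ⧸ dimensionInf (LoopGroup (puncturedDisc p) x₀)) =
        QuotientGroup.mk (e b) → a = b := by
    intro a b hab
    rw [QuotientGroup.eq, hbot, Subgroup.mem_bot, inv_mul_eq_one] at hab
    exact e.injective hab
  let r : LoopGroup (puncturedDisc p) x₀ ⧸ dimensionInf (LoopGroup (puncturedDisc p) x₀) →
      LoopGroup (puncturedDisc p) x₀ ⧸ dimensionInf (LoopGroup (puncturedDisc p) x₀) → Prop :=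
    fun x y => ∃ a b : FreeGroup (Fin n), x = QuotientGroup.mk (e a) ∧
      y = QuotientGroup.mk (e b) ∧ MagnusLT n a b
  have hr : ∀ a b : FreeGroup (Fin n),
      r (QuotientGroup.mk (e a)) (QuotientGroup.mk (e b)) ↔ MagnusLT n a b := by
    refine fun a b => ⟨?_, fun hab => ⟨a, b, rfl, rfl, hab⟩⟩
    rintro ⟨a', b', ha, hb, hab⟩
    rwa [hmk _ _ ha, hmk _ _ hb]
  have hgen := closure_range_of e
  obtain ⟨ω, hω, hdual⟩ := exists_dual_isFlatSystem hdisc h hgen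
  -- the connection, its faithful holonomy and its ordering, for an arbitrary dual system
  have main : ∀ ω : Fin n → ℂ → ℂ [⋀^Fin 1]→L[ℝ] ℝ,
      IsDualFlatSystem (fun i => e (FreeGroup.of i)) ω →
      ∃ C : FormalHomologyConnection (puncturedDisc p) (Fin n),
        (∀ i, C.hdeg i = 1) ∧ C.ω = linearForm ω ∧ C.δ = 0 ∧
        (∃ T : LoopGroup (puncturedDisc p) x₀ →* NCSeries (Fin n), Function.Injective T ∧
          (∀ γ : Path x₀ x₀, PiecewiseSmooth γ → T (loopClass γ) = C.transport γ) ∧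
          C.IsHolonomyMap fun g => C.toR (T g)) ∧
        ∃ coord : List (Fin n) → C.R →ₗ[ℝ] ℝ,
          C.IsHolonomyBasis (degLexLT n) List.length
            (fun w => C.toR (NCSeries.monomial w)) coord ∧
          C.IsHolonomyOrderingOf (degLexLT n) coord r := by
    intro ω hω
    have hflat := hω.isFlatSystem
    have hdual := hω.period_eq hU
    let C := linearConnection hU hconn (fun θ hθ => exists_primitive_twoForm hp hdisc hθ) hflat
      hgen hdual
    have hT : ∀ γ : Path x₀ x₀, PiecewiseSmooth γ →
        holonomy hU hflat x₀ (loopClass γ) = C.transport γ := fun γ hγ =>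
      (holonomy_loopClass hU hflat hγ).trans (transport_linearForm C rfl γ).symm
    have hmap : C.IsHolonomyMap fun g => C.toR (holonomy hU hflat x₀ g) :=
      ⟨exists_piecewiseSmooth hU, fun γ hγ => congrArg C.toR (hT γ hγ)⟩
    refine ⟨C, fun _ => rfl, rfl, rfl, ⟨holonomy hU hflat x₀, hinj e hflat hdual, hT, hmap⟩,
      coordAt C rfl, isHolonomyBasis_monomial C (fun _ => rfl) rfl,
      isHolonomyOrderingOf_magnus C (fun _ => rfl) rfl e
        (fun g => classTransport_coeff_nil hU _) (fun i j => ?_) hmap hr⟩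
    refine (classTransport_coeff_singleton hU _ _).trans ((hdual j i).trans ?_)
    simp only [eq_comm]
  have hdualω := hω.isDualFlatSystem hU hdual
  refine ⟨r, hr, ⟨hU, hconn.isConnected, ?_⟩, ⟨ω, hdualω⟩, main⟩
  obtain ⟨C, -, -, -, -, coord, hbasis, hord⟩ := main ω hdualω
  exact ⟨n, C, _, _, _, _, coord, hbasis, hord⟩
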